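/- A \emph{colored stochastic dataset} with $n\ge 0$ points in $\mathbb{R}^2$ consists of $n$ pairwise distinct points $a_1,\dots,a_n\in\mathbb{R}^2$, each with a color $\mathrm{cl}(a_i)\in\mathbb{N}$ and an existence probability $\pi(a_i)\in[0,1]$. A \emph{realization} is a random subset $R\subseteq\{a_1,\dots,a_n\}$ that contains each $a_i$ independently with probability $\pi(a_i)$. For an orthogonal basis $B=(\mathbf{b}_1,\mathbf{b}_2)$ of $\mathbb{R}^2$, a point $p$ \emph{dominates} a point $q$ with respect to $B$ if $\langle\mathbf{b}_i,p\rangle\ge\langle\mathbf{b}_i,q\rangle$ for $i=1,2$, and $R$ contains an \emph{inter-color dominance} with respect to $B$ if there are $a,b\in R$ with $\mathrm{cl}(a)\ne\mathrm{cl}(b)$ such that $a$ dominates $b$ with respect to $B$. Let $\Lambda^*$ be the probability that a realization contains, for every orthogonal basis $B$ of $\mathbb{R}^2$, an inter-color dominance with respect to $B$. The free-basis colored stochastic dominance (FBCSD) problem in $\mathbb{R}^2$ is to compute $\Lambda^*$ (equivalently, $1-\Lambda^*$) from the points, colors and probabilities. \textbf{Theorem.} The FBCSD problem in $\mathbb{R}^2$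 can be solved in $O(n^4\log^2 n)$ time on a real RAM: there are a single program (independent of $n$) and a function $T:\mathbb{N}\to\mathbb{N}$ with $T(n)=O(n^4\log^2 n)$ as $n\to\infty$ such that, for every $n$ and every colored stochastic dataset with $n$ points in $\mathbb{R}^2$, the program stops after at most $T(n)$ steps with output exactly $\Lambda^*$. (A real RAM stores natural numbers and real numbers in indexed memory; in unit time each it can add, subtract (truncated at $0$) and compare natural numbers, use them as memory addresses, add, subtract, multiply, divide and compare real numbers, read or write a memory cell, and branch.) -/

import Mathlib

/-! ### Colored stochastic datasets and the free-basis dominance probability -/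

/-- A colored stochastic dataset in `ℝ^d` with `n` points: pairwise distinct points
`a_0, …, a_{n-1}`, each with a color and an existence probability. -/
structure ColoredStochasticDataset (d n : ℕ) where
  point : Fin n → EuclideanSpace ℝ (Fin d)
  point_injective : Function.Injective point
  color : Fin n → ℕ
  prob : Fin n → ℝ
  prob_mem : ∀ i, prob i ∈ Set.Icc (0 : ℝ) 1

/-- A basis of `ℝ^d` whose vectors are pairwise orthogonal. -/
def IsOrthogonalBasis {d : ℕ} (B : Module.Basis (Fin d) ℝ (EuclideanSpace ℝ (Fin d))) : Prop :=
  ∀ i j, i ≠ j → inner ℝ (B i) (B j) = 0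

/-- `p` dominates `q` with respect to the basis `B`. -/
def DominatesWrt {d : ℕ} (B : Module.Basis (Fin d) ℝ (EuclideanSpace ℝ (Fin d)))
    (p q : EuclideanSpace ℝ (Fin d)) : Prop :=
  ∀ i, inner ℝ (B i) q ≤ inner ℝ (B i) p

namespace ColoredStochasticDataset

/-- The set of points with indices in `R` contains an inter-color dominance with respect to `B`. -/
def HasInterColorDominance {d n : ℕ} (S : ColoredStochasticDataset d n)
    (B : Module.Basis (Fin d) ℝ (EuclideanSpace ℝ (Fin d))) (R : Finset (Fin n)) : Prop :=
  ∃ i ∈ R, ∃ j ∈ R, S.color i ≠ S.color j ∧ DominatesWrt B (S.point i) (S.point j)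

/-- The probability that the realization consists exactly of the points with indices in `R`,
the points existing independently with their existence probabilities. -/
def realizationProb {d n : ℕ} (S : ColoredStochasticDataset d n) (R : Finset (Fin n)) : ℝ :=
  (∏ i ∈ R, S.prob i) * ∏ i ∈ Rᶜ, (1 - S.prob i)

open Classical in
/-- The probability that a realization contains inter-color dominances with respect to every
orthogonal basis of `ℝ^d`. -/
noncomputable def freeBasisDominanceProb {d n : ℕ} (S : ColoredStochasticDataset d n) : ℝ :=
  ∑ R : Finset (Fin n),
    if ∀ B : Module.Basis (Fin d) ℝ (EuclideanSpace ℝ (Fin d)),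
        IsOrthogonalBasis B → S.HasInterColorDominance B R
    then S.realizationProb R else 0

end ColoredStochasticDataset

/-! ### The real RAM

Programs run on a memory holding natural numbers and a memory holding real numbers.
Natural numbers can be added, subtracted, compared, and used as addresses; real numbers can be
added, subtracted, multiplied, divided, and compared. There are no other operations: in particular
no rounding, no conversion from reals to naturals and no real constants besides the naturals.
Every operation, memory access, assignment and branching costs one time unit. -/

namespace RealRAM

/-- Memory contents. Memory is organized in arrays: `s.nat a k` and `s.real a k` are the `k`-th
cells of the `a`-th array of naturals and of the `a`-th array of reals. The name `a` of an
array is fixed in the program text, so a program uses only finitely many arrays; the index `k` may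
be computed at run time. -/
@[ext]
structure State where
  nat : ℕ → ℕ → ℕ
  real : ℕ → ℕ → ℝ

/-- The memory after writing `v` to cell `k` of the array `a` of naturals. -/
def State.setNat (s : State) (a k v : ℕ) : State where
  nat := Function.update s.nat a (Function.update (s.nat a) k v)
  real := s.real

/-- The memory after writing `v` to cell `k` of the array `a` of reals. -/
noncomputable def State.setReal (s : State) (a k : ℕ) (v : ℝ) : State where
  nat := s.nat
  real := Function.update s.real a (Function.update (s.real a) k v)

/-- Expressions with natural number values. -/
inductive NatExpr where
  | const (k : ℕ)
  | get (a : ℕ) (i : NatExpr)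
  | add (e f : NatExpr)
  | sub (e f : NatExpr)

/-- The value of an expression; the subtraction is the truncated one. -/
def NatExpr.eval (s : State) : NatExpr → ℕ
  | const k => k
  | get a i => s.nat a (i.eval s)
  | add e f => e.eval s + f.eval s
  | sub e f => e.eval s - f.eval s

/-- The cost of evaluating an expression: one unit per node. -/
def NatExpr.cost : NatExpr → ℕ
  | const _ => 1
  | get _ i => i.cost + 1
  | add e f => e.cost + f.cost + 1
  | sub e f => e.cost + f.cost + 1

/-- Expressions with real values. -/
inductive RealExpr where
  | const (k : ℕ)
  | get (a : ℕ) (i : NatExpr)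
  | add (e f : RealExpr)
  | sub (e f : RealExpr)
  | mul (e f : RealExpr)
  | div (e f : RealExpr)

/-- The value of an expression. A division by zero returns zero; this gives no additional power,
since a program can test whether a denominator is zero. -/
noncomputable def RealExpr.eval (s : State) : RealExpr → ℝ
  | const k => k
  | get a i => s.real a (i.eval s)
  | add e f => e.eval s + f.eval s
  | sub e f => e.eval s - f.eval s
  | mul e f => e.eval s * f.eval s
  | div e f => e.eval s / f.eval s

/-- The cost of evaluating an expression: one unit per node. -/
def RealExpr.cost : RealExpr → ℕ
  | const _ => 1
  | get _ i => i.cost + 1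
  | add e f => e.cost + f.cost + 1
  | sub e f => e.cost + f.cost + 1
  | mul e f => e.cost + f.cost + 1
  | div e f => e.cost + f.cost + 1

/-- Conditions for branching. -/
inductive Test where
  | natLt (e f : NatExpr)
  | natEq (e f : NatExpr)
  | realLt (e f : RealExpr)
  | realEq (e f : RealExpr)
  | not (b : Test)
  | and (b c : Test)

/-- The condition holds in the given memory. -/
def Test.Holds (s : State) : Test → Prop
  | natLt e f => e.eval s < f.eval s
  | natEq e f => e.eval s = f.eval s
  | realLt e f => e.eval s < f.eval s
  | realEq e f => e.eval s = f.eval s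
  | not b => ¬ b.Holds s
  | and b c => b.Holds s ∧ c.Holds s

/-- The cost of evaluating a condition: one unit per node. -/
def Test.cost : Test → ℕ
  | natLt e f => e.cost + f.cost + 1
  | natEq e f => e.cost + f.cost + 1
  | realLt e f => e.cost + f.cost + 1
  | realEq e f => e.cost + f.cost + 1
  | not b => b.cost + 1
  | and b c => b.cost + c.cost + 1

/-- Programs. -/
inductive Program where
  | skip
  | setNat (a : ℕ) (i e : NatExpr)
  | setReal (a : ℕ) (i : NatExpr) (e : RealExpr)
  | seq (p q : Program)
  | ite (b : Test) (p q : Program)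
  | while (b : Test) (p : Program)

/-- `Exec p s t s'`: started with memory `s`, the program `p` terminates after exactly `t` time
units with memory `s'`. -/
inductive Exec : Program → State → ℕ → State → Prop where
  | skip (s : State) : Exec .skip s 1 s
  | setNat (s : State) (a : ℕ) (i e : NatExpr) :
      Exec (.setNat a i e) s (i.cost + e.cost + 1) (s.setNat a (i.eval s) (e.eval s))
  | setReal (s : State) (a : ℕ) (i : NatExpr) (e : RealExpr) :
      Exec (.setReal a i e) s (i.cost + e.cost + 1) (s.setReal a (i.eval s) (e.eval s))
  | seq {p q : Program} {s s' s'' : State} {t t' : ℕ} :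
      Exec p s t s' → Exec q s' t' s'' → Exec (.seq p q) s (t + t') s''
  | iteTrue {b : Test} {p q : Program} {s s' : State} {t : ℕ} :
      b.Holds s → Exec p s t s' → Exec (.ite b p q) s (b.cost + t + 1) s'
  | iteFalse {b : Test} {p q : Program} {s s' : State} {t : ℕ} :
      ¬ b.Holds s → Exec q s t s' → Exec (.ite b p q) s (b.cost + t + 1) s'
  | whileTrue {b : Test} {p : Program} {s s' s'' : State} {t t' : ℕ} :
      b.Holds s → Exec p s t s' → Exec (.while b p) s' t' s'' →
      Exec (.while b p) s (b.cost + t + t' + 1) s''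
  | whileFalse {b : Test} {p : Program} {s : State} :
      ¬ b.Holds s → Exec (.while b p) s (b.cost + 1) s

end RealRAM

/-- The initial memory for a planar dataset as input. The number `n` of points is in cell `0` of
the array `0` of naturals, the colors are in the array `1` of naturals; the `x`-coordinates, the
`y`-coordinates and the existence probabilities are in the arrays `0`, `1` and `2` of reals. All
other cells contain zero. -/
noncomputable def ColoredStochasticDataset.initialState {n : ℕ}
    (S : ColoredStochasticDataset 2 n) : RealRAM.State where
  nat a k :=
    if a = 0 ∧ k = 0 then n
    else if h : a = 1 ∧ k < n then S.color ⟨k, h.2⟩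
    else 0
  real a k :=
    if h : k < n then
      if a = 0 then S.point ⟨k, h⟩ 0
      else if a = 1 then S.point ⟨k, h⟩ 1
      else if a = 2 then S.prob ⟨k, h⟩
      else 0
    else 0

/-- The answer of a program: the content of cell `0` of the array `3` of reals. -/
def RealRAM.State.output (s : RealRAM.State) : ℝ := s.real 3 0

/-! Consider the complementary event: some orthogonal basis admits no inter-color dominance in the
realization R. Up to a quarter turn this says that for some nonzero direction d all differences of
points of different colors in R lie in the open first or third quadrant of the coordinate system
whose first axis is d (`OpenDir`, `exists_orthogonalBasis_iff`).

If R is monochromatic, every direction is good. Otherwise a good direction can be turned until it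
first meets a difference of two points of different colors. There the quadrant condition holds with
the first axis included (`HalfOpenDir`) but not with it excluded. Such a boundary direction exists
as soon as a good direction does (`OpenDir.exists_halfOpenDir`), a small turn back from it gives a
good direction (`HalfOpenDir.exists_openDir`), and it is unique up to scaling
(`HalfOpenDir.parallel`). Hence the indicator of the event is the indicator of "monochromatic" plus
the sum over all ordered pairs (a, b) of the difference of the indicators of `HalfOpenDir` and
`OpenDir` at b - a, divided by the number of ordered pairs parallel to b - a
(`indicator_exists_openDir`). Taking expectations leaves at most 2n² + 1 probabilities to compute.

Each of these is the probability that R is concordant for two linear orders: points of different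
colors must be in the same order in both. The orders are lexicographic, and their tie-breaking
decides which axes are admitted (`lexConcordant_opposite`, `lexConcordant_halfOpen`,
`lexConcordant_open`).

The weight of a realization is a constant times a product of odds r/(1 - r), once the points of
probability one are removed (`sum_existProb_concordant`). The concordant sets are sorted by their
maximal ranks a and b in the two orders (`cornerSum`). The points i and j with these ranks have the
same color. Cutting R, in the first order, behind the last point of another color leaves a smaller
concordant set with maximal ranks t and b', and behind the cut an arbitrary set of points of the
color of i in a box, subject only to containing i and j. The odds of these free sets sum to a closed
product (`sum_prod_odds_superset`). That product splits into a part free of b' and a part free of j,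
so the double sum over t and b' can be done in two stages, the inner one being `partialSum`
(`cornerSum_eq`).

Both stages are sums of terms S k times the product of the A l with l < k. A binary tree over the
leaves evaluates such prefix sums and changes single factors or summands along one path
(`run_treeQuery`, `run_treeSetFactor`, `run_treeSetSum`). A row of corner sums comes from one sweep
in the second order. The partial sums of a row come from one sweep through the color classes that
switches factors on and off (`allEvents`). Each row therefore needs linearly many tree operations.

There are n² pairs, n + 1 rows for each and O(n) tree operations per row, each of cost proportional
to the height of the tree. The time is read off from the nesting depth of the loops (`time_le`,
`time_whole_le`). -/

/-! ### Commands with bounded loops -/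

namespace RealRAM

/-- The natural number scalar stored in cell `0` of the array `a`. -/
abbrev natVar (a : ℕ) : NatExpr := .get a (.const 0)

/-- The real scalar stored in cell `0` of the array `a`. -/
abbrev realVar (a : ℕ) : RealExpr := .get a (.const 0)

/-- The disjunction of two conditions. -/
abbrev Test.or (b c : Test) : Test := .not (.and (.not b) (.not c))

/-- Commands all of whose loops are counting loops: `loop v b p` runs `p` for the values
`0, 1, …, m - 1` of the scalar `v`, where `m` is the value of the scalar `b`. -/
inductive Cmd where
  | skip
  | setNat (a : ℕ) (i e : NatExpr)
  | setReal (a : ℕ) (i : NatExpr) (e : RealExpr)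
  | seq (p q : Cmd)
  | ite (b : Test) (p q : Cmd)
  | loop (v b : ℕ) (p : Cmd)

/-- Sequential composition. -/
infixr:60 " ;; " => Cmd.seq

namespace Cmd

/-- The program of a command. -/
def toProgram : Cmd → Program
  | skip => .skip
  | setNat a i e => .setNat a i e
  | setReal a i e => .setReal a i e
  | seq p q => .seq p.toProgram q.toProgram
  | ite b p q => .ite b p.toProgram q.toProgram
  | loop v b p => .seq (.setNat v (.const 0) (.const 0))
      (.while (.natLt (natVar v) (natVar b))
        (.seq p.toProgram (.setNat v (.const 0) (.add (natVar v) (.const 1)))))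

/-- The memory after `k` rounds of a counting loop with body `f` and counter `v`. -/
def iterate (v : ℕ) (f : State → State) (s : State) : ℕ → State
  | 0 => s.setNat v 0 0
  | k + 1 => (f (iterate v f s k)).setNat v 0 (k + 1)

open Classical in
/-- The effect of a command on the memory. -/
noncomputable def run : Cmd → State → State
  | skip, s => s
  | setNat a i e, s => s.setNat a (i.eval s) (e.eval s)
  | setReal a i e, s => s.setReal a (i.eval s) (e.eval s)
  | seq p q, s => q.run (p.run s)
  | ite b p q, s => if b.Holds s then p.run s else q.run s
  | loop v b p, s => iterate v p.run s (s.nat b 0)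

/-- The arrays of naturals that a command may change. -/
def natWrites : Cmd → List ℕ
  | skip => []
  | setNat a _ _ => [a]
  | setReal _ _ _ => []
  | seq p q => p.natWrites ++ q.natWrites
  | ite _ p q => p.natWrites ++ q.natWrites
  | loop v _ p => v :: p.natWrites

/-- The arrays of reals that a command may change. -/
def realWrites : Cmd → List ℕ
  | skip => []
  | setNat _ _ _ => []
  | setReal a _ _ => [a]
  | seq p q => p.realWrites ++ q.realWrites
  | ite _ p q => p.realWrites ++ q.realWrites
  | loop _ _ p => p.realWrites

/-- The scalars that bound the loops of a command. -/
def bounds : Cmd → List ℕ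
  | skip => []
  | setNat _ _ _ => []
  | setReal _ _ _ => []
  | seq p q => p.bounds ++ q.bounds
  | ite _ p q => p.bounds ++ q.bounds
  | loop _ b p => b :: p.bounds

/-- No loop body changes the loop counter. -/
def CountersSafe : Cmd → Bool
  | skip => true
  | setNat _ _ _ => true
  | setReal _ _ _ => true
  | seq p q => p.CountersSafe && q.CountersSafe
  | ite _ p q => p.CountersSafe && q.CountersSafe
  | loop v _ p => p.CountersSafe && !(p.natWrites.contains v)

/-- No loop body changes a loop counter, and no loop bound is changed. -/
def Safe (c : Cmd) : Bool :=
  c.CountersSafe && c.bounds.all fun b => !(c.natWrites.contains b)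

/-- A bound for the running time, where `ρ` gives the values of the loop bounds. -/
def time (ρ : ℕ → ℕ) : Cmd → ℕ
  | skip => 1
  | setNat _ i e => i.cost + e.cost + 1
  | setReal _ i e => i.cost + e.cost + 1
  | seq p q => p.time ρ + q.time ρ
  | ite b p q => b.cost + (p.time ρ + q.time ρ) + 1
  | loop _ b p => 9 + ρ b * (12 + p.time ρ)

end Cmd

/-! ### Memory lemmas -/

@[simp] theorem State.setNat_nat (s : State) (a k v b : ℕ) :
    (s.setNat a k v).nat b = if b = a then Function.update (s.nat a) k v else s.nat b := by
  by_cases h : b = a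
  · subst h; simp [State.setNat]
  · simp [State.setNat, h]

@[simp] theorem State.setNat_real (s : State) (a k v : ℕ) : (s.setNat a k v).real = s.real := rfl

@[simp] theorem State.setReal_real (s : State) (a k : ℕ) (v : ℝ) (b : ℕ) :
    (s.setReal a k v).real b = if b = a then Function.update (s.real a) k v else s.real b := by
  by_cases h : b = a
  · subst h; simp [State.setReal]
  · simp [State.setReal, h]

@[simp] theorem State.setReal_nat (s : State) (a k : ℕ) (v : ℝ) : (s.setReal a k v).nat = s.nat :=
  rfl

attribute [simp] NatExpr.eval RealExpr.eval Test.Holds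

namespace Cmd

@[simp] theorem run_skip (s : State) : skip.run s = s := rfl

@[simp] theorem run_setNat (a : ℕ) (i e : NatExpr) (s : State) :
    (setNat a i e).run s = s.setNat a (i.eval s) (e.eval s) := rfl

@[simp] theorem run_setReal (a : ℕ) (i : NatExpr) (e : RealExpr) (s : State) :
    (setReal a i e).run s = s.setReal a (i.eval s) (e.eval s) := rfl

@[simp] theorem run_seq (p q : Cmd) (s : State) : (p ;; q).run s = q.run (p.run s) := rfl

open Classical in
@[simp] theorem run_ite (b : Test) (p q : Cmd) (s : State) :
    (ite b p q).run s = if b.Holds s then p.run s else q.run s := rfl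

/-! ### Frame conditions and the loop rule -/

/-- The two memories agree outside of the arrays that `c` may change. -/
structure Frame (c : Cmd) (s t : State) : Prop where
  nat : ∀ a, a ∉ c.natWrites → t.nat a = s.nat a
  real : ∀ a, a ∉ c.realWrites → t.real a = s.real a

theorem frame_iterate {v b : ℕ} {p : Cmd} (hp : ∀ s, Frame p s (p.run s)) (s : State) (k : ℕ) :
    Frame (loop v b p) s (iterate v p.run s k) := by
  induction k with
  | zero =>
    refine ⟨fun a ha => ?_, fun a _ => rfl⟩
    have : a ≠ v := fun h => ha (by simp [natWrites, h])
    simp [iterate, this]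
  | succ k ih =>
    refine ⟨fun a ha => ?_, fun a ha => ?_⟩
    · simp only [natWrites, List.mem_cons, not_or] at ha
      simp only [iterate, State.setNat_nat, ha.1, if_false]
      rw [(hp _).nat a ha.2, ih.nat a (by simp [natWrites, ha])]
    · simp only [iterate, State.setNat_real]
      rw [(hp _).real a ha, ih.real a ha]

/-- Array names are fixed in the program text, so the arrays a command can touch form a concrete
list. Later proofs preserve everything else merely by deciding non-membership in it. -/
theorem frame_run (c : Cmd) (s : State) : Frame c s (c.run s) := by
  induction c generalizing s with
  | skip => exact ⟨fun _ _ => rfl, fun _ _ => rfl⟩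
  | setNat a i e =>
    refine ⟨fun b hb => ?_, fun b _ => rfl⟩
    have : b ≠ a := by simpa [natWrites] using hb
    simp [this]
  | setReal a i e =>
    refine ⟨fun b _ => rfl, fun b hb => ?_⟩
    have : b ≠ a := by simpa [realWrites] using hb
    simp [this]
  | seq p q hp hq =>
    refine ⟨fun b hb => ?_, fun b hb => ?_⟩
    · simp only [natWrites, List.mem_append, not_or] at hb
      rw [run, (hq _).nat b hb.2, (hp _).nat b hb.1]
    · simp only [realWrites, List.mem_append, not_or] at hb
      rw [run, (hq _).real b hb.2, (hp _).real b hb.1]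
  | ite t p q hp hq =>
    refine ⟨fun b hb => ?_, fun b hb => ?_⟩
    · simp only [natWrites, List.mem_append, not_or] at hb
      rw [run]; split
      · exact (hp _).nat b hb.1
      · exact (hq _).nat b hb.2
    · simp only [realWrites, List.mem_append, not_or] at hb
      rw [run]; split
      · exact (hp _).real b hb.1
      · exact (hq _).real b hb.2
  | loop v b p hp => exact frame_iterate hp s _

theorem run_nat {c : Cmd} {s : State} (a : ℕ) (h : a ∉ c.natWrites) :
    (c.run s).nat a = s.nat a := (frame_run c s).nat a h

theorem run_real {c : Cmd} {s : State} (a : ℕ) (h : a ∉ c.realWrites) :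
    (c.run s).real a = s.real a := (frame_run c s).real a h

theorem iterate_counter (v : ℕ) (f : State → State) (s : State) (k : ℕ) :
    (iterate v f s k).nat v 0 = k := by
  cases k <;> simp [iterate]

/-- The invariant rule for counting loops. -/
theorem run_loop {v b : ℕ} {p : Cmd} {s : State} (Inv : ℕ → State → Prop)
    (h0 : Inv 0 (s.setNat v 0 0))
    (step : ∀ k st, k < s.nat b 0 → st.nat v 0 = k → Frame (loop v b p) s st → Inv k st →
      Inv (k + 1) ((p.run st).setNat v 0 (k + 1))) :
    Inv (s.nat b 0) ((loop v b p).run s) := by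
  have key : ∀ k, k ≤ s.nat b 0 → Inv k (iterate v p.run s k) := by
    intro k
    induction k with
    | zero => intro _; exact h0
    | succ k ih =>
      intro hk
      exact step k _ hk (iterate_counter v _ s k) (frame_iterate (frame_run p) s k)
        (ih (Nat.le_of_succ_le hk))
  exact key _ le_rfl

/-! ### Execution and running time of commands -/

/-- The body of a loop changes neither its counter nor its bound, so the test of the while loop
succeeds exactly as often as `iterate` prescribes on entry. -/
theorem exec_of_safe {ρ : ℕ → ℕ} (c : Cmd) (hc : c.CountersSafe) (s : State)
    (hb : ∀ b ∈ c.bounds, s.nat b 0 = ρ b) (hw : ∀ b ∈ c.bounds, b ∉ c.natWrites) :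
    ∃ t ≤ c.time ρ, Exec c.toProgram s t (c.run s) := by
  induction c generalizing s with
  | skip => exact ⟨1, le_rfl, .skip s⟩
  | setNat a i e => exact ⟨_, le_rfl, .setNat s a i e⟩
  | setReal a i e => exact ⟨_, le_rfl, .setReal s a i e⟩
  | seq p q hp hq =>
    simp only [CountersSafe, Bool.and_eq_true] at hc
    simp only [bounds, natWrites, List.mem_append, not_or] at hb hw
    obtain ⟨t, ht, e⟩ := hp hc.1 s (fun b h => hb b (.inl h)) (fun b h => (hw b (.inl h)).1)
    obtain ⟨t', ht', e'⟩ := hq hc.2 (p.run s)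
      (fun b h => by rw [run_nat b (hw b (.inr h)).1]; exact hb b (.inr h))
      (fun b h => (hw b (.inr h)).2)
    exact ⟨t + t', Nat.add_le_add ht ht', .seq e e'⟩
  | ite t p q hp hq =>
    simp only [CountersSafe, Bool.and_eq_true] at hc
    simp only [bounds, natWrites, List.mem_append, not_or] at hb hw
    obtain ⟨t1, ht1, e1⟩ := hp hc.1 s (fun b h => hb b (.inl h)) (fun b h => (hw b (.inl h)).1)
    obtain ⟨t2, ht2, e2⟩ := hq hc.2 s (fun b h => hb b (.inr h)) (fun b h => (hw b (.inr h)).2)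
    by_cases h : t.Holds s
    · refine ⟨_, ?_, by simpa only [run, if_pos h, toProgram] using Exec.iteTrue h e1⟩
      simp only [time]; omega
    · refine ⟨_, ?_, by simpa only [run, if_neg h, toProgram] using Exec.iteFalse h e2⟩
      simp only [time]; omega
  | loop v b p hp =>
    simp only [CountersSafe, Bool.and_eq_true, Bool.not_eq_true', List.contains_eq_mem,
      decide_eq_false_iff_not] at hc
    simp only [bounds, natWrites, List.mem_cons, not_or, forall_eq_or_imp] at hb hw
    have frame := fun k => frame_iterate (v := v) (b := b) (frame_run p) s k
    have hbn : ∀ k, (iterate v p.run s k).nat b 0 = ρ b := fun k => by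
      rw [(frame k).nat b (by simp [natWrites, hw.1]), hb.1]
    -- Induction on the number `d` of remaining rounds. A round costs 6 for the successful test and
    -- 6 for the increment, apart from the body; the final failing test costs 6. With 3 for the
    -- initial assignment this gives the constants 12 and 9 of `time`.
    have loop : ∀ d k, k + d = ρ b → ∃ t ≤ d * (12 + p.time ρ) + 6,
        Exec (.while (.natLt (natVar v) (natVar b))
          (.seq p.toProgram (.setNat v (.const 0) (.add (natVar v) (.const 1)))))
          (iterate v p.run s k) t (iterate v p.run s (ρ b)) := by
      intro d
      induction d with
      | zero =>
        intro k hk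
        obtain rfl : k = ρ b := by omega
        refine ⟨6, by omega, ?_⟩
        exact Exec.whileFalse (by simp [iterate_counter, hbn])
      | succ d ih =>
        intro k hk
        obtain ⟨t', ht', e'⟩ := ih (k + 1) (by omega)
        obtain ⟨t, ht, e⟩ := hp hc.1 (iterate v p.run s k)
          (fun b' h' => by
            rw [(frame k).nat b' (by simp [natWrites, hw.2 b' h']), hb.2 b' h'])
          (fun b' h' => (hw.2 b' h').2)
        have hinc : Exec (.setNat v (.const 0) (.add (natVar v) (.const 1)))
            (p.run (iterate v p.run s k)) 6 (iterate v p.run s (k + 1)) := by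
          have := Exec.setNat (p.run (iterate v p.run s k)) v (.const 0)
            (.add (natVar v) (.const 1))
          simpa [iterate, NatExpr.cost, run_nat v hc.2, iterate_counter] using this
        have hlt : (Test.natLt (natVar v) (natVar b)).Holds (iterate v p.run s k) := by
          simp [iterate_counter, hbn]; omega
        refine ⟨_, ?_, Exec.whileTrue hlt (.seq e hinc) e'⟩
        simp only [Test.cost, NatExpr.cost]
        rw [Nat.add_mul, one_mul]
        omega
    obtain ⟨t, ht, e⟩ := loop (ρ b) 0 (by omega)
    refine ⟨3 + t, by simp only [time]; omega, ?_⟩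
    rw [run, hb.1]
    exact Exec.seq (Exec.setNat s v (.const 0) (.const 0)) e

theorem exec_of_safe' {ρ : ℕ → ℕ} (c : Cmd) (hc : c.Safe) (s : State)
    (hb : ∀ b ∈ c.bounds, s.nat b 0 = ρ b) :
    ∃ t ≤ c.time ρ, Exec c.toProgram s t (c.run s) := by
  simp only [Safe, Bool.and_eq_true, List.all_eq_true, Bool.not_eq_true', List.contains_eq_mem,
    decide_eq_false_iff_not] at hc
  exact exec_of_safe c hc.1 s hb hc.2

/-- The nesting depth of the loops with bound other than `b₀`. -/
def depth (b₀ : ℕ) : Cmd → ℕ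
  | seq p q => max (p.depth b₀) (q.depth b₀)
  | ite _ p q => max (p.depth b₀) (q.depth b₀)
  | loop _ b p => p.depth b₀ + if b = b₀ then 0 else 1
  | _ => 0

/-- The nesting depth of the loops with bound `b₀`. -/
def depthAt (b₀ : ℕ) : Cmd → ℕ
  | seq p q => max (p.depthAt b₀) (q.depthAt b₀)
  | ite _ p q => max (p.depthAt b₀) (q.depthAt b₀)
  | loop _ b p => p.depthAt b₀ + if b = b₀ then 1 else 0
  | _ => 0

/-- A constant factor for the running time. -/
def timeConst : Cmd → ℕ
  | skip => 1
  | setNat _ i e => i.cost + e.cost + 1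
  | setReal _ i e => i.cost + e.cost + 1
  | seq p q => p.timeConst + q.timeConst
  | ite b p q => b.cost + (p.timeConst + q.timeConst) + 1
  | loop _ _ p => 21 + p.timeConst

/-- Treating `b₀` separately keeps the logarithmic factor apart from the powers of n: loops over
tree paths give powers of `H`, all others powers of `M`. Composition and branching take maxima of
the exponents and add only the constants. -/
theorem time_le {b₀ M H : ℕ} {ρ : ℕ → ℕ} (hM : 1 ≤ M) (hH : 1 ≤ H) (c : Cmd)
    (hb : ∀ b ∈ c.bounds, ρ b ≤ if b = b₀ then H else M) :
    c.time ρ ≤ c.timeConst * (M ^ c.depth b₀ * H ^ c.depthAt b₀) := by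
  have mono : ∀ {d d' e e' : ℕ}, d ≤ d' → e ≤ e' → M ^ d * H ^ e ≤ M ^ d' * H ^ e' :=
    fun h h' => Nat.mul_le_mul (Nat.pow_le_pow_right hM h) (Nat.pow_le_pow_right hH h')
  have pos : ∀ d e : ℕ, 1 ≤ M ^ d * H ^ e :=
    fun d e => Nat.mul_pos (Nat.pow_pos hM) (Nat.pow_pos hH)
  induction c with
  | skip => simp [time, timeConst, depth, depthAt]
  | setNat a i e => simp [time, timeConst, depth, depthAt]
  | setReal a i e => simp [time, timeConst, depth, depthAt]
  | seq p q hp hq =>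
    simp only [bounds, List.mem_append] at hb
    simp only [time, timeConst, depth, depthAt, add_mul]
    refine add_le_add ((hp fun b h => hb b (.inl h)).trans ?_)
      ((hq fun b h => hb b (.inr h)).trans ?_)
    · exact Nat.mul_le_mul_left _ (mono (le_max_left _ _) (le_max_left _ _))
    · exact Nat.mul_le_mul_left _ (mono (le_max_right _ _) (le_max_right _ _))
  | ite t p q hp hq =>
    simp only [bounds, List.mem_append] at hb
    simp only [time, timeConst, depth, depthAt, add_mul]
    refine add_le_add (add_le_add ?_ (add_le_add ((hp fun b h => hb b (.inl h)).trans ?_)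
      ((hq fun b h => hb b (.inr h)).trans ?_))) ?_
    · exact Nat.le_mul_of_pos_right _ (pos _ _)
    · exact Nat.mul_le_mul_left _ (mono (le_max_left _ _) (le_max_left _ _))
    · exact Nat.mul_le_mul_left _ (mono (le_max_right _ _) (le_max_right _ _))
    · simpa using pos _ _
  | loop v b p hp =>
    simp only [bounds, List.mem_cons, forall_eq_or_imp] at hb
    have h1 := hp hb.2
    have h2 := hb.1
    simp only [time, timeConst, depth, depthAt]
    set Q := M ^ p.depth b₀ * H ^ p.depthAt b₀
    have hQ : 1 ≤ Q := pos _ _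
    have h3 : 12 + p.time ρ ≤ (12 + p.timeConst) * Q := by nlinarith
    -- Since `Q * B` is at least one, the overheads 9 and 12 are absorbed in the constant 21.
    have key : ∀ B : ℕ, 1 ≤ B → ρ b ≤ B → 9 + ρ b * (12 + p.time ρ)
        ≤ (21 + p.timeConst) * (Q * B) := by
      intro B hB hρ
      have h4 := Nat.mul_le_mul hρ h3
      have h5 : 1 ≤ Q * B := Nat.mul_pos hQ hB
      nlinarith
    by_cases hbb : b = b₀
    · simp only [hbb, if_true] at h2 ⊢
      have := key H hH (by rw [hbb]; exact h2)
      rw [hbb] at this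
      simpa [Q, pow_succ, mul_assoc] using this
    · simp only [hbb, if_false] at h2 ⊢
      have := key M hM h2
      calc _ ≤ _ := this
        _ = _ := by simp only [Q, pow_succ, add_zero]; ring

end Cmd

end RealRAM

/-! ### The program

Arrays of naturals: `0` number of points, `1` colors, `2` number of leaves of the tree (a power of
two), `3` height of the tree, `4` twice the number of leaves, `5` number of points plus one,
`6` twice the number of points, `7` halves of the tree nodes, `8` row offsets of the table `16`,
`9` and `10` ranks of the points in the two orders, `11` and `12` the inverses of the ranks,
`13` and `14` points and types of the events, `15` number of events, `16` current leaf,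
`17` current node, `18` flag, `19` current row, `33` and `34` current points, `20`–`27` counters.

Arrays of reals: `0`–`2` input, `3` output, `4`–`7` primary and secondary keys of the two orders,
`8` reduced probabilities, `10` and `11` factors and sums at the tree nodes, `12` result of a query,
`13` and `14` new leaf values, `15` current row, `16` table of partial sums, `17` running product,
`18` sum of all rows, `19` constant factor, `20` concordance probability, `21` number of parallel
pairs, `22` sum over all pairs, `23` and `24` current direction. -/

namespace RealRAM

namespace Cmd

/-! ### Commands: operations on the tree -/

/-- Recompute the ancestors of the current leaf. -/
def fixPath : Cmd :=
  -- Leaf `k` is node `N + k` for `N` leaves, and the parent of a node is its half, read from a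
  -- table because naturals cannot be divided.
  setNat 17 (.const 0) (.get 7 (.add (natVar 2) (natVar 16))) ;;
  loop 20 3 (
    setReal 11 (natVar 17) (.add (.get 11 (.add (natVar 17) (natVar 17)))
      (.mul (.get 10 (.add (natVar 17) (natVar 17)))
        (.get 11 (.add (.add (natVar 17) (natVar 17)) (.const 1))))) ;;
    setReal 10 (natVar 17) (.mul (.get 10 (.add (natVar 17) (natVar 17)))
      (.get 10 (.add (.add (natVar 17) (natVar 17)) (.const 1)))) ;;
    setNat 17 (.const 0) (.get 7 (natVar 17)))

/-- Change the factor at the current leaf. -/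
def treeSetFactor : Cmd :=
  setReal 10 (.add (natVar 2) (natVar 16)) (realVar 13) ;; fixPath

/-- Change the summand at the current leaf. -/
def treeSetSum : Cmd :=
  setReal 11 (.add (natVar 2) (natVar 16)) (realVar 14) ;; fixPath

/-- Make all factors one and all summands zero. -/
def treeReset : Cmd :=
  loop 20 4 (
    setReal 10 (natVar 20) (.const 1) ;;
    setReal 11 (natVar 20) (.const 0))

/-- Compute the sum over all leaves before the current leaf. -/
def treeQuery : Cmd :=
  setNat 17 (.const 0) (.add (natVar 2) (natVar 16)) ;;
  setReal 12 (.const 0) (.const 0) ;;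
  loop 20 3 (
    -- Doubling the half returns the node exactly for left children. A right child must prepend its
    -- left sibling, whose leaves all come earlier.
    ite (.natEq (.add (.get 7 (natVar 17)) (.get 7 (natVar 17))) (natVar 17))
      skip
      (setReal 12 (.const 0) (.add (.get 11 (.sub (natVar 17) (.const 1)))
        (.mul (.get 10 (.sub (natVar 17) (.const 1))) (realVar 12)))) ;;
    setNat 17 (.const 0) (.get 7 (natVar 17)))

/-! ### Commands: ranks -/

/-- Increase the rank of the point in the counter `23` if it is above the point in the
counter `22`. -/
def comparePoints (k₁ k₂ rk : ℕ) : Cmd :=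
  ite (.or (.realLt (.get k₁ (natVar 22)) (.get k₁ (natVar 23)))
      (.and (.realEq (.get k₁ (natVar 22)) (.get k₁ (natVar 23)))
        (.realLt (.get k₂ (natVar 22)) (.get k₂ (natVar 23)))))
    (setNat rk (natVar 23) (.add (.get rk (natVar 23)) (.const 1)))
    skip

/-- Compute the rank of a point. -/
def rankPoint (k₁ k₂ rk inv : ℕ) : Cmd :=
  -- Ranks start at one, so that zero is free to be the maximal rank of the empty set.
  setNat rk (natVar 23) (.const 1) ;;
  loop 22 0 (comparePoints k₁ k₂ rk) ;;
  setNat inv (.get rk (natVar 23)) (natVar 23)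

/-- Compute the ranks of the points in the lexicographic order of the keys `k₁` and `k₂`. -/
def rankPoints (k₁ k₂ rk inv : ℕ) : Cmd := loop 23 0 (rankPoint k₁ k₂ rk inv)

/-! ### Commands: certain points -/

/-- Set the flag if the point in the counter `22` is certain and incompatible with the point in
the counter `23`. -/
def testConflict : Cmd :=
  ite (.and (.realEq (.get 2 (natVar 22)) (.const 1))
      (.and (.not (.natEq (.get 1 (natVar 22)) (.get 1 (natVar 23))))
        (.or (.and (.natLt (.get 9 (natVar 22)) (.get 9 (natVar 23)))
            (.not (.natLt (.get 10 (natVar 22)) (.get 10 (natVar 23)))))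
          (.and (.not (.natLt (.get 9 (natVar 22)) (.get 9 (natVar 23))))
            (.natLt (.get 10 (natVar 22)) (.get 10 (natVar 23)))))))
    (setNat 18 (.const 0) (.const 1))
    skip

/-- Set the flag if the point in the counter `23` is incompatible with a certain point. -/
def findConflict : Cmd :=
  setNat 18 (.const 0) (.const 0) ;; loop 22 0 testConflict

/-- Compute the reduced probability of a point and update the constant factor. -/
def reduceProb : Cmd :=
  findConflict ;;
  ite (.realEq (.get 2 (natVar 23)) (.const 1))
    -- A certain point leaves the sum over odds. If it conflicts with another certain point, no
    -- possible realization is concordant and the constant factor becomes zero.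
    (setReal 8 (natVar 23) (.const 0) ;;
      ite (.natEq (natVar 18) (.const 1)) (setReal 19 (.const 0) (.const 0)) skip)
    (setReal 19 (.const 0) (.mul (realVar 19) (.sub (.const 1) (.get 2 (natVar 23)))) ;;
      ite (.natEq (natVar 18) (.const 1))
        (setReal 8 (natVar 23) (.const 0))
        (setReal 8 (natVar 23) (.get 2 (natVar 23))))

/-- Compute the reduced probabilities and the constant factor. -/
def reduceProbs : Cmd := setReal 19 (.const 0) (.const 1) ;; loop 23 0 reduceProb

/-! ### Commands: events -/

/-- Clear the flag if the point in the counter `22` is before the point in the counter `23` and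
has the same color. -/
def testHeadStep : Cmd :=
  ite (.and (.natLt (natVar 22) (natVar 23))
      (.natEq (.get 1 (natVar 22)) (.get 1 (natVar 23))))
    (setNat 18 (.const 0) (.const 0))
    skip

/-- Set the flag to one if the point in the counter `23` is the first point of its color. -/
def testHead : Cmd :=
  setNat 18 (.const 0) (.const 1) ;; loop 22 0 testHeadStep

/-- Append an event of type `ty` if the next point in the first order has the color of the point
in the counter `23`. -/
def appendPoint (ty : ℕ) : Cmd :=
  setNat 34 (.const 0) (.get 11 (.add (natVar 22) (.const 1))) ;;
  ite (.natEq (.get 1 (natVar 34)) (.get 1 (natVar 23)))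
    (setNat 13 (natVar 15) (natVar 34) ;;
      setNat 14 (natVar 15) (.const ty) ;;
      setNat 15 (.const 0) (.add (natVar 15) (.const 1)))
    skip

/-- Append events of type `ty` for all points with the color of the point in the counter `23`,
in the first order. -/
def appendClass (ty : ℕ) : Cmd := loop 22 0 (appendPoint ty)

/-- Append the events for a color. -/
def appendColor : Cmd :=
  testHead ;;
  -- The class is switched on point by point and then off completely, so that the next color finds
  -- all factors equal to one.
  ite (.natEq (natVar 18) (.const 1)) (appendClass 1 ;; appendClass 0) skip

/-- Compute the list of events. -/
def makeEvents : Cmd :=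
  setNat 15 (.const 0) (.const 0) ;; loop 23 0 appendColor

/-! ### Commands: rows and partial sums -/

/-- The row of the empty set. -/
def emptyRow : Cmd :=
  loop 22 5 (setReal 15 (natVar 22) (.const 0)) ;;
  -- The empty set has both maxima zero and weight one.
  setReal 15 (.const 0) (.const 1)

/-- Put a partial sum for the current point into the tree. -/
def loadTableStep : Cmd :=
  ite (.natLt (natVar 21) (natVar 19))
    (setNat 16 (.const 0) (natVar 21) ;;
      setReal 14 (.const 0) (.get 16 (.add (.get 8 (natVar 21)) (natVar 33))) ;;
      treeSetSum)
    skip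

/-- Put the partial sums for the current point into the tree. -/
def loadTable : Cmd := loop 21 0 loadTableStep

/-- Compute one entry of the current row. -/
def rowStep : Cmd :=
  setNat 34 (.const 0) (.get 12 (.add (natVar 22) (.const 1))) ;;
  setReal 15 (.add (natVar 22) (.const 1)) (.const 0) ;;
  ite (.and (.natEq (.get 1 (natVar 34)) (.get 1 (natVar 33)))
      (.not (.natLt (.get 9 (natVar 33)) (.get 9 (natVar 34)))))
    (setReal 17 (.const 0) (.div (realVar 17) (.sub (.const 1) (.get 8 (natVar 34)))) ;;
      setNat 16 (.const 0) (.get 9 (natVar 34)) ;;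
      -- A second maximum below the second rank of the row's point is impossible, so the entry stays
      -- zero. The factor of the point is still needed for later entries.
      ite (.natLt (.get 10 (natVar 34)) (.get 10 (natVar 33)))
        skip
        (treeQuery ;;
          ite (.natEq (natVar 34) (natVar 33))
            (setReal 15 (.add (natVar 22) (.const 1))
              (.mul (.get 8 (natVar 33)) (.mul (realVar 17) (realVar 12))))
            (setReal 15 (.add (natVar 22) (.const 1))
              (.mul (.mul (.get 8 (natVar 33)) (.get 8 (natVar 34)))
                (.mul (realVar 17) (realVar 12))))) ;;
      setReal 13 (.const 0) (.sub (.const 1) (.get 8 (natVar 34))) ;;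
      treeSetFactor)
    skip

/-- Compute the current row. -/
def pointRow : Cmd :=
  treeReset ;;
  loadTable ;;
  setReal 15 (.const 0) (.const 0) ;;
  setReal 17 (.const 0) (.const 1) ;;
  loop 22 0 rowStep

/-- Put an entry of the current row into the tree. -/
def loadRowStep : Cmd :=
  setNat 16 (.const 0) (natVar 21) ;;
  setReal 14 (.const 0) (.get 15 (natVar 21)) ;;
  treeSetSum

/-- Put the current row into the tree. -/
def loadRow : Cmd := loop 21 5 loadRowStep

/-- Process an event. -/
def eventStep : Cmd :=
  setNat 34 (.const 0) (.get 13 (natVar 22)) ;;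
  setNat 16 (.const 0) (.get 10 (natVar 34)) ;;
  ite (.natLt (natVar 19) (.get 9 (natVar 34)))
    (ite (.natEq (.get 14 (natVar 22)) (.const 1))
      (treeQuery ;;
        -- Row zero belongs to the empty set, so no color can clash with it and the content of array
        -- `33` is meaningless there.
        ite (.and (.natLt (.const 0) (natVar 19))
            (.natEq (.get 1 (natVar 33)) (.get 1 (natVar 34))))
          (setReal 16 (.add (.get 8 (natVar 19)) (natVar 34)) (.const 0))
          (setReal 16 (.add (.get 8 (natVar 19)) (natVar 34)) (realVar 12)) ;;
        setReal 13 (.const 0) (.sub (.const 1) (.get 8 (natVar 34))) ;;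
        treeSetFactor)
      (setReal 13 (.const 0) (.const 1) ;; treeSetFactor))
    skip

/-- Compute the partial sums of the current row. -/
def pushRow : Cmd :=
  treeReset ;; loadRow ;; loop 22 6 eventStep

/-- Compute a row, its sum and its partial sums. -/
def doRow : Cmd :=
  setNat 19 (.const 0) (natVar 23) ;;
  setNat 33 (.const 0) (.get 11 (natVar 23)) ;;
  ite (.natEq (natVar 23) (.const 0)) emptyRow pointRow ;;
  loop 21 5 (setReal 18 (.const 0) (.add (realVar 18) (.get 15 (natVar 21)))) ;;
  pushRow

/-- Compute all rows. -/
def doRows : Cmd :=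
  setReal 18 (.const 0) (.const 0) ;; loop 23 5 doRow

/-- Compute the concordance probability of the two orders given by the keys. -/
def concordance : Cmd :=
  rankPoints 4 5 9 11 ;; rankPoints 6 7 10 12 ;; reduceProbs ;; makeEvents ;; doRows ;;
  setReal 20 (.const 0) (.mul (realVar 19) (realVar 18))

/-! ### Commands: directions and pairs of points -/

/-- Keys for two opposite orders. -/
def oppositeKeys : Cmd :=
  loop 23 0 (
    setReal 4 (natVar 23) (.get 0 (natVar 23)) ;;
    setReal 5 (natVar 23) (.get 1 (natVar 23)) ;;
    setReal 6 (natVar 23) (.sub (.const 0) (.get 0 (natVar 23))) ;;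
    setReal 7 (natVar 23) (.sub (.const 0) (.get 1 (natVar 23))))

/-- Keys for the half-open quadrant at the current direction. -/
def halfOpenKeys : Cmd :=
  loop 23 0 (
    setReal 4 (natVar 23) (.add (.mul (realVar 23) (.get 0 (natVar 23)))
      (.mul (realVar 24) (.get 1 (natVar 23)))) ;;
    setReal 5 (natVar 23) (.sub (.mul (realVar 24) (.get 0 (natVar 23)))
      (.mul (realVar 23) (.get 1 (natVar 23)))) ;;
    setReal 6 (natVar 23) (.sub (.mul (realVar 23) (.get 1 (natVar 23)))
      (.mul (realVar 24) (.get 0 (natVar 23)))) ;;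
    setReal 7 (natVar 23) (.add (.mul (realVar 23) (.get 0 (natVar 23)))
      (.mul (realVar 24) (.get 1 (natVar 23)))))

/-- From the keys for the half-open quadrant to the keys for the open quadrant. -/
def openKeys : Cmd :=
  -- Only the tie-break of the second order is reversed; this is what excludes the first axis.
  loop 23 0 (setReal 7 (natVar 23) (.sub (.const 0) (.get 7 (natVar 23))))

/-- Count a pair of points if it is parallel to the current direction. -/
def testParallel : Cmd :=
  ite (.and (.not (.natEq (natVar 26) (natVar 27)))
      (.realEq
        (.mul (realVar 23) (.sub (.get 1 (natVar 27)) (.get 1 (natVar 26))))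
        (.mul (realVar 24) (.sub (.get 0 (natVar 27)) (.get 0 (natVar 26))))))
    (setReal 21 (.const 0) (.add (realVar 21) (.const 1)))
    skip

/-- Count the pairs of points that are parallel to the current direction. -/
def countParallel : Cmd :=
  setReal 21 (.const 0) (.const 0) ;; loop 26 0 (loop 27 0 testParallel)

/-- Add the contribution of a pair of points. -/
def doPair : Cmd :=
  ite (.natEq (natVar 24) (natVar 25)) skip (
    setReal 23 (.const 0) (.sub (.get 0 (natVar 25)) (.get 0 (natVar 24))) ;;
    setReal 24 (.const 0) (.sub (.get 1 (natVar 25)) (.get 1 (natVar 24))) ;;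
    countParallel ;;
    halfOpenKeys ;;
    concordance ;;
    setReal 22 (.const 0) (.add (realVar 22) (.div (realVar 20) (realVar 21))) ;;
    openKeys ;;
    concordance ;;
    setReal 22 (.const 0) (.sub (realVar 22) (.div (realVar 20) (realVar 21))))

/-! ### Commands: initialization and assembly -/

/-- Set the scalars that depend only on the number of points. -/
def initSizes : Cmd :=
  setNat 5 (.const 0) (.add (natVar 0) (.const 1)) ;;
  setNat 6 (.const 0) (.add (natVar 0) (natVar 0)) ;;
  setNat 2 (.const 0) (.const 1)

/-- Find the least power of two above the number of points. -/
def initTree : Cmd :=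
  loop 20 5 (
    ite (.natLt (natVar 0) (natVar 2))
      skip
      (setNat 2 (.const 0) (.add (natVar 2) (natVar 2)) ;;
        setNat 3 (.const 0) (.add (natVar 3) (.const 1))))

/-- Set the number of tree nodes. -/
def initNodes : Cmd :=
  setNat 4 (.const 0) (.add (natVar 2) (natVar 2))

/-- Compute the tables of halves and of row offsets. -/
def initTables : Cmd :=
  loop 20 2 (
    setNat 7 (.add (natVar 20) (natVar 20)) (natVar 20) ;;
    setNat 7 (.add (.add (natVar 20) (natVar 20)) (.const 1)) (natVar 20)) ;;
  -- Offsets are accumulated by addition because naturals cannot be multiplied.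
  loop 20 5 (
    setNat 8 (.add (natVar 20) (.const 1)) (.add (.get 8 (natVar 20)) (natVar 0)))

/-- Compute the answer. -/
def sumPairs : Cmd :=
  oppositeKeys ;;
  concordance ;;
  setReal 22 (.const 0) (realVar 20) ;;
  loop 24 0 (loop 25 0 doPair) ;;
  setReal 3 (.const 0) (.sub (.const 1) (realVar 22))

/-- The part of the program with loops bounded by the sizes computed before. -/
def mainPart : Cmd := initTables ;; sumPairs

theorem safe_mainPart : mainPart.Safe = true := by decide +kernel

theorem bounds_mainPart : ∀ b ∈ mainPart.bounds, b = 0 ∨ b = 2 ∨ b = 3 ∨ b = 4 ∨ b = 5 ∨ b = 6 := by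
  decide +kernel

end Cmd

end RealRAM

/-! ### The tree of prefix sums -/

namespace RealRAM

/-- The memory holds the sizes and tables for `n` points and a tree of height `h`. -/
structure Sizes (n h : ℕ) (s : State) : Prop where
  num : s.nat 0 0 = n
  leaves : s.nat 2 0 = 2 ^ h
  height : s.nat 3 0 = h
  nodes : s.nat 4 0 = 2 ^ h + 2 ^ h
  succ_num : s.nat 5 0 = n + 1
  twice_num : s.nat 6 0 = n + n
  half : ∀ m < 2 ^ h + 2 ^ h, s.nat 7 m = m / 2
  offset : ∀ k ≤ n, s.nat 8 k = k * n
  lt : n < 2 ^ h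

theorem Sizes.congr {n h : ℕ} {s t : State} (hs : Sizes n h s)
    (H : ∀ a ≤ 8, a ≠ 1 → t.nat a = s.nat a) : Sizes n h t := by
  refine ⟨?_, ?_, ?_, ?_, ?_, ?_, ?_, ?_, hs.lt⟩
  · rw [H 0 (by norm_num) (by norm_num), hs.num]
  · rw [H 2 (by norm_num) (by norm_num), hs.leaves]
  · rw [H 3 (by norm_num) (by norm_num), hs.height]
  · rw [H 4 (by norm_num) (by norm_num), hs.nodes]
  · rw [H 5 (by norm_num) (by norm_num), hs.succ_num]
  · rw [H 6 (by norm_num) (by norm_num), hs.twice_num]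
  · rw [H 7 (by norm_num) (by norm_num)]; exact hs.half
  · rw [H 8 (by norm_num) (by norm_num)]; exact hs.offset

/-- The equation for an inner node of the tree with factors `al` and sums `sm`. -/
def NodeEq (al sm : ℕ → ℝ) (w : ℕ) : Prop :=
  al w = al (w + w) * al (w + w + 1) ∧ sm w = sm (w + w) + al (w + w) * sm (w + w + 1)

/-- The memory holds a tree with `N` leaves, with factors `A` and summands `S` at the leaves. -/
structure TreeRep (N : ℕ) (s : State) (A S : ℕ → ℝ) : Prop where
  node : ∀ w, 1 ≤ w → w < N → NodeEq (s.real 10) (s.real 11) w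
  factor : ∀ k < N, s.real 10 (N + k) = A k
  summand : ∀ k < N, s.real 11 (N + k) = S k

theorem TreeRep.congr {N : ℕ} {s t : State} {A S : ℕ → ℝ} (hs : TreeRep N s A S)
    (h10 : t.real 10 = s.real 10) (h11 : t.real 11 = s.real 11) : TreeRep N t A S := by
  refine ⟨?_, ?_, ?_⟩
  · rw [h10, h11]; exact hs.node
  · rw [h10]; exact hs.factor
  · rw [h11]; exact hs.summand

@[simp] theorem treeRep_setNat {N : ℕ} {s : State} {A S : ℕ → ℝ} {a k v : ℕ} :
    TreeRep N (s.setNat a k v) A S ↔ TreeRep N s A S :=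
  ⟨fun h => h.congr rfl rfl, fun h => h.congr rfl rfl⟩

/-- The sum of the first `K` summands, each multiplied with all factors before it. -/
def prefixSum (A S : ℕ → ℝ) (K : ℕ) : ℝ := ∑ k ∈ Finset.range K, S k * ∏ b ∈ Finset.range k, A b

/-- The value at a partial sum of the leaves before the node `v`, given the value `x` of the leaves
of the same range at or after `v`. -/
def pathValue (al sm : ℕ → ℝ) (v : ℕ) (x : ℝ) : ℝ :=
  if _ : v ≤ 1 then x
  else pathValue al sm (v / 2) (if v / 2 + v / 2 = v then x else sm (v - 1) + al (v - 1) * x)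
termination_by v
decreasing_by omega

/-- A node acts as the affine map x ↦ sm + al * x, and a step to the left within a level prepends
one such map. If `v` is a left child, the first step of the climb from its sibling does this. If `v`
is a right child, the claim one level higher applies, and the node equation says that the parent's
map is the composite of those of its children. -/
theorem pathValue_succ {al sm : ℕ → ℝ} {N : ℕ}
    (hT : ∀ w, 1 ≤ w → w < N → NodeEq al sm w) (l : ℕ) :
    ∀ v x, 2 ^ l ≤ v → v + 1 < 2 ^ (l + 1) → v < N + N →
      pathValue al sm (v + 1) x = pathValue al sm v (sm v + al v * x) := by
  induction l with
  | zero => intro v x h1 h2; omega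
  | succ l ih =>
    intro v x h1 h2 hv
    have hv2 : 2 ≤ v := by
      have : 2 ≤ 2 ^ (l + 1) := by rw [pow_succ]; have := Nat.one_le_two_pow (n := l); omega
      omega
    rw [pathValue, dif_neg (by omega), pathValue.eq_1 al sm v, dif_neg (by omega)]
    rcases Nat.even_or_odd' v with ⟨w, rfl | rfl⟩
    · rw [if_neg (by omega), if_pos (by omega)]
      have : (2 * w + 1) / 2 = 2 * w / 2 := by omega
      rw [this]; rfl
    · rw [if_pos (by omega), if_neg (by omega)]
      have e1 : (2 * w + 1 + 1) / 2 = w + 1 := by omega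
      have e2 : (2 * w + 1) / 2 = w := by omega
      rw [e1, e2, ih w x (by rw [pow_succ] at h1; omega) (by rw [pow_succ] at h2; omega) (by omega)]
      obtain ⟨ha, hs⟩ := hT w (by omega) (by omega)
      rw [ha, hs]
      congr 1
      have e3 : 2 * w + 1 - 1 = w + w := by omega
      have e4 : 2 * w + 1 = w + w + 1 := by omega
      rw [e3, e4]; ring

/-- The climb from the leftmost node of a level meets only left children and thus collects nothing.
-/
theorem pathValue_two_pow (al sm : ℕ → ℝ) (l : ℕ) (x : ℝ) : pathValue al sm (2 ^ l) x = x := by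
  induction l with
  | zero => rw [pathValue, dif_pos (by norm_num)]
  | succ l ih =>
    have : 1 ≤ 2 ^ l := Nat.one_le_two_pow
    rw [pathValue, dif_neg (by rw [pow_succ]; omega)]
    have e : 2 ^ (l + 1) / 2 = 2 ^ l := by rw [pow_succ]; omega
    rw [e, if_pos (by rw [pow_succ]; omega), ih]

/-- Starting from the leftmost leaf, each step to the right composes with the affine map of one more
leaf. The value `x` is kept arbitrary so that the induction closes; queries use zero. -/
theorem TreeRep.pathValue_eq {h : ℕ} {s : State} {A S : ℕ → ℝ} (hs : TreeRep (2 ^ h) s A S)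
    (K : ℕ) (hK : K < 2 ^ h) (x : ℝ) :
    pathValue (s.real 10) (s.real 11) (2 ^ h + K) x
      = prefixSum A S K + (∏ b ∈ Finset.range K, A b) * x := by
  induction K generalizing x with
  | zero => simp [pathValue_two_pow, prefixSum]
  | succ K ih =>
    rw [← add_assoc, pathValue_succ hs.node h _ _ (by omega) (by rw [pow_succ]; omega) (by omega),
      ih (by omega), hs.factor K (by omega), hs.summand K (by omega)]
    simp only [prefixSum, Finset.sum_range_succ, Finset.prod_range_succ]
    ring

/-! ### Correctness of the tree operations -/

namespace Cmd

/-- At each moment only the node about to be recomputed may violate its equation, and recomputing it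
can spoil only the equation of its parent. After `h` rounds the exceptional index is zero, which is
no node, so all equations hold. -/
theorem run_fixPath {n h : ℕ} {s : State} (hs : Sizes n h s) (hK : s.nat 16 0 < 2 ^ h)
    (hT : ∀ w, 1 ≤ w → w < 2 ^ h → w ≠ (2 ^ h + s.nat 16 0) / 2 →
      NodeEq (s.real 10) (s.real 11) w) :
    (∀ w, 1 ≤ w → w < 2 ^ h →
      NodeEq ((fixPath.run s).real 10) ((fixPath.run s).real 11) w) ∧
    (∀ k, (fixPath.run s).real 10 (2 ^ h + k) = s.real 10 (2 ^ h + k)) ∧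
    (∀ k, (fixPath.run s).real 11 (2 ^ h + k) = s.real 11 (2 ^ h + k)) := by
  set N := 2 ^ h with hN
  set K := s.nat 16 0 with hKdef
  rw [fixPath, run]
  set s1 := (setNat 17 (.const 0) (.get 7 (.add (natVar 2) (natVar 16)))).run s with hs1
  have hh : s1.nat 3 0 = h := by simp [hs1, hs.height]
  have key := run_loop (s := s1) (v := 20) (b := 3)
    (p := setReal 11 (natVar 17) (.add (.get 11 (.add (natVar 17) (natVar 17)))
      (.mul (.get 10 (.add (natVar 17) (natVar 17)))
        (.get 11 (.add (.add (natVar 17) (natVar 17)) (.const 1))))) ;;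
    setReal 10 (natVar 17) (.mul (.get 10 (.add (natVar 17) (natVar 17)))
      (.get 10 (.add (.add (natVar 17) (natVar 17)) (.const 1)))) ;;
    setNat 17 (.const 0) (.get 7 (natVar 17)))
    (fun k st => st.nat 17 0 = (N + K) / 2 ^ (k + 1) ∧
      (∀ w, 1 ≤ w → w < N → w ≠ (N + K) / 2 ^ (k + 1) → NodeEq (st.real 10) (st.real 11) w) ∧
      (∀ k, st.real 10 (N + k) = s.real 10 (N + k)) ∧
      (∀ k, st.real 11 (N + k) = s.real 11 (N + k)))
    ?_ ?_
  · rw [hh] at key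
    obtain ⟨-, h2, h3, h4⟩ := key
    refine ⟨fun w hw1 hw2 => h2 w hw1 hw2 ?_, h3, h4⟩
    have : (N + K) / 2 ^ (h + 1) = 0 := Nat.div_eq_of_lt (by rw [pow_succ]; omega)
    omega
  · simp only [hs1, run, NatExpr.eval, State.setNat_nat, State.setNat_real]
    refine ⟨?_, ?_, by simp, by simp⟩
    · simp [hs.leaves, hs.half (N + K) (by omega), ← hKdef, ← hN]
    · simpa using hT
  · intro k st hk _ hf ⟨h1, h2, h3, h4⟩
    rw [hh] at hk
    have hf7 : st.nat 7 = s.nat 7 := by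
      rw [hf.nat 7 (by decide)]; simp [hs1]
    set c := (N + K) / 2 ^ (k + 1) with hc
    have hcN : c < N := by
      have h2k : 2 ≤ 2 ^ (k + 1) := by
        have := Nat.one_le_two_pow (n := k); rw [pow_succ]; omega
      rw [hc, Nat.div_lt_iff_lt_mul (by positivity)]
      nlinarith
    have hc1 : 1 ≤ c := by
      rw [hc, Nat.le_div_iff_mul_le (by positivity), one_mul]
      have : 2 ^ (k + 1) ≤ 2 ^ h := Nat.pow_le_pow_right (by norm_num) hk
      omega
    have hc2 : (N + K) / 2 ^ (k + 1 + 1) = c / 2 := by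
      rw [hc, Nat.div_div_eq_div_mul, ← pow_succ]
    have e1 : c + c ≠ c := by omega
    have e2 : c + c + 1 ≠ c := by omega
    simp only [run, NatExpr.eval, RealExpr.eval, State.setNat_nat, State.setNat_real,
      State.setReal_nat, State.setReal_real, h1, hf7]
    norm_num
    rw [hs.half c (by omega), hc2]
    refine ⟨rfl, ?_, ?_, ?_⟩
    · intro w hw1 hw2 hw3
      by_cases hwc : w = c
      · subst hwc
        simp only [NodeEq, Function.update_self, Function.update_of_ne e1, Function.update_of_ne e2,
          and_self]
      · have e3 : w + w ≠ c := by omega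
        have e4 : w + w + 1 ≠ c := by omega
        have := h2 w hw1 hw2 hwc
        simpa [NodeEq, Function.update_apply, hwc, e3, e4] using this
    · intro j
      rw [Function.update_of_ne (by omega), h3]
    · intro j
      rw [Function.update_of_ne (by omega), h4]

theorem run_treeSetFactor {n h : ℕ} {s : State} {A S : ℕ → ℝ} (hs : Sizes n h s)
    (hT : TreeRep (2 ^ h) s A S) (hK : s.nat 16 0 < 2 ^ h) :
    TreeRep (2 ^ h) (treeSetFactor.run s) (Function.update A (s.nat 16 0) (s.real 13 0)) S := by
  rw [treeSetFactor, run]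
  set s1 := (setReal 10 (.add (natVar 2) (natVar 16)) (realVar 13)).run s with hs1
  have e1 : s1 = s.setReal 10 (2 ^ h + s.nat 16 0) (s.real 13 0) := by
    simp [hs1, hs.leaves]
  have hs' : Sizes n h s1 := hs.congr fun a _ _ => by simp [e1]
  obtain ⟨h1, h2, h3⟩ := run_fixPath hs' (by simpa [e1] using hK) (fun w hw1 hw2 hw3 => by
    simp only [e1, State.setReal_nat] at hw3
    have := hT.node w hw1 hw2
    simpa [e1, NodeEq, Function.update_apply, show w ≠ 2 ^ h + s.nat 16 0 by omega,
      show w + w ≠ 2 ^ h + s.nat 16 0 by omega,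
      show w + w + 1 ≠ 2 ^ h + s.nat 16 0 by omega] using this)
  refine ⟨h1, fun k hk => ?_, fun k hk => ?_⟩
  · rw [h2]
    simp [e1, Function.update_apply, hT.factor k hk]
  · rw [h3]
    simp [e1, hT.summand k hk]

theorem run_treeSetSum {n h : ℕ} {s : State} {A S : ℕ → ℝ} (hs : Sizes n h s)
    (hT : TreeRep (2 ^ h) s A S) (hK : s.nat 16 0 < 2 ^ h) :
    TreeRep (2 ^ h) (treeSetSum.run s) A (Function.update S (s.nat 16 0) (s.real 14 0)) := by
  rw [treeSetSum, run]
  set s1 := (setReal 11 (.add (natVar 2) (natVar 16)) (realVar 14)).run s with hs1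
  have e1 : s1 = s.setReal 11 (2 ^ h + s.nat 16 0) (s.real 14 0) := by
    simp [hs1, hs.leaves]
  have hs' : Sizes n h s1 := hs.congr fun a _ _ => by simp [e1]
  obtain ⟨h1, h2, h3⟩ := run_fixPath hs' (by simpa [e1] using hK) (fun w hw1 hw2 hw3 => by
    simp only [e1, State.setReal_nat] at hw3
    have := hT.node w hw1 hw2
    simpa [e1, NodeEq, Function.update_apply, show w ≠ 2 ^ h + s.nat 16 0 by omega,
      show w + w ≠ 2 ^ h + s.nat 16 0 by omega,
      show w + w + 1 ≠ 2 ^ h + s.nat 16 0 by omega] using this)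
  refine ⟨h1, fun k hk => ?_, fun k hk => ?_⟩
  · rw [h2]
    simp [e1, hT.factor k hk]
  · rw [h3]
    simp [e1, Function.update_apply, hT.summand k hk]

theorem run_treeReset {n h : ℕ} {s : State} (hs : Sizes n h s) :
    TreeRep (2 ^ h) (treeReset.run s) 1 0 := by
  rw [treeReset]
  have key := run_loop (s := s) (v := 20) (b := 4)
    (p := setReal 10 (natVar 20) (.const 1) ;; setReal 11 (natVar 20) (.const 0))
    (fun k st => ∀ m < k, st.real 10 m = 1 ∧ st.real 11 m = 0)
    (by simp) (by
      intro k st _ hk _ hI m hm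
      simp only [run, NatExpr.eval, RealExpr.eval, State.setReal_nat, State.setNat_real,
        State.setReal_real, hk]
      rcases Nat.lt_succ_iff_lt_or_eq.mp hm with h | rfl
      · simp [h.ne, hI m h]
      · simp)
  rw [hs.nodes] at key
  refine ⟨fun w hw1 hw2 => ?_, fun k hk => (key _ (by omega)).1, fun k hk => (key _ (by omega)).2⟩
  obtain ⟨a1, a2⟩ := key w (by omega)
  obtain ⟨b1, b2⟩ := key (w + w) (by omega)
  obtain ⟨c1, c2⟩ := key (w + w + 1) (by omega)
  rw [NodeEq, a1, a2, b1, b2, c1, c2]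
  norm_num

/-- The invariant is that `pathValue` of the current node at the accumulated value does not change.
At the leaf with value zero it is the prefix sum, and at the root it is the accumulated value. -/
theorem run_treeQuery {n h : ℕ} {s : State} {A S : ℕ → ℝ} (hs : Sizes n h s)
    (hT : TreeRep (2 ^ h) s A S) (hK : s.nat 16 0 < 2 ^ h) :
    (treeQuery.run s).real 12 0 = prefixSum A S (s.nat 16 0) := by
  set N := 2 ^ h with hN
  set K := s.nat 16 0 with hKdef
  rw [treeQuery, run, run]
  set s1 := (setReal 12 (.const 0) (.const 0)).run
    ((setNat 17 (.const 0) (.add (natVar 2) (natVar 16))).run s) with hs1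
  have hh : s1.nat 3 0 = h := by simp [hs1, hs.height]
  have key := run_loop (s := s1) (v := 20) (b := 3)
    (p := ite (.natEq (.add (.get 7 (natVar 17)) (.get 7 (natVar 17))) (natVar 17))
      skip
      (setReal 12 (.const 0) (.add (.get 11 (.sub (natVar 17) (.const 1)))
        (.mul (.get 10 (.sub (natVar 17) (.const 1))) (realVar 12)))) ;;
    setNat 17 (.const 0) (.get 7 (natVar 17)))
    (fun k st => st.nat 17 0 = (N + K) / 2 ^ k ∧
      pathValue (s.real 10) (s.real 11) ((N + K) / 2 ^ k) (st.real 12 0) = prefixSum A S K)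
    ?_ ?_
  · rw [hh] at key
    obtain ⟨-, h2⟩ := key
    have : (N + K) / 2 ^ h = 1 := by
      rw [← hN, Nat.add_div_left _ (by omega), Nat.div_eq_of_lt hK]
    rw [this, pathValue, dif_pos le_rfl] at h2
    exact h2
  · simp only [hs1, run, NatExpr.eval, RealExpr.eval, State.setNat_nat, State.setNat_real,
      State.setReal_nat, State.setReal_real]
    have := hT.pathValue_eq K hK 0
    simp only [mul_zero, add_zero] at this
    simpa [hs.leaves, ← hKdef, ← hN] using this
  · intro k st hk _ hf ⟨h1, h2⟩
    rw [hh] at hk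
    have hf7 : st.nat 7 = s.nat 7 := by rw [hf.nat 7 (by decide)]; simp [hs1]
    have hf10 : st.real 10 = s.real 10 := by rw [hf.real 10 (by decide)]; simp [hs1]
    have hf11 : st.real 11 = s.real 11 := by rw [hf.real 11 (by decide)]; simp [hs1]
    have hc2 : (N + K) / 2 ^ (k + 1) = (N + K) / 2 ^ k / 2 := by
      rw [Nat.div_div_eq_div_mul, ← pow_succ]
    have hc1 : 2 ≤ (N + K) / 2 ^ k := by
      rw [Nat.le_div_iff_mul_le (by positivity)]
      have : 2 ^ (k + 1) ≤ 2 ^ h := Nat.pow_le_pow_right (by norm_num) hk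
      rw [pow_succ] at this
      omega
    have hcN : (N + K) / 2 ^ k < N + N := lt_of_le_of_lt (Nat.div_le_self _ _) (by omega)
    rw [hc2]
    set c := (N + K) / 2 ^ k with hc
    rw [pathValue, dif_neg (by omega)] at h2
    have h7 : s.nat 7 c = c / 2 := hs.half c hcN
    by_cases hpar : c / 2 + c / 2 = c
    · simpa [h1, hf7, h7, hpar] using h2
    · simpa [h1, hf7, h7, hpar, hf10, hf11] using h2

end Cmd

end RealRAM

/-! ### Concordant sets

The points are `0, …, n - 1`, with colors `col` and with ranks `X` and `Y` in two linear orders. -/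

/-- The ranks of `n` points in a linear order. -/
structure IsRanking (n : ℕ) (X : ℕ → ℕ) : Prop where
  inj : ∀ i < n, ∀ j < n, X i = X j → i = j
  pos : ∀ i < n, 1 ≤ X i
  le : ∀ i < n, X i ≤ n

/-- All points of different colors in `R` are in the same order in both rankings. -/
def Concordant (col X Y : ℕ → ℕ) (R : Finset ℕ) : Prop :=
  ∀ i ∈ R, ∀ j ∈ R, col i = col j ∨ (X i < X j ↔ Y i < Y j)

open Classical in
/-- The concordant sets in which the maximal ranks are `a` and `b`. -/
noncomputable def cornerSets (n : ℕ) (col X Y : ℕ → ℕ) (a b : ℕ) : Finset (Finset ℕ) :=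
  {R ∈ (Finset.range n).powerset | Concordant col X Y R ∧ R.sup X = a ∧ R.sup Y = b}

/-- The total weight of the concordant sets in which the maximal ranks are `a` and `b`. -/
noncomputable def cornerSum (n : ℕ) (col X Y : ℕ → ℕ) (r : ℕ → ℝ) (a b : ℕ) : ℝ :=
  ∑ R ∈ cornerSets n col X Y a b, ∏ v ∈ R, r v / (1 - r v)

/-- The point of rank `t` in the ranking `X` has the color of `m`. -/
def SameColorAt (n : ℕ) (col X : ℕ → ℕ) (t m : ℕ) : Prop := ∃ k < n, X k = t ∧ col k = col m

open Classical in
/-- The sum over the row `t` that is used for the row of the point `m`. -/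
noncomputable def partialSum (n : ℕ) (col X Y : ℕ → ℕ) (r : ℕ → ℝ) (t m : ℕ) : ℝ :=
  if SameColorAt n col X t m then 0
  else ∑ b ∈ Finset.range (Y m), cornerSum n col X Y r t b *
    ∏ v ∈ Finset.range n with col v = col m ∧ t < X v ∧ X v < X m ∧ Y v < b, (1 - r v)

/-- The points with the color of `i` that have at most the ranks `a` and `b`. -/
def classBelow (n : ℕ) (col X Y : ℕ → ℕ) (i a b : ℕ) : Finset ℕ :=
  {v ∈ Finset.range n | col v = col i ∧ X v ≤ a ∧ Y v ≤ b}

section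

variable {n : ℕ} {col X Y : ℕ → ℕ} {r : ℕ → ℝ}

/-- Ranks are positive, so a set whose supremum is a rank is nonempty and attains it; injectivity
identifies the point. -/
theorem IsRanking.mem_of_sup_eq (hX : IsRanking n X) {R : Finset ℕ} (hR : R ⊆ Finset.range n)
    {i : ℕ} (hi : i < n) (h : R.sup X = X i) : i ∈ R := by
  have hne : R.Nonempty := by
    by_contra h0
    rw [Finset.not_nonempty_iff_eq_empty] at h0
    subst h0
    have := hX.pos i hi
    simp at h
    omega
  obtain ⟨k, hk, hkX⟩ := Finset.exists_mem_eq_sup R hne X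
  have := hX.inj k (Finset.mem_range.mp (hR hk)) i hi (by rw [← hkX, h])
  exact this ▸ hk

theorem exists_of_sup_pos {R : Finset ℕ} {f : ℕ → ℕ} (h : 0 < R.sup f) :
    ∃ w ∈ R, f w = R.sup f := by
  have hne : R.Nonempty := by
    by_contra h0
    rw [Finset.not_nonempty_iff_eq_empty] at h0
    subst h0
    simp at h
  obtain ⟨k, hk, hkX⟩ := Finset.exists_mem_eq_sup R hne f
  exact ⟨k, hk, hkX.symm⟩

/-- The largest first rank of a point of `R` whose color is not that of `i`. -/
def lastForeign (col X : ℕ → ℕ) (i : ℕ) (R : Finset ℕ) : ℕ :=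
  ({v ∈ R | col v ≠ col i} : Finset ℕ).sup X

/-- The last point of the first order and the last point of the second are ordered oppositely unless
they coincide, which concordance allows only for equal colors. -/
theorem col_eq_of_mem_cornerSets (hX : IsRanking n X) (hY : IsRanking n Y) {R : Finset ℕ}
    {i j : ℕ} (hi : i < n) (hj : j < n) (hR : R ∈ cornerSets n col X Y (X i) (Y j)) :
    col i = col j ∧ X j ≤ X i ∧ Y i ≤ Y j := by
  simp only [cornerSets, Finset.mem_filter, Finset.mem_powerset] at hR
  obtain ⟨hsub, hc, hx, hy⟩ := hR
  have iR := hX.mem_of_sup_eq hsub hi hx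
  have jR := hY.mem_of_sup_eq hsub hj hy
  have h1 : X j ≤ X i := hx ▸ Finset.le_sup jR
  have h2 : Y i ≤ Y j := hy ▸ Finset.le_sup iR
  refine ⟨?_, h1, h2⟩
  rcases hc i iR j jR with h | h
  · exact h
  · by_contra hne
    have hij : i ≠ j := fun h => hne (by rw [h])
    have : Y i ≠ Y j := fun h => hij (hY.inj i hi j hj h)
    omega

/-- The set is cut behind its last point of a color other than that of `i`. Behind the cut only the
color of `i` remains, and everything before the cut is also lower in the second order: foreign
points by concordance, points of the color of `i` by comparison through the foreign point at the
cut. Without foreign points the cut is at zero and the lower part is empty. -/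
theorem split_spec (hX : IsRanking n X) (hY : IsRanking n Y) {R : Finset ℕ} {i j : ℕ}
    (hi : i < n) (hj : j < n) (hR : R ∈ cornerSets n col X Y (X i) (Y j)) :
    lastForeign col X i R < X j ∧
    ({v ∈ R | X v ≤ lastForeign col X i R} : Finset ℕ).sup Y < Y i ∧
    ¬ SameColorAt n col X (lastForeign col X i R) i ∧
    ({v ∈ R | X v ≤ lastForeign col X i R} : Finset ℕ).sup X = lastForeign col X i R ∧
    ∀ v ∈ R, lastForeign col X i R < X v → col v = col i ∧ X v ≤ X i ∧ Y v ≤ Y j ∧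
      ({v ∈ R | X v ≤ lastForeign col X i R} : Finset ℕ).sup Y < Y v := by
  obtain ⟨hcij, hXji, hYij⟩ := col_eq_of_mem_cornerSets hX hY hi hj hR
  simp only [cornerSets, Finset.mem_filter, Finset.mem_powerset] at hR
  obtain ⟨hsub, hc, hx, hy⟩ := hR
  have iR := hX.mem_of_sup_eq hsub hi hx
  have jR := hY.mem_of_sup_eq hsub hj hy
  have lt_n : ∀ v ∈ R, v < n := fun v hv => Finset.mem_range.mp (hsub hv)
  set t := lastForeign col X i R with ht
  have hforeign : ∀ v ∈ R, col v ≠ col i → X v ≤ t := fun v hv hvc =>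
    Finset.le_sup (f := X) (Finset.mem_filter.mpr ⟨hv, hvc⟩)
  have hatt : 0 < t → ∃ w ∈ R, col w ≠ col i ∧ X w = t := fun h => by
    obtain ⟨w, hw, hwt⟩ := exists_of_sup_pos h
    rw [Finset.mem_filter] at hw
    exact ⟨w, hw.1, hw.2, hwt⟩
  have htj : t < X j := by
    rw [ht, lastForeign, Finset.sup_lt_iff (by exact hX.pos j hj)]
    intro v hv
    rw [Finset.mem_filter] at hv
    rcases hc v hv.1 j jR with h | h
    · exact absurd (h.trans hcij.symm) hv.2
    · rw [h]
      have h1 : Y v ≤ Y j := hy ▸ Finset.le_sup hv.1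
      have h2 : Y v ≠ Y j := fun h => hv.2 (by rw [hY.inj v (lt_n v hv.1) j hj h, hcij])
      omega
  have hsep : ∀ v ∈ R, t < X v → ∀ w ∈ R, X w ≤ t → Y w < Y v := by
    intro v hv htv w hw hwt
    have hvc : col v = col i := by
      by_contra h
      exact absurd (hforeign v hv h) (by omega)
    by_cases hwc : col w = col i
    -- The points `v` and `w` have equal colors and cannot be compared directly; the foreign point
    -- `u` at the cut lies between them in both orders.
    · obtain ⟨u, hu, huc, hut⟩ := hatt ((hX.pos w (lt_n w hw)).trans hwt)
      have hwu : X w ≠ X u := fun h => huc (by rw [← hX.inj w (lt_n w hw) u (lt_n u hu) h, hwc])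
      have h1 := (hc w hw u hu).resolve_left (fun h => huc (by rw [← h, hwc]))
      have h2 := (hc u hu v hv).resolve_left (fun h => huc (by rw [h, hvc]))
      have h3 := h1.mp (by omega)
      have h4 := h2.mp (by omega)
      omega
    · exact ((hc w hw v hv).resolve_left (fun h => hwc (by rw [h, hvc]))).mp (by omega)
  have hsup : ∀ v ∈ R, t < X v → ({v ∈ R | X v ≤ t} : Finset ℕ).sup Y < Y v := by
    intro v hv htv
    rw [Finset.sup_lt_iff (by exact hY.pos v (lt_n v hv))]
    intro w hw
    rw [Finset.mem_filter] at hw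
    exact hsep v hv htv w hw.1 hw.2
  refine ⟨htj, hsup i iR (by omega), ?_, ?_, ?_⟩
  · rintro ⟨k, hk, hkt, hkc⟩
    obtain ⟨w, hw, hwc, hwt⟩ := hatt (by have := hX.pos k hk; omega)
    exact hwc (by rw [hX.inj w (lt_n w hw) k hk (by omega), hkc])
  · apply le_antisymm
    · exact Finset.sup_le fun v hv => (Finset.mem_filter.mp hv).2
    · conv_lhs => rw [ht, lastForeign]
      refine Finset.sup_mono fun v hv => ?_
      rw [Finset.mem_filter] at hv ⊢
      exact ⟨hv.1, hforeign v hv.1 hv.2⟩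
  · intro v hv htv
    refine ⟨?_, hx ▸ Finset.le_sup hv, hy ▸ Finset.le_sup hv, hsup v hv htv⟩
    by_contra h
    exact absurd (hforeign v hv h) (by omega)

/-- Conversely, the two parts can be chosen independently: every point of `B` is above every point
of `R₀` in both orders, and `B` has only one color. The hypothesis `hclash` makes `t` a foreign rank
unless it is zero, so the cut of the union is again at `t`. -/
theorem union_spec {i j t b : ℕ}
    (hXji : X j ≤ X i) (hYij : Y i ≤ Y j) (ht : t < X j) (hb : b < Y i)
    (hclash : ¬ SameColorAt n col X t i) {R₀ B : Finset ℕ}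
    (hR : R₀ ∈ cornerSets n col X Y t b)
    (hB : B ⊆ classBelow n col X Y i (X i) (Y j))
    (htB : ∀ v ∈ B, t < X v ∧ b < Y v) (hiB : i ∈ B) (hjB : j ∈ B) :
    R₀ ∪ B ∈ cornerSets n col X Y (X i) (Y j) ∧ lastForeign col X i (R₀ ∪ B) = t ∧
      ({v ∈ R₀ ∪ B | X v ≤ t} : Finset ℕ) = R₀ ∧ ({v ∈ R₀ ∪ B | t < X v} : Finset ℕ) = B ∧
      Disjoint R₀ B := by
  simp only [cornerSets, Finset.mem_filter, Finset.mem_powerset] at hR ⊢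
  obtain ⟨hsub, hc, hx, hy⟩ := hR
  have hBm : ∀ v ∈ B, v < n ∧ col v = col i ∧ X v ≤ X i ∧ Y v ≤ Y j := fun v hv => by
    simpa [classBelow] using hB hv
  have hXt : ∀ v ∈ R₀, X v ≤ t := fun v hv => hx ▸ Finset.le_sup hv
  have hYb : ∀ v ∈ R₀, Y v ≤ b := fun v hv => hy ▸ Finset.le_sup hv
  have hBX : B.sup X = X i :=
    le_antisymm (Finset.sup_le fun v hv => (hBm v hv).2.2.1) (Finset.le_sup hiB)
  have hBY : B.sup Y = Y j :=
    le_antisymm (Finset.sup_le fun v hv => (hBm v hv).2.2.2) (Finset.le_sup hjB)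
  refine ⟨⟨Finset.union_subset hsub fun v hv => Finset.mem_range.mpr (hBm v hv).1, ?_, ?_, ?_⟩,
    ?_, ?_, ?_, ?_⟩
  · intro v hv w hw
    rw [Finset.mem_union] at hv hw
    rcases hv with hv | hv <;> rcases hw with hw | hw
    · exact hc v hv w hw
    · right
      have := hXt v hv; have := hYb v hv; have := htB w hw
      omega
    · right
      have := hXt w hw; have := hYb w hw; have := htB v hv
      omega
    · left; rw [(hBm v hv).2.1, (hBm w hw).2.1]
  · rw [Finset.sup_union, hx, hBX]; exact sup_eq_right.mpr (by omega)
  · rw [Finset.sup_union, hy, hBY]; exact sup_eq_right.mpr (by omega)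
  · rw [lastForeign, Finset.filter_union,
      (Finset.filter_eq_empty_iff (s := B)).mpr fun v hv => not_not.mpr (hBm v hv).2.1,
      Finset.union_empty]
    apply le_antisymm
    · exact Finset.sup_le fun v hv => hXt v (Finset.mem_filter.mp hv).1
    · rcases Nat.eq_zero_or_pos t with h0 | h0
      · omega
      · obtain ⟨w, hw, hwt⟩ := exists_of_sup_pos (R := R₀) (f := X) (by omega)
        rw [← hx, ← hwt]
        refine Finset.le_sup (f := X) (Finset.mem_filter.mpr ⟨hw, fun h => hclash ?_⟩)
        exact ⟨w, Finset.mem_range.mp (hsub hw), by omega, h⟩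
  · ext v
    simp only [Finset.mem_filter, Finset.mem_union]
    constructor
    · rintro ⟨h | h, h'⟩
      · exact h
      · exact absurd (htB v h).1 (by omega)
    · exact fun h => ⟨.inl h, hXt v h⟩
  · ext v
    simp only [Finset.mem_filter, Finset.mem_union]
    constructor
    · rintro ⟨h | h, h'⟩
      · exact absurd (hXt v h) (by omega)
      · exact h
    · exact fun h => ⟨.inr h, (htB v h).1⟩
  · rw [Finset.disjoint_left]
    intro v hv hv'
    have := hXt v hv; have := htB v hv'
    omega

open Classical in
-- The sets are grouped by the two maximal ranks of their part before the cut. By `split_spec` and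
-- `union_spec`, a group is the product of the possible lower and upper parts, and the weight is
-- multiplicative.
theorem cornerSum_eq_sum_split (hX : IsRanking n X) (hY : IsRanking n Y) {i j : ℕ}
    (hi : i < n) (hj : j < n) (hXji : X j ≤ X i) (hYij : Y i ≤ Y j) :
    cornerSum n col X Y r (X i) (Y j) =
      ∑ t ∈ Finset.range (X j), ∑ b ∈ Finset.range (Y i),
        if SameColorAt n col X t i then 0 else cornerSum n col X Y r t b *
          ∑ B ∈ (classBelow n col X Y i (X i) (Y j)).powerset with
            (∀ v ∈ B, t < X v ∧ b < Y v) ∧ i ∈ B ∧ j ∈ B, ∏ v ∈ B, r v / (1 - r v) := by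
  have hsplit : ∀ R ∈ cornerSets n col X Y (X i) (Y j), _ := fun R hR =>
    split_spec hX hY hi hj hR
  rw [← Finset.sum_product', cornerSum]
  rw [← Finset.sum_fiberwise_of_maps_to (s := cornerSets n col X Y (X i) (Y j))
    (t := Finset.range (X j) ×ˢ Finset.range (Y i))
    (g := fun R => (lastForeign col X i R,
      ({v ∈ R | X v ≤ lastForeign col X i R} : Finset ℕ).sup Y))]
  swap
  · intro R hR
    obtain ⟨h1, h2, -⟩ := hsplit R hR
    simp [h1, h2]
  refine Finset.sum_congr rfl ?_
  rintro ⟨t, b⟩ htb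
  simp only [Finset.mem_product, Finset.mem_range] at htb
  by_cases hcl : SameColorAt n col X t i
  · rw [if_pos hcl]
    refine Finset.sum_eq_zero fun R hR => ?_
    rw [Finset.mem_filter, Prod.mk.injEq] at hR
    obtain ⟨-, -, h3, -⟩ := hsplit R hR.1
    rw [hR.2.1] at h3
    exact absurd hcl h3
  · rw [if_neg hcl, cornerSum, Finset.sum_mul_sum, ← Finset.sum_product']
    refine Finset.sum_bij' (fun R _ => (({v ∈ R | X v ≤ t} : Finset ℕ), {v ∈ R | t < X v}))
      (fun p _ => p.1 ∪ p.2) ?_ ?_ ?_ ?_ ?_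
    · intro R hR
      rw [Finset.mem_filter, Prod.mk.injEq] at hR
      obtain ⟨hR, rfl, hb⟩ := hR
      obtain ⟨h1, h2, h3, h4, h5⟩ := hsplit R hR
      simp only [cornerSets, Finset.mem_filter, Finset.mem_powerset] at hR
      obtain ⟨hsub, hc, hx, hy⟩ := hR
      have iR := hX.mem_of_sup_eq hsub hi hx
      have jR := hY.mem_of_sup_eq hsub hj hy
      simp only [Finset.mem_product, cornerSets, Finset.mem_filter, Finset.mem_powerset]
      refine ⟨⟨(Finset.filter_subset _ _).trans hsub, ?_, h4, hb⟩, ?_, ?_, ⟨iR, by omega⟩,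
        ⟨jR, by omega⟩⟩
      · exact fun v hv w hw => hc v (Finset.mem_filter.mp hv).1 w (Finset.mem_filter.mp hw).1
      · intro v hv
        rw [Finset.mem_filter] at hv
        obtain ⟨a1, a2, a3, -⟩ := h5 v hv.1 hv.2
        simp [classBelow, a1, a2, a3, Finset.mem_range.mp (hsub hv.1)]
      · intro v hv
        refine ⟨hv.2, ?_⟩
        rw [← hb]
        exact (h5 v hv.1 hv.2).2.2.2
    · rintro ⟨R₀, B⟩ h
      simp only [Finset.mem_product, Finset.mem_filter, Finset.mem_powerset] at h
      obtain ⟨hR, hB, htB, hiB, hjB⟩ := h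
      obtain ⟨h1, h2, h3, h4, h5⟩ :=
        union_spec hXji hYij htb.1 htb.2 hcl hR hB htB hiB hjB
      rw [Finset.mem_filter, Prod.mk.injEq]
      refine ⟨h1, h2, ?_⟩
      rw [h2, h3]
      simp only [cornerSets, Finset.mem_filter] at hR
      exact hR.2.2.2
    · intro R _
      ext v
      simp only [Finset.mem_union, Finset.mem_filter]
      have := le_or_gt (X v) t
      tauto
    · rintro ⟨R₀, B⟩ h
      simp only [Finset.mem_product, Finset.mem_filter, Finset.mem_powerset] at h
      obtain ⟨hR, hB, htB, hiB, hjB⟩ := h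
      obtain ⟨h1, h2, h3, h4, h5⟩ :=
        union_spec hXji hYij htb.1 htb.2 hcl hR hB htB hiB hjB
      rw [h3, h4]
    · intro R _
      rw [← Finset.prod_union]
      · congr 1
        ext v
        simp only [Finset.mem_union, Finset.mem_filter]
        have := le_or_gt (X v) t
        tauto
      · rw [Finset.disjoint_left]
        intro v hv hv'
        rw [Finset.mem_filter] at hv hv'
        omega

end

/-! ### The recursion in two stages -/

section

variable {n : ℕ} {col X Y : ℕ → ℕ} {r : ℕ → ℝ}

/-- The total weight of the subsets of `S` that contain `T`. -/
theorem sum_prod_odds_superset {S T : Finset ℕ} (hTS : T ⊆ S) (hr : ∀ v ∈ S, r v < 1) :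
    ∑ B ∈ S.powerset with T ⊆ B, ∏ v ∈ B, r v / (1 - r v)
      = (∏ v ∈ T, r v) * (∏ v ∈ S, (1 - r v))⁻¹ := by
  -- Expanding the product of odds + 1, with the 1 replaced by 0 on `T`, leaves exactly the subsets
  -- containing `T`. Each factor is r/(1 - r) on `T` and 1/(1 - r) elsewhere.
  have h1 := Finset.prod_add (fun v => r v / (1 - r v)) (fun v => if v ∈ T then (0 : ℝ) else 1) S
  have h2 : ∀ B ∈ S.powerset, (∏ v ∈ B, r v / (1 - r v)) *
      ∏ v ∈ S \ B, (if v ∈ T then (0 : ℝ) else 1)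
        = if T ⊆ B then ∏ v ∈ B, r v / (1 - r v) else 0 := by
    intro B _
    by_cases h : T ⊆ B
    · rw [if_pos h, Finset.prod_eq_one (s := S \ B), mul_one]
      intro v hv
      rw [if_neg fun hvT => (Finset.mem_sdiff.mp hv).2 (h hvT)]
    · rw [if_neg h]
      obtain ⟨v, hvT, hvB⟩ := Finset.not_subset.mp h
      have h0 : ∏ w ∈ S \ B, (if w ∈ T then (0 : ℝ) else 1) = 0 :=
        Finset.prod_eq_zero (Finset.mem_sdiff.mpr ⟨hTS hvT, hvB⟩) (if_pos hvT)
      rw [h0, mul_zero]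
  rw [Finset.sum_filter, ← Finset.sum_congr rfl h2, ← h1, ← Finset.prod_inv_distrib,
    ← Finset.inter_eq_right.mpr hTS, ← Finset.filter_mem_eq_inter, Finset.prod_filter,
    ← Finset.prod_mul_distrib]
  refine Finset.prod_congr rfl fun v hv => ?_
  have : 1 - r v ≠ 0 := by have := hr v hv; linarith
  rw [Finset.filter_mem_eq_inter, Finset.inter_eq_right.mpr hTS]
  split <;> field_simp <;> ring

/-- A set counted here contains `v`, whose color must be that of the last point in the first order.
In the recursion this keeps `b` from being the second rank of a point of the current color, so
strict inequalities suffice there. -/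
theorem sameColorAt_of_cornerSum_ne_zero (hX : IsRanking n X) (hY : IsRanking n Y) {t v : ℕ}
    (hv : v < n) (h : cornerSum n col X Y r t (Y v) ≠ 0) : SameColorAt n col X t v := by
  obtain ⟨R, hR, -⟩ := Finset.exists_ne_zero_of_sum_ne_zero h
  have hR' := hR
  simp only [cornerSets, Finset.mem_filter, Finset.mem_powerset] at hR'
  obtain ⟨hsub, -, hx, hy⟩ := hR'
  have vR := hY.mem_of_sup_eq hsub hv hy
  have h1 : X v ≤ t := hx ▸ Finset.le_sup vR
  obtain ⟨w, hw, hwt⟩ := exists_of_sup_pos (R := R) (f := X) (by have := hX.pos v hv; omega)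
  have hwn := Finset.mem_range.mp (hsub hw)
  refine ⟨w, hwn, by rw [hwt, hx], ?_⟩
  rw [show t = X w by rw [hwt, hx]] at hR
  exact (col_eq_of_mem_cornerSets hX hY hwn hv hR).1

theorem cornerSum_eq_zero (hX : IsRanking n X) (hY : IsRanking n Y) {i j : ℕ}
    (hi : i < n) (hj : j < n) (h : ¬ (col j = col i ∧ X j ≤ X i ∧ Y i ≤ Y j)) :
    cornerSum n col X Y r (X i) (Y j) = 0 := by
  refine Finset.sum_eq_zero fun R hR => ?_
  obtain ⟨h1, h2⟩ := col_eq_of_mem_cornerSets hX hY hi hj hR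
  exact absurd ⟨h1.symm, h2⟩ h

theorem eq_empty_of_sup_eq_zero (hX : IsRanking n X) {R : Finset ℕ} (hR : R ⊆ Finset.range n)
    (h : R.sup X = 0) : R = ∅ := by
  by_contra hne
  obtain ⟨v, hv⟩ := Finset.nonempty_iff_ne_empty.mpr hne
  have := Finset.le_sup (f := X) hv
  have := hX.pos v (Finset.mem_range.mp (hR hv))
  omega

theorem cornerSum_zero_left (hX : IsRanking n X) (b : ℕ) :
    cornerSum n col X Y r 0 b = if b = 0 then 1 else 0 := by
  have : cornerSets n col X Y 0 b = if b = 0 then {∅} else ∅ := by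
    ext R
    simp only [cornerSets, Finset.mem_filter, Finset.mem_powerset]
    constructor
    · rintro ⟨h1, -, h2, h3⟩
      have := eq_empty_of_sup_eq_zero hX h1 h2
      subst this
      simp at h3
      simp [← h3]
    · split
      · rename_i hb
        intro h
        rw [Finset.mem_singleton] at h
        simp [h, hb, Concordant]
      · simp
  rw [cornerSum, this]
  split <;> simp

theorem cornerSum_zero_right (hY : IsRanking n Y) {a : ℕ} (ha : a ≠ 0) :
    cornerSum n col X Y r a 0 = 0 := by
  refine Finset.sum_eq_zero fun R hR => ?_
  simp only [cornerSets, Finset.mem_filter, Finset.mem_powerset] at hR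
  obtain ⟨h1, -, h2, h3⟩ := hR
  have := eq_empty_of_sup_eq_zero hY h1 h3
  subst this
  simp at h2
  omega

open Classical in
theorem sum_cornerSum (hX : IsRanking n X) (hY : IsRanking n Y) :
    ∑ a ∈ Finset.range (n + 1), ∑ b ∈ Finset.range (n + 1), cornerSum n col X Y r a b
      = ∑ R ∈ (Finset.range n).powerset with Concordant col X Y R, ∏ v ∈ R, r v / (1 - r v) := by
  rw [← Finset.sum_product', ← Finset.sum_fiberwise_of_maps_to
    (s := {R ∈ (Finset.range n).powerset | Concordant col X Y R})
    (t := Finset.range (n + 1) ×ˢ Finset.range (n + 1))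
    (g := fun R => (R.sup X, R.sup Y))]
  · refine Finset.sum_congr rfl ?_
    rintro ⟨a, b⟩ -
    simp only [cornerSum, cornerSets, Prod.mk.injEq, Finset.filter_filter]
  · intro R hR
    rw [Finset.mem_filter, Finset.mem_powerset] at hR
    simp only [Finset.mem_product, Finset.mem_range, Nat.lt_succ_iff]
    exact ⟨Finset.sup_le fun v hv => hX.le v (Finset.mem_range.mp (hR.1 hv)),
      Finset.sup_le fun v hv => hY.le v (Finset.mem_range.mp (hR.1 hv))⟩

open Classical in
/-- The recursion for the rows. -/
theorem cornerSum_eq (hX : IsRanking n X) (hY : IsRanking n Y) (hr : ∀ v < n, r v < 1) {i j : ℕ}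
    (hi : i < n) (hj : j < n) (hcol : col j = col i) (hXji : X j ≤ X i) (hYij : Y i ≤ Y j) :
    cornerSum n col X Y r (X i) (Y j) =
      (if j = i then r i else r i * r j) *
        ((∏ v ∈ classBelow n col X Y i (X i) (Y j), (1 - r v))⁻¹ *
          ∑ t ∈ Finset.range (X j), partialSum n col X Y r t i *
            ∏ v ∈ classBelow n col X Y i (X i) (Y j) with X v < t, (1 - r v)) := by
  set C := classBelow n col X Y i (X i) (Y j) with hC
  have hrC : ∀ v ∈ C, r v < 1 := fun v hv => hr v (by
    simp only [hC, classBelow, Finset.mem_filter, Finset.mem_range] at hv; exact hv.1)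
  have hpos : ∀ S : Finset ℕ, S ⊆ C → ∏ v ∈ S, (1 - r v) ≠ 0 := fun S hS =>
    Finset.prod_ne_zero_iff.mpr fun v hv => by have := hrC v (hS hv); linarith
  rw [cornerSum_eq_sum_split hX hY hi hj hXji hYij, ← hC, Finset.mul_sum, Finset.mul_sum]
  refine Finset.sum_congr rfl fun t ht => ?_
  rw [Finset.mem_range] at ht
  rw [partialSum]
  by_cases hcl : SameColorAt n col X t i
  · simp [hcl]
  simp only [if_neg hcl]
  rw [Finset.sum_mul, Finset.mul_sum, Finset.mul_sum]
  refine Finset.sum_congr rfl fun b hb => ?_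
  rw [Finset.mem_range] at hb
  by_cases hE : cornerSum n col X Y r t b = 0
  · simp [hE]
  -- The part behind the cut is any subset of this box that contains `i` and `j`.
  set box : Finset ℕ := {v ∈ C | t < X v ∧ b < Y v} with hbox
  have hsets : (Finset.filter (fun B => (∀ v ∈ B, t < X v ∧ b < Y v) ∧ i ∈ B ∧ j ∈ B) C.powerset)
      = Finset.filter (fun B => {i, j} ⊆ B) box.powerset := by
    ext B
    simp only [Finset.mem_filter, Finset.mem_powerset, Finset.insert_subset_iff,
      Finset.singleton_subset_iff, hbox]
    exact ⟨fun h => ⟨fun v hv => Finset.mem_filter.mpr ⟨h.1 hv, h.2.1 v hv⟩, h.2.2⟩,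
      fun h => ⟨fun v hv => (Finset.mem_filter.mp (h.1 hv)).1,
        fun v hv => (Finset.mem_filter.mp (h.1 hv)).2, h.2⟩⟩
  have hij : ({i, j} : Finset ℕ) ⊆ box := by
    simp only [Finset.insert_subset_iff, Finset.singleton_subset_iff, hbox, hC, classBelow,
      Finset.mem_filter, Finset.mem_range]
    refine ⟨⟨⟨hi, trivial, le_rfl, hYij⟩, by omega, hb⟩, ⟨⟨hj, hcol, hXji, le_rfl⟩, ht, by omega⟩⟩
  rw [hsets, sum_prod_odds_superset hij fun v hv => hrC v (Finset.filter_subset _ _ hv)]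
  have hT : ∏ v ∈ ({i, j} : Finset ℕ), r v = if j = i then r i else r i * r j := by
    split
    · rename_i h; simp [h]
    · rename_i h; rw [Finset.prod_pair (Ne.symm h)]
  rw [hT]
  -- The class splits into `box`, `low` and `side`. The product over `low` does not involve `b` and
  -- that over `side` does not involve `j`; replacing the box product by the quotient of the others
  -- therefore separates the sums over `t` and `b`.
  set low : Finset ℕ := {v ∈ C | X v < t} with hlow
  set side : Finset ℕ :=
    {v ∈ Finset.range n | col v = col i ∧ t < X v ∧ X v < X i ∧ Y v < b} with hside
  -- Together with `hXt`, this ensures that no class point lies on the boundary lines of the box,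
  -- where the three pieces would miss it.
  have hYb : ∀ v < n, col v = col i → Y v ≠ b := by
    rintro v hv hvc rfl
    obtain ⟨k, hk, hkt, hkc⟩ := sameColorAt_of_cornerSum_ne_zero hX hY hv hE
    exact hcl ⟨k, hk, hkt, hkc.trans hvc⟩
  have hXt : ∀ v < n, col v = col i → X v ≠ t := fun v hv hvc h => hcl ⟨v, hv, h, hvc⟩
  have hsidelow : Disjoint side low := by
    rw [Finset.disjoint_left]
    intro v hv hv'
    simp only [hside, hlow, Finset.mem_filter] at hv hv'
    omega
  have hbl : Disjoint box (side ∪ low) := by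
    rw [Finset.disjoint_left]
    intro v hv hv'
    simp only [hside, hlow, hbox, Finset.mem_filter, Finset.mem_union] at hv hv'
    omega
  have hunion : C = box ∪ (side ∪ low) := by
    ext v
    simp only [hside, hlow, hbox, hC, classBelow, Finset.mem_filter, Finset.mem_union,
      Finset.mem_range]
    constructor
    · rintro ⟨h1, h2, h3, h4⟩
      have h5 := hYb v h1 h2
      have h6 := hXt v h1 h2
      by_cases hlt : X v < t
      · exact .inr (.inr ⟨⟨h1, h2, h3, h4⟩, hlt⟩)
      by_cases hYlt : Y v < b
      · refine .inr (.inl ⟨h1, h2, by omega, ?_, hYlt⟩)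
        have : X v ≠ X i := fun h => by
          have := hX.inj v h1 i hi h
          subst this
          omega
        omega
      · exact .inl ⟨⟨h1, h2, h3, h4⟩, by omega, by omega⟩
    · rintro (h | h | h)
      · exact h.1
      · exact ⟨h.1, h.2.1, by omega, by omega⟩
      · exact h.1
  have hCprod : ∏ v ∈ C, (1 - r v)
      = (∏ v ∈ box, (1 - r v)) * ((∏ v ∈ side, (1 - r v)) * ∏ v ∈ low, (1 - r v)) := by
    conv_lhs => rw [hunion]
    rw [Finset.prod_union hbl, Finset.prod_union hsidelow]
  have n1 := hpos box (Finset.filter_subset _ _)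
  have n2 := hpos side (by rw [hunion]; exact fun v hv => by simp [hv])
  have n3 := hpos low (Finset.filter_subset _ _)
  rw [hCprod]
  field_simp

end

theorem IsRanking.exists_eq {n : ℕ} {X : ℕ → ℕ} (hX : IsRanking n X) {k : ℕ} (hk : 1 ≤ k)
    (hkn : k ≤ n) : ∃ i < n, X i = k := by
  have h := Finset.surj_on_of_inj_on_of_card_le (s := Finset.range n) (t := Finset.Icc 1 n)
    (fun i _ => X i)
    (fun i hi => Finset.mem_Icc.mpr ⟨hX.pos i (Finset.mem_range.mp hi),
      hX.le i (Finset.mem_range.mp hi)⟩)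
    (fun i j hi hj h => hX.inj i (Finset.mem_range.mp hi) j (Finset.mem_range.mp hj) h)
    (by simp) k (Finset.mem_Icc.mpr ⟨hk, hkn⟩)
  obtain ⟨i, hi, h⟩ := h
  exact ⟨i, Finset.mem_range.mp hi, h.symm⟩

/-- The product of `1 - r v` over the points `v` of `C` with `f v = x`. -/
noncomputable def fiberProd (C : Finset ℕ) (f : ℕ → ℕ) (r : ℕ → ℝ) (x : ℕ) : ℝ :=
  ∏ v ∈ C with f v = x, (1 - r v)

theorem fiberProd_empty (f : ℕ → ℕ) (r : ℕ → ℝ) : fiberProd ∅ f r = 1 := by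
  funext x; simp [fiberProd]

theorem fiberProd_insert {C : Finset ℕ} {f : ℕ → ℕ} {r : ℕ → ℝ} {j : ℕ}
    (h : ∀ v ∈ C, f v ≠ f j) :
    fiberProd (insert j C) f r = Function.update (fiberProd C f r) (f j) (1 - r j) := by
  funext x
  by_cases hx : x = f j
  · subst hx
    rw [Function.update_self, fiberProd, Finset.filter_insert, if_pos rfl,
      Finset.filter_false_of_mem h]
    simp
  · rw [Function.update_of_ne hx, fiberProd, Finset.filter_insert, if_neg (Ne.symm hx), fiberProd]

/-- This translates products of leaf factors, as used by the tree, into the products over sets of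
points in the recursion. -/
theorem prod_range_fiberProd (C : Finset ℕ) (f : ℕ → ℕ) (r : ℕ → ℝ) (K : ℕ) :
    ∏ x ∈ Finset.range K, fiberProd C f r x = ∏ v ∈ C with f v < K, (1 - r v) := by
  rw [← Finset.prod_fiberwise_of_maps_to (s := {v ∈ C | f v < K}) (t := Finset.range K) (g := f)
    (fun v hv => Finset.mem_range.mpr (Finset.mem_filter.mp hv).2)]
  refine Finset.prod_congr rfl fun x hx => ?_
  rw [fiberProd, Finset.filter_filter]
  congr 1
  ext v
  simp only [Finset.mem_filter]
  have := Finset.mem_range.mp hx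
  constructor
  · rintro ⟨h, rfl⟩; exact ⟨h, this, rfl⟩
  · rintro ⟨h, -, h'⟩; exact ⟨h, h'⟩

/-! ### Points in memory, and loading the tree -/

namespace RealRAM

/-- The memory holds the colors, ranks and reduced probabilities of `n` points. -/
structure Points (n : ℕ) (col X Y : ℕ → ℕ) (r : ℕ → ℝ) (s : State) : Prop where
  color : s.nat 1 = col
  fst : s.nat 9 = X
  snd : s.nat 10 = Y
  invFst : ∀ i < n, s.nat 11 (X i) = i
  invSnd : ∀ i < n, s.nat 12 (Y i) = i
  prob : s.real 8 = r
  isFst : IsRanking n X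
  isSnd : IsRanking n Y
  lt_one : ∀ v < n, r v < 1

theorem Points.congr {n : ℕ} {col X Y : ℕ → ℕ} {r : ℕ → ℝ} {s t : State}
    (hs : Points n col X Y r s) (h1 : t.nat 1 = s.nat 1) (h9 : t.nat 9 = s.nat 9)
    (h10 : t.nat 10 = s.nat 10) (h11 : t.nat 11 = s.nat 11) (h12 : t.nat 12 = s.nat 12)
    (h8 : t.real 8 = s.real 8) : Points n col X Y r t := by
  refine ⟨h1.trans hs.color, h9.trans hs.fst, h10.trans hs.snd, ?_, ?_, h8.trans hs.prob,
    hs.isFst, hs.isSnd, hs.lt_one⟩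
  · rw [h11]; exact hs.invFst
  · rw [h12]; exact hs.invSnd

namespace Cmd

/-- The command does not change the sizes and the points. -/
def Keeps (c : Cmd) : Bool :=
  ([0, 2, 3, 4, 5, 6, 7, 8, 1, 9, 10, 11, 12].all fun a => !(c.natWrites.contains a)) &&
    !(c.realWrites.contains 8)

theorem Frame.sizes {c : Cmd} {s t : State} {n h : ℕ} (hf : Frame c s t) (hs : Sizes n h s)
    (hc : c.Keeps = true) : Sizes n h t := by
  simp only [Keeps, List.all_cons, Bool.and_eq_true, Bool.not_eq_true', List.contains_eq_mem,
    decide_eq_false_iff_not] at hc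
  refine hs.congr fun a ha h1 => hf.nat a ?_
  interval_cases a <;> simp_all

theorem Frame.points {c : Cmd} {s t : State} {n : ℕ} {col X Y : ℕ → ℕ} {r : ℕ → ℝ}
    (hf : Frame c s t) (hs : Points n col X Y r s) (hc : c.Keeps = true) :
    Points n col X Y r t := by
  simp only [Keeps, List.all_cons, Bool.and_eq_true, Bool.not_eq_true', List.contains_eq_mem,
    decide_eq_false_iff_not] at hc
  refine hs.congr (hf.nat _ ?_) (hf.nat _ ?_) (hf.nat _ ?_) (hf.nat _ ?_) (hf.nat _ ?_)
    (hf.real _ ?_) <;> tauto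

theorem run_loadTable {n h : ℕ} {s : State} (hs : Sizes n h s) (hT : TreeRep (2 ^ h) s 1 0)
    {a i : ℕ} (ha : s.nat 19 0 = a) (han : a ≤ n) (hi : s.nat 33 0 = i) :
    TreeRep (2 ^ h) (loadTable.run s) 1
      (fun t => if t < a then s.real 16 (s.nat 8 t + i) else 0) := by
  have key := run_loop (s := s) (v := 21) (b := 0) (p := loadTableStep)
    (fun k st => TreeRep (2 ^ h) st 1
      (fun t => if t < k ∧ t < a then s.real 16 (s.nat 8 t + i) else 0))
    (by simp only [treeRep_setNat, Nat.not_lt_zero, false_and, if_false]; exact hT) (by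
      intro k st hkn hk hf hI
      rw [hs.num] at hkn
      rw [treeRep_setNat]
      have h19 : st.nat 19 0 = a := by rw [hf.nat 19 (by decide), ha]
      have h33 : st.nat 33 0 = i := by rw [hf.nat 33 (by decide), hi]
      have h8 : st.nat 8 = s.nat 8 := hf.nat 8 (by decide)
      have h16 : st.real 16 = s.real 16 := hf.real 16 (by decide)
      have hst : Sizes n h st := hf.sizes hs (by decide)
      rw [loadTableStep, run_ite]
      by_cases hka : k < a
      · rw [if_pos (by simpa [hk, h19] using hka), run_seq, run_seq]
        set s2 := (setReal 14 (.const 0) (.get 16 (.add (.get 8 (natVar 21)) (natVar 33)))).run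
          ((setNat 16 (.const 0) (natVar 21)).run st) with hs2
        have f16 : s2.nat 16 0 = k := by simp [hs2, hk]
        have f14 : s2.real 14 0 = s.real 16 (s.nat 8 k + i) := by
          simp [hs2, hk, h8, h33, h16]
        have := run_treeSetSum (s := s2) (hst.congr fun b hb _ => by
            simp [hs2, show b ≠ 16 by omega]) (hI.congr (by simp [hs2]) (by simp [hs2]))
          (by rw [f16]; have := hs.lt; omega)
        rw [f16, f14] at this
        convert this using 1
        funext t
        by_cases htk : t = k
        · subst htk; simp [hka]
        · rw [Function.update_of_ne htk]
          have : t < k + 1 ↔ t < k := by omega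
          simp [this]
      · rw [if_neg (by simpa [hk, h19] using hka), run_skip]
        convert hI using 1
        funext t
        congr 1
        simp only [eq_iff_iff]
        omega)
  rw [hs.num] at key
  rw [loadTable]
  convert key using 1
  funext t
  congr 1
  simp only [eq_iff_iff]
  omega

theorem run_loadRow {n h : ℕ} {s : State} (hs : Sizes n h s) (hT : TreeRep (2 ^ h) s 1 0) :
    TreeRep (2 ^ h) (loadRow.run s) 1 (fun y => if y ≤ n then s.real 15 y else 0) := by
  have key := run_loop (s := s) (v := 21) (b := 5) (p := loadRowStep)
    (fun k st => TreeRep (2 ^ h) st 1 (fun y => if y < k then s.real 15 y else 0))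
    (by simp only [treeRep_setNat, Nat.not_lt_zero, if_false]; exact hT) (by
      intro k st hkn hk hf hI
      rw [hs.succ_num] at hkn
      rw [treeRep_setNat, loadRowStep, run_seq, run_seq]
      have h15 : st.real 15 = s.real 15 := hf.real 15 (by decide)
      have hst : Sizes n h st := hf.sizes hs (by decide)
      set s2 := (setReal 14 (.const 0) (.get 15 (natVar 21))).run
        ((setNat 16 (.const 0) (natVar 21)).run st) with hs2
      have f16 : s2.nat 16 0 = k := by simp [hs2, hk]
      have f14 : s2.real 14 0 = s.real 15 k := by simp [hs2, hk, h15]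
      have := run_treeSetSum (s := s2) (hst.congr fun b hb _ => by
          simp [hs2, show b ≠ 16 by omega]) (hI.congr (by simp [hs2]) (by simp [hs2]))
        (by rw [f16]; have := hs.lt; omega)
      rw [f16, f14] at this
      convert this using 1
      funext y
      by_cases hyk : y = k
      · subst hyk; simp
      · rw [Function.update_of_ne hyk]
        have : y < k + 1 ↔ y < k := by omega
        simp [this])
  rw [hs.succ_num] at key
  rw [loadRow]
  convert key using 1
  funext y
  congr 1
  simp only [eq_iff_iff]
  omega

end Cmd

end RealRAM

/-! ### Computation of a row -/

namespace RealRAM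

namespace Cmd

section

variable {n h : ℕ} {col X Y : ℕ → ℕ} {r : ℕ → ℝ}

theorem classBelow_succ_of_mem (hY : IsRanking n Y) {i j a k : ℕ} (hj : j < n)
    (hYj : Y j = k + 1) (hc : col j = col i ∧ X j ≤ a) :
    classBelow n col X Y i a (k + 1) = insert j (classBelow n col X Y i a k) := by
  ext v
  simp only [classBelow, Finset.mem_filter, Finset.mem_range, Finset.mem_insert]
  constructor
  · rintro ⟨h1, h2, h3, h4⟩
    by_cases hvj : v = j
    · exact .inl hvj
    · have : Y v ≠ Y j := fun h => hvj (hY.inj v h1 j hj h)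
      exact .inr ⟨h1, h2, h3, by omega⟩
  · rintro (rfl | ⟨h1, h2, h3, h4⟩)
    · exact ⟨hj, hc.1, hc.2, by omega⟩
    · exact ⟨h1, h2, h3, by omega⟩

theorem classBelow_succ_of_not_mem (hY : IsRanking n Y) {i j a k : ℕ} (hj : j < n)
    (hYj : Y j = k + 1) (hc : ¬ (col j = col i ∧ X j ≤ a)) :
    classBelow n col X Y i a (k + 1) = classBelow n col X Y i a k := by
  ext v
  simp only [classBelow, Finset.mem_filter, Finset.mem_range]
  constructor
  · rintro ⟨h1, h2, h3, h4⟩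
    have hvj : v ≠ j := by rintro rfl; exact hc ⟨h2, h3⟩
    have : Y v ≠ Y j := fun h => hvj (hY.inj v h1 j hj h)
    exact ⟨h1, h2, h3, by omega⟩
  · rintro ⟨h1, h2, h3, h4⟩
    exact ⟨h1, h2, h3, by omega⟩

/-- The state of the row computation for the point `i` after the ranks up to `k`. -/
structure RowInv (n h : ℕ) (col X Y : ℕ → ℕ) (r : ℕ → ℝ) (i : ℕ) (S : ℕ → ℝ) (k : ℕ)
    (st : State) : Prop where
  tree : TreeRep (2 ^ h) st (fiberProd (classBelow n col X Y i (X i) k) X r) S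
  prod : st.real 17 0 = (∏ v ∈ classBelow n col X Y i (X i) k, (1 - r v))⁻¹
  row : ∀ b ≤ k, st.real 15 b = cornerSum n col X Y r (X i) b

theorem rowInv_setNat {i k a m v : ℕ} {S : ℕ → ℝ} {st : State} :
    RowInv n h col X Y r i S k (st.setNat a m v) ↔ RowInv n h col X Y r i S k st :=
  ⟨fun H => ⟨treeRep_setNat.mp H.tree, H.prod, H.row⟩,
    fun H => ⟨treeRep_setNat.mpr H.tree, H.prod, H.row⟩⟩

/-- The second rank `k + 1` belongs to one point `j`. If it joins the class of `i`, the inverse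
class product is divided by 1 - r j, and the query at leaf `X j` is the sum in `cornerSum_eq`. In
all cases where the entry must vanish, `cornerSum_eq_zero` applies. -/
theorem run_rowStep {st : State} (hs : Sizes n h st) (hp : Points n col X Y r st) {i k : ℕ}
    (hi : i < n) (hst : st.nat 33 0 = i) (hk : st.nat 22 0 = k) (hkn : k < n) {S : ℕ → ℝ}
    (hS : ∀ t < X i, S t = partialSum n col X Y r t i) (hI : RowInv n h col X Y r i S k st) :
    RowInv n h col X Y r i S (k + 1) (rowStep.run st) := by
  obtain ⟨j, hj, hjY⟩ := hp.isSnd.exists_eq (k := k + 1) (by omega) (by omega)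
  have h12 : st.nat 12 (k + 1) = j := by rw [← hjY]; exact hp.invSnd j hj
  rw [rowStep, run_seq, run_seq, run_ite]
  set s1 := (setReal 15 (.add (natVar 22) (.const 1)) (.const 0)).run
    ((setNat 34 (.const 0) (.get 12 (.add (natVar 22) (.const 1)))).run st) with hs1
  have e1 : s1 = (st.setNat 34 0 j).setReal 15 (k + 1) 0 := by simp [hs1, hk, h12]
  have hcond : (Test.and (.natEq (.get 1 (natVar 34)) (.get 1 (natVar 33)))
      (.not (.natLt (.get 9 (natVar 33)) (.get 9 (natVar 34))))).Holds s1 ↔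
      (col j = col i ∧ X j ≤ X i) := by
    simp [e1, hst, hp.color, hp.fst]
  have hrow1 : ∀ b ≤ k, s1.real 15 b = cornerSum n col X Y r (X i) b := fun b hb => by
    rw [e1]
    simp only [State.setReal_real, if_true]
    rw [Function.update_of_ne (by omega)]
    exact hI.row b hb
  by_cases hc : col j = col i ∧ X j ≤ X i
  swap
  · rw [if_neg (by rwa [hcond]), run_skip]
    refine ⟨?_, ?_, ?_⟩
    · rw [classBelow_succ_of_not_mem hp.isSnd hj hjY hc]
      exact hI.tree.congr (by simp [e1]) (by simp [e1])
    · rw [classBelow_succ_of_not_mem hp.isSnd hj hjY hc]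
      simpa [e1] using hI.prod
    · intro b hb
      rcases Nat.le_succ_iff.mp hb with hb | rfl
      · exact hrow1 b hb
      · rw [Nat.succ_eq_add_one, ← hjY, cornerSum_eq_zero hp.isFst hp.isSnd hi hj (by tauto)]
        simp [e1, hjY]
  rw [if_pos (by rwa [hcond]), run_seq, run_seq, run_seq, run_seq]
  have hins := classBelow_succ_of_mem hp.isSnd hj hjY hc
  set C := classBelow n col X Y i (X i) k with hC
  have hjC : j ∉ C := by simp [hC, classBelow, hjY]
  have hCne : ∀ v ∈ C, X v ≠ X j := fun v hv h => by
    have hvn : v < n := by simp only [hC, classBelow, Finset.mem_filter, Finset.mem_range] at hv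
                           exact hv.1
    exact hjC (hp.isFst.inj v hvn j hj h ▸ hv)
  have hXjlt : X j < 2 ^ h := lt_of_le_of_lt (hp.isFst.le j hj) hs.lt
  set s2 := (setNat 16 (.const 0) (.get 9 (natVar 34))).run
    ((setReal 17 (.const 0) (.div (realVar 17) (.sub (.const 1) (.get 8 (natVar 34))))).run s1)
    with hs2
  have e2 : s2 = (s1.setReal 17 0 (st.real 17 0 / (1 - r j))).setNat 16 0 (X j) := by
    simp [hs2, e1, hp.prob, hp.fst]
  have hprod : s2.real 17 0 = (∏ v ∈ classBelow n col X Y i (X i) (k + 1), (1 - r v))⁻¹ := by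
    rw [e2]
    simp only [State.setNat_real, State.setReal_real, if_true, Function.update_self]
    rw [hI.prod, hins, Finset.prod_insert hjC, mul_inv, div_eq_mul_inv, mul_comm]
  have htree2 : TreeRep (2 ^ h) s2 (fiberProd C X r) S :=
    hI.tree.congr (by simp [e2, e1]) (by simp [e2, e1])
  have hsz2 : Sizes n h s2 := hs.congr fun a ha _ => by
    simp [e2, e1, show a ≠ 16 by omega, show a ≠ 34 by omega]
  have n16 : s2.nat 16 0 = X j := by simp [e2]
  set mid : Cmd := ite (.natLt (.get 10 (natVar 34)) (.get 10 (natVar 33)))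
        skip
        (treeQuery ;;
          ite (.natEq (natVar 34) (natVar 33))
            (setReal 15 (.add (natVar 22) (.const 1))
              (.mul (.get 8 (natVar 33)) (.mul (realVar 17) (realVar 12))))
            (setReal 15 (.add (natVar 22) (.const 1))
              (.mul (.mul (.get 8 (natVar 33)) (.get 8 (natVar 34)))
                (.mul (realVar 17) (realVar 12))))) with hmid
  set s3 := mid.run s2 with hs3
  have f3 : Frame mid s2 s3 := frame_run _ _
  have hrow3 : ∀ b ≤ k + 1, s3.real 15 b = cornerSum n col X Y r (X i) b := by
    have hrow2 : ∀ b ≤ k, s2.real 15 b = cornerSum n col X Y r (X i) b := fun b hb => by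
      rw [← hrow1 b hb]; simp [e2]
    have hcond3 : (Test.natLt (.get 10 (natVar 34)) (.get 10 (natVar 33))).Holds s2 ↔
        Y j < Y i := by simp [e2, e1, hst, hp.snd]
    rw [hs3, hmid, run_ite]
    by_cases hYlt : Y j < Y i
    · rw [if_pos (by rwa [hcond3]), run_skip]
      intro b hb
      rcases Nat.le_succ_iff.mp hb with hb | rfl
      · exact hrow2 b hb
      · rw [Nat.succ_eq_add_one, ← hjY, cornerSum_eq_zero hp.isFst hp.isSnd hi hj (by omega)]
        simp [e2, e1, hjY]
    rw [if_neg (by rwa [hcond3]), run_seq, run_ite]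
    have hq := run_treeQuery hsz2 htree2 (by rw [n16]; exact hXjlt)
    have fq : Frame treeQuery s2 (treeQuery.run s2) := frame_run _ _
    set s' := treeQuery.run s2 with hs'
    have q34 : s'.nat 34 0 = j := by rw [fq.nat 34 (by decide)]; simp [e2, e1]
    have q33 : s'.nat 33 0 = i := by rw [fq.nat 33 (by decide)]; simp [e2, e1, hst]
    have q22 : s'.nat 22 0 = k := by rw [fq.nat 22 (by decide)]; simp [e2, e1, hk]
    have q8 : s'.real 8 = r := by rw [fq.real 8 (by decide)]; simp [e2, e1, hp.prob]
    have q17 := hprod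
    rw [← fq.real 17 (by decide)] at q17
    have q15 : s'.real 15 = s2.real 15 := fq.real 15 (by decide)
    -- Only leaves `t` before `X j` are summed, and the factor of `j` enters only behind them. The
    -- query may thus precede the insertion of that factor.
    have hval : (∏ v ∈ classBelow n col X Y i (X i) (k + 1), (1 - r v))⁻¹ *
          ∑ t ∈ Finset.range (X j), partialSum n col X Y r t i *
            ∏ v ∈ classBelow n col X Y i (X i) (k + 1) with X v < t, (1 - r v)
        = s'.real 17 0 * s'.real 12 0 := by
      rw [q17, hq, n16, prefixSum]
      congr 1
      refine Finset.sum_congr rfl fun t ht => ?_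
      rw [Finset.mem_range] at ht
      rw [hS t (by omega), prod_range_fiberProd, hins, Finset.filter_insert,
        if_neg (by omega)]
    have hcs := cornerSum_eq (r := r) hp.isFst hp.isSnd hp.lt_one hi hj hc.1 hc.2
      (by omega : Y i ≤ Y j)
    rw [hjY, hval] at hcs
    intro b hb
    by_cases hji : j = i
    · rw [if_pos (by simp [q34, q33, hji])]
      rcases Nat.le_succ_iff.mp hb with hb | rfl
      · simp only [run_setReal, State.setReal_real, if_true, NatExpr.eval, q22]
        rw [Function.update_of_ne (by omega), q15]
        exact hrow2 b hb
      · rw [if_pos hji] at hcs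
        simp [q22, hcs, q8, q33]
    · rw [if_neg (by simp [q34, q33, hji])]
      rcases Nat.le_succ_iff.mp hb with hb | rfl
      · simp only [run_setReal, State.setReal_real, if_true, NatExpr.eval, q22]
        rw [Function.update_of_ne (by omega), q15]
        exact hrow2 b hb
      · rw [if_neg hji] at hcs
        simp [q22, hcs, q8, q33, q34]
  set s4 := (setReal 13 (.const 0) (.sub (.const 1) (.get 8 (natVar 34)))).run s3 with hs4
  have f34 : s3.nat 34 0 = j := by rw [f3.nat 34 (by decide)]; simp [e2, e1]
  have f8 : s3.real 8 = r := by rw [f3.real 8 (by decide)]; simp [e2, e1, hp.prob]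
  have e4 : s4 = s3.setReal 13 0 (1 - r j) := by simp [hs4, f34, f8]
  have hsz4 : Sizes n h s4 := (f3.sizes hsz2 (by decide)).congr fun a _ _ => by simp [e4]
  have n16' : s4.nat 16 0 = X j := by rw [e4, State.setReal_nat, f3.nat 16 (by decide), n16]
  have htree4 : TreeRep (2 ^ h) s4 (fiberProd C X r) S := htree2.congr
    (by rw [e4, ← f3.real 10 (by decide)]; simp) (by rw [e4, ← f3.real 11 (by decide)]; simp)
  have hT := run_treeSetFactor hsz4 htree4 (by rw [n16']; exact hXjlt)
  refine ⟨?_, ?_, ?_⟩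
  · rw [n16'] at hT
    rw [hins, fiberProd_insert hCne]
    simpa [e4] using hT
  · rw [run_real 17 (by decide), e4]
    simp only [State.setReal_real]
    norm_num
    rw [f3.real 17 (by decide), hprod]
  · rw [run_real 15 (by decide), e4]
    simpa using hrow3

theorem run_pointRow {s : State} (hs : Sizes n h s) (hp : Points n col X Y r s) {i : ℕ}
    (hi : i < n) (h19 : s.nat 19 0 = X i) (h33 : s.nat 33 0 = i)
    (hT : ∀ t < X i, s.real 16 (t * n + i) = partialSum n col X Y r t i) :
    ∀ b ≤ n, (pointRow.run s).real 15 b = cornerSum n col X Y r (X i) b := by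
  rw [pointRow, run_seq, run_seq, run_seq, run_seq]
  have fa : Frame treeReset s (treeReset.run s) := frame_run _ _
  have ta := run_treeReset hs
  set sa := treeReset.run s
  have sza : Sizes n h sa := fa.sizes hs (by decide)
  have hpa : Points n col X Y r sa := fa.points hp (by decide)
  have fb : Frame loadTable sa (loadTable.run sa) := frame_run _ _
  have tb := run_loadTable (i := i) sza ta ((congrFun (fa.nat 19 (by decide)) 0).trans h19)
    (hp.isFst.le i hi) ((congrFun (fa.nat 33 (by decide)) 0).trans h33)
  set sb := loadTable.run sa
  have szb : Sizes n h sb := fb.sizes sza (by decide)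
  have hpb : Points n col X Y r sb := fb.points hpa (by decide)
  set S : ℕ → ℝ := fun t => if t < X i then sa.real 16 (sa.nat 8 t + i) else 0
  have hS : ∀ t < X i, S t = partialSum n col X Y r t i := fun t ht => by
    have := hp.isFst.le i hi
    simp only [S, if_pos ht, fa.real 16 (by decide), sza.offset t (by omega)]
    exact hT t ht
  set sc := (setReal 17 (.const 0) (.const 1)).run ((setReal 15 (.const 0) (.const 0)).run sb)
    with hsc
  have szc : Sizes n h sc := szb.congr fun a _ _ => by simp [hsc]
  have hpc : Points n col X Y r sc := hpb.congr rfl rfl rfl rfl rfl (by simp [hsc])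
  have h33c : sc.nat 33 0 = i := by
    simp only [hsc, run_setReal, State.setReal_nat]
    rw [fb.nat 33 (by decide), fa.nat 33 (by decide), h33]
  have hpos := hp.isFst.pos i hi
  have hempty : classBelow n col X Y i (X i) 0 = ∅ := by
    rw [classBelow, Finset.filter_eq_empty_iff]
    rintro v hv ⟨-, -, h0⟩
    have := hp.isSnd.pos v (Finset.mem_range.mp hv)
    omega
  have key := run_loop (s := sc) (v := 22) (b := 0) (p := rowStep)
    (fun k st => RowInv n h col X Y r i S k st)
    (by
      rw [rowInv_setNat]
      refine ⟨?_, ?_, ?_⟩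
      · rw [hempty, fiberProd_empty]
        exact tb.congr (by simp [hsc]) (by simp [hsc])
      · simp [hempty, hsc]
      · intro b hb
        obtain rfl : b = 0 := by omega
        -- A second maximum of zero would force the empty set, whose first maximum is not `X i`.
        rw [cornerSum_zero_right hp.isSnd (by omega)]
        simp [hsc])
    (by
      intro k st hkn hk hf hI
      rw [szc.num] at hkn
      rw [rowInv_setNat]
      exact run_rowStep (hf.sizes szc (by decide)) (hf.points hpc (by decide)) hi
        (by rw [hf.nat 33 (by decide), h33c]) hk hkn hS hI)
  rw [szc.num] at key
  exact key.row

end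

end Cmd

end RealRAM

/-! ### The list of events -/

/-- The points with the color of `e`, ordered by their first ranks. -/
def colorClass (n : ℕ) (col px : ℕ → ℕ) (e : ℕ) : List ℕ :=
  ((List.range n).map fun k => px (k + 1)).filter fun m => col m = col e

/-- The events for the color of `e`, if `e` is the first point of its color. -/
def colorEvents (n : ℕ) (col px : ℕ → ℕ) (e : ℕ) : List (ℕ × ℕ) :=
  if ∀ m < e, col m ≠ col e then
    (colorClass n col px e).map (fun m => (m, 1)) ++ (colorClass n col px e).map fun m => (m, 0)
  else []

/-- The list of all events. -/
def allEvents (n : ℕ) (col px : ℕ → ℕ) : List (ℕ × ℕ) :=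
  (List.range n).flatMap (colorEvents n col px)

section

variable {n : ℕ} {col X Y px : ℕ → ℕ} {r : ℕ → ℝ}

theorem IsRanking.inv_lt (hX : IsRanking n X) (hpx : ∀ i < n, px (X i) = i) {k : ℕ} (hk : k < n) :
    px (k + 1) < n ∧ X (px (k + 1)) = k + 1 := by
  obtain ⟨i, hi, h⟩ := hX.exists_eq (k := k + 1) (by omega) (by omega)
  rw [← h, hpx i hi]
  exact ⟨hi, rfl⟩

theorem mem_colorClass (hX : IsRanking n X) (hpx : ∀ i < n, px (X i) = i) {e v : ℕ} :
    v ∈ colorClass n col px e ↔ v < n ∧ col v = col e := by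
  simp only [colorClass, List.mem_filter, List.mem_map, List.mem_range, decide_eq_true_eq]
  constructor
  · rintro ⟨⟨k, hk, rfl⟩, h⟩
    exact ⟨(hX.inv_lt hpx hk).1, h⟩
  · rintro ⟨hv, h⟩
    have h1 := hX.pos v hv
    have h2 := hX.le v hv
    refine ⟨⟨X v - 1, by omega, ?_⟩, h⟩
    rw [Nat.sub_add_cancel h1, hpx v hv]

theorem pairwise_colorClass (hX : IsRanking n X) (hpx : ∀ i < n, px (X i) = i) (e : ℕ) :
    (colorClass n col px e).Pairwise fun v w => X v < X w := by
  refine List.Pairwise.filter _ ?_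
  rw [List.pairwise_map]
  refine List.pairwise_lt_range.imp_of_mem fun {k l} hk hl hkl => ?_
  rw [(hX.inv_lt hpx (List.mem_range.mp hk)).2, (hX.inv_lt hpx (List.mem_range.mp hl)).2]
  omega

theorem length_colorClass (hX : IsRanking n X) (hpx : ∀ i < n, px (X i) = i) (e : ℕ) :
    (colorClass n col px e).length = ({v ∈ Finset.range n | col v = col e} : Finset ℕ).card := by
  have hnd : (colorClass n col px e).Nodup :=
    (pairwise_colorClass hX hpx e).imp fun {v w} h => by rintro rfl; omega
  rw [← List.toFinset_card_of_nodup hnd]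
  congr 1
  ext v
  simp [mem_colorClass hX hpx]

/-- Only the first point of a color produces events, twice as many as the color has points. Sorting
all points by the first point of their color shows that each point is counted twice. -/
theorem length_allEvents (hX : IsRanking n X) (hpx : ∀ i < n, px (X i) = i) :
    (allEvents n col px).length = n + n := by
  have h1 : ∀ e, (colorEvents n col px e).length
      = if ∀ m < e, col m ≠ col e then
        2 * ({v ∈ Finset.range n | col v = col e} : Finset ℕ).card else 0 := by
    intro e
    rw [colorEvents]
    split
    · rw [List.length_append, List.length_map, List.length_map, length_colorClass hX hpx]; ring
    · rfl
  have h2 : (allEvents n col px).length = ∑ e ∈ Finset.range n, (colorEvents n col px e).length := by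
    rw [allEvents, List.length_flatMap, Finset.sum_range]
    rw [← List.sum_ofFn, List.ofFn_eq_map, ← List.map_coe_finRange_eq_range, List.map_map]
    rfl
  have h3 := Finset.card_eq_sum_card_fiberwise (s := Finset.range n)
    (t := {e ∈ Finset.range n | ∀ m < e, col m ≠ col e})
    (f := fun v => Nat.find (⟨v, rfl⟩ : ∃ e, col e = col v)) (by
      intro v hv
      have hle := Nat.find_min' (⟨v, rfl⟩ : ∃ e, col e = col v) rfl
      have hspec := Nat.find_spec (⟨v, rfl⟩ : ∃ e, col e = col v)
      simp only [Finset.coe_filter, Finset.mem_range, Set.mem_ofPred_eq]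
      refine ⟨lt_of_le_of_lt hle (Finset.mem_range.mp hv), fun m hm h => ?_⟩
      exact Nat.find_min _ hm (h.trans hspec))
  rw [Finset.card_range] at h3
  rw [h2, Finset.sum_congr rfl fun e _ => h1 e, ← Finset.sum_filter, ← Finset.mul_sum, ← two_mul]
  congr 1
  conv_rhs => rw [h3]
  refine Finset.sum_congr rfl fun e he => ?_
  rw [Finset.mem_filter] at he
  congr 1
  ext v
  simp only [Finset.mem_filter, Finset.mem_range, and_congr_right_iff]
  intro _
  constructor
  · intro h
    rw [Nat.find_eq_iff]
    exact ⟨h.symm, fun m hm h' => he.2 m hm (h'.trans h)⟩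
  · intro h
    have := Nat.find_spec (⟨v, rfl⟩ : ∃ e, col e = col v)
    rw [h] at this
    exact this.symm

open Classical in
theorem mem_allEvents (hX : IsRanking n X) (hpx : ∀ i < n, px (X i) = i) {m : ℕ} (hm : m < n) :
    (m, 1) ∈ allEvents n col px := by
  rw [allEvents, List.mem_flatMap]
  have hle := Nat.find_min' (⟨m, rfl⟩ : ∃ e, col e = col m) rfl
  have hspec := Nat.find_spec (⟨m, rfl⟩ : ∃ e, col e = col m)
  refine ⟨Nat.find (⟨m, rfl⟩ : ∃ e, col e = col m), List.mem_range.mpr (by omega), ?_⟩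
  rw [colorEvents, if_pos fun k hk h => Nat.find_min _ hk (h.trans hspec)]
  rw [List.mem_append]
  left
  rw [List.mem_map]
  exact ⟨m, (mem_colorClass hX hpx).mpr ⟨hm, hspec.symm⟩, rfl⟩

theorem lt_of_mem_allEvents (hX : IsRanking n X) (hpx : ∀ i < n, px (X i) = i) {p : ℕ × ℕ}
    (hp : p ∈ allEvents n col px) : p.1 < n := by
  rw [allEvents, List.mem_flatMap] at hp
  obtain ⟨e, -, he⟩ := hp
  rw [colorEvents] at he
  split at he
  · rw [List.mem_append, List.mem_map, List.mem_map] at he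
    rcases he with ⟨m, hm, rfl⟩ | ⟨m, hm, rfl⟩ <;> exact ((mem_colorClass hX hpx).mp hm).1
  · simp at he

/-- The effect of an event on the factors for the row `a`. -/
noncomputable def eventFactor (X Y : ℕ → ℕ) (r : ℕ → ℝ) (a : ℕ) (A : ℕ → ℝ) (p : ℕ × ℕ) : ℕ → ℝ :=
  if a < X p.1 then Function.update A (Y p.1) (if p.2 = 1 then 1 - r p.1 else 1) else A

/-- The positions changed by switching a list on are among those that switching the same list off
resets; this is the hypothesis of `foldl_eventFactor_off`. -/
theorem foldl_eventFactor_ne (a : ℕ) (l : List ℕ) (A : ℕ → ℝ) (y : ℕ) :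
    (l.map fun m => (m, 1)).foldl (eventFactor X Y r a) A y = A y ∨
      ∃ v ∈ l, a < X v ∧ Y v = y := by
  induction l generalizing A with
  | nil => simp
  | cons m l ih =>
    rw [List.map_cons, List.foldl_cons]
    rcases ih (eventFactor X Y r a A (m, 1)) with h | ⟨v, hv, h⟩
    · rw [h, eventFactor]
      split
      · rename_i ham
        by_cases hy : Y m = y
        · exact .inr ⟨m, by simp, ham, hy⟩
        · left; rw [Function.update_of_ne (Ne.symm hy)]
      · exact .inl rfl
    · exact .inr ⟨v, by simp [hv], h⟩

theorem foldl_eventFactor_off (a : ℕ) (l : List ℕ) (A : ℕ → ℝ)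
    (h : ∀ y, A y = 1 ∨ ∃ v ∈ l, a < X v ∧ Y v = y) :
    (l.map fun m => (m, 0)).foldl (eventFactor X Y r a) A = 1 := by
  induction l generalizing A with
  | nil => funext y; simpa using h y
  | cons m l ih =>
    rw [List.map_cons, List.foldl_cons]
    refine ih _ fun y => ?_
    rw [eventFactor]
    split
    · rename_i ham
      by_cases hy : y = Y m
      · left; simp [hy]
      · rw [Function.update_of_ne hy]
        rcases h y with h | ⟨v, hv, h1, h2⟩
        · exact .inl h
        · rcases List.mem_cons.mp hv with rfl | hv
          · exact absurd h2.symm hy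
          · exact .inr ⟨v, hv, h1, h2⟩
    · rename_i ham
      rcases h y with h | ⟨v, hv, h1, h2⟩
      · exact .inl h
      · rcases List.mem_cons.mp hv with rfl | hv
        · exact absurd h1 ham
        · exact .inr ⟨v, hv, h1, h2⟩

/-- A completed color leaves no trace, so colors can be processed one after another in the same
tree. -/
theorem foldl_colorEvents (a e : ℕ) :
    (colorEvents n col px e).foldl (eventFactor X Y r a) 1 = 1 := by
  rw [colorEvents]
  split
  · rw [List.foldl_append]
    exact foldl_eventFactor_off a _ _ fun y => foldl_eventFactor_ne a _ 1 y
  · rfl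

theorem foldl_eventFactor_on (hY : IsRanking n Y) (a : ℕ) (l : List ℕ) (hl : ∀ v ∈ l, v < n)
    (hnd : l.Nodup) :
    (l.map fun m => (m, 1)).foldl (eventFactor X Y r a) 1
      = fiberProd {v ∈ l.toFinset | a < X v} Y r := by
  induction l using List.reverseRecOn with
  | nil => simp [fiberProd_empty]
  | append_singleton l m ih =>
    rw [List.nodup_append] at hnd
    rw [List.map_append, List.foldl_append, ih (fun v hv => hl v (by simp [hv])) hnd.1]
    simp only [List.map_cons, List.map_nil, List.foldl_cons, List.foldl_nil, eventFactor, if_true]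
    have hset : (l ++ [m]).toFinset = insert m l.toFinset := by ext v; simp
    rw [hset, Finset.filter_insert]
    split
    · rw [fiberProd_insert]
      intro v hv h
      rw [Finset.mem_filter, List.mem_toFinset] at hv
      have := hY.inj v (hl v (by simp [hv.1])) m (hl m (by simp)) h
      exact hnd.2.2 v hv.1 m (by simp) this
    · rfl

/-- The class is listed in the first order. Just before `m` is switched on, the active factors are
those of its class with first rank between `a` and `X m`, which is the set occurring in `partialSum`
apart from its bound on the second rank. -/
theorem foldl_prefix_colorEvents (hX : IsRanking n X) (hY : IsRanking n Y)
    (hpx : ∀ i < n, px (X i) = i) (a e m : ℕ) (P Q : List (ℕ × ℕ))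
    (h : colorEvents n col px e = P ++ (m, 1) :: Q) :
    P.foldl (eventFactor X Y r a) 1
      = fiberProd {v ∈ Finset.range n | col v = col m ∧ a < X v ∧ X v < X m} Y r := by
  rw [colorEvents] at h
  split at h
  swap
  · simp at h
  have hon : ∃ C, (colorClass n col px e).map (fun m => (m, 1)) = P ++ (m, 1) :: C := by
    rw [List.append_eq_append_iff] at h
    -- The second half of the events consists of switching off only, so the event at `m` lies in the
    -- first half.
    have hoff : ∀ D E : List (ℕ × ℕ),
        (colorClass n col px e).map (fun m => (m, 0)) ≠ D ++ (m, 1) :: E := by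
      intro D E hD
      have : (m, 1) ∈ (colorClass n col px e).map fun m => (m, 0) := by rw [hD]; simp
      simp at this
    rcases h with ⟨D, -, hD⟩ | ⟨C, hC, hC'⟩
    · exact absurd hD (hoff D Q)
    · cases C with
      | nil => exact absurd (by simpa using hC'.symm) (hoff [] Q)
      | cons c C =>
        rw [List.cons_append, List.cons.injEq] at hC'
        exact ⟨C, by rw [hC, ← hC'.1]⟩
  obtain ⟨C, hC⟩ := hon
  rw [List.map_eq_append_iff] at hC
  obtain ⟨l₁, l₂, hcls, rfl, h2⟩ := hC
  rw [List.map_eq_cons_iff] at h2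
  obtain ⟨m', l₃, rfl, hm', -⟩ := h2
  obtain rfl : m' = m := by simpa using hm'
  have hpw := pairwise_colorClass (col := col) hX hpx e
  have hmem := fun v => mem_colorClass (col := col) hX hpx (e := e) (v := v)
  rw [hcls] at hpw hmem
  rw [List.pairwise_append, List.pairwise_cons] at hpw
  obtain ⟨hp1, ⟨hp2, -⟩, hp3⟩ := hpw
  have hme := (hmem m').mp (by simp)
  rw [foldl_eventFactor_on hY a l₁ (fun v hv => ((hmem v).mp (by simp [hv])).1)
    (hp1.imp fun {v w} h => by rintro rfl; omega)]
  congr 1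
  ext v
  simp only [Finset.mem_filter, List.mem_toFinset, Finset.mem_range]
  constructor
  · rintro ⟨hv, hav⟩
    have hv' := (hmem v).mp (by simp [hv])
    exact ⟨hv'.1, by rw [hv'.2, hme.2], hav, hp3 v hv m' (by simp)⟩
  · rintro ⟨hv, hvc, hav, hvm⟩
    refine ⟨?_, hav⟩
    have := (hmem v).mpr ⟨hv, by rw [hvc, hme.2]⟩
    rw [List.mem_append, List.mem_cons] at this
    rcases this with h | rfl | h
    · exact h
    · omega
    · have := hp2 v h; omega

/-- Whole colors before the current one cancel by `foldl_colorEvents`, which leaves a prefix of the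
events of a single color. -/
theorem foldl_prefix_allEvents (hX : IsRanking n X) (hY : IsRanking n Y)
    (hpx : ∀ i < n, px (X i) = i) (a m : ℕ) (P Q : List (ℕ × ℕ))
    (h : allEvents n col px = P ++ (m, 1) :: Q) :
    P.foldl (eventFactor X Y r a) 1
      = fiberProd {v ∈ Finset.range n | col v = col m ∧ a < X v ∧ X v < X m} Y r := by
  have key : ∀ (es : List ℕ) (P : List (ℕ × ℕ)),
      es.flatMap (colorEvents n col px) = P ++ (m, 1) :: Q →
      P.foldl (eventFactor X Y r a) 1
        = fiberProd {v ∈ Finset.range n | col v = col m ∧ a < X v ∧ X v < X m} Y r := by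
    intro es
    induction es with
    | nil => intro P h; simp at h
    | cons e es ih =>
      intro P h
      rw [List.flatMap_cons, List.append_eq_append_iff] at h
      rcases h with ⟨D, rfl, hD⟩ | ⟨C, hC, hC'⟩
      · rw [List.foldl_append, foldl_colorEvents]
        exact ih D hD
      · cases C with
        | nil =>
          rw [List.append_nil] at hC
          rw [← hC, foldl_colorEvents]
          exact ih [] (by simpa using hC'.symm)
        | cons c C =>
          rw [List.cons_append, List.cons.injEq] at hC'
          exact foldl_prefix_colorEvents hX hY hpx a e m P C (by rw [hC, ← hC'.1])
  exact key _ P h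

end

/-! ### The list of events in memory -/

namespace RealRAM

/-- The memory holds the list `L` of events. -/
def EventsRep (s : State) (L : List (ℕ × ℕ)) : Prop :=
  s.nat 15 0 = L.length ∧ ∀ t p, L[t]? = some p → s.nat 13 t = p.1 ∧ s.nat 14 t = p.2

theorem EventsRep.congr {s t : State} {L : List (ℕ × ℕ)} (hs : EventsRep s L)
    (h13 : t.nat 13 = s.nat 13) (h14 : t.nat 14 = s.nat 14) (h15 : t.nat 15 = s.nat 15) :
    EventsRep t L := by
  rw [EventsRep, h13, h14, h15]; exact hs

namespace Cmd

theorem run_appendPoint {ty e k : ℕ} {st : State} {L : List (ℕ × ℕ)}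
    (he : st.nat 23 0 = e) (hk : st.nat 22 0 = k) (hL : EventsRep st L) :
    EventsRep ((appendPoint ty).run st)
      (L ++ (if st.nat 1 (st.nat 11 (k + 1)) = st.nat 1 e then [(st.nat 11 (k + 1), ty)] else [])) := by
  rw [appendPoint, run_seq, run_ite]
  set s1 := (setNat 34 (.const 0) (.get 11 (.add (natVar 22) (.const 1)))).run st with hs1
  have e1 : s1 = st.setNat 34 0 (st.nat 11 (k + 1)) := by simp [hs1, hk]
  have hcond : (Test.natEq (.get 1 (natVar 34)) (.get 1 (natVar 23))).Holds s1 ↔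
      st.nat 1 (st.nat 11 (k + 1)) = st.nat 1 e := by simp [e1, he]
  by_cases hc : st.nat 1 (st.nat 11 (k + 1)) = st.nat 1 e
  · rw [if_pos (by rwa [hcond]), if_pos hc]
    obtain ⟨h1, h2⟩ := hL
    refine ⟨by simp [e1, h1], fun t p ht => ?_⟩
    rw [List.getElem?_append] at ht
    split at ht
    · rename_i hlt
      have := h2 t p ht
      simpa [e1, h1, hlt.ne] using this
    · rename_i hlt
      rw [List.getElem?_singleton] at ht
      split at ht
      · rename_i h0
        have htl : t = L.length := by omega
        subst htl
        have := Option.some.inj ht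
        subst this
        simp [e1, h1]
      · simp at ht
  · rw [if_neg (by rwa [hcond]), if_neg hc, List.append_nil]
    exact hL.congr (by simp [e1]) (by simp [e1]) (by simp [e1])

theorem run_appendClass {n : ℕ} {ty e : ℕ} {s : State} {L : List (ℕ × ℕ)} (hn : s.nat 0 0 = n)
    (he : s.nat 23 0 = e) (hL : EventsRep s L) :
    EventsRep ((appendClass ty).run s)
      (L ++ (colorClass n (s.nat 1) (s.nat 11) e).map fun m => (m, ty)) := by
  have key := run_loop (s := s) (v := 22) (b := 0) (p := appendPoint ty)
    (fun k st => EventsRep st (L ++ (colorClass k (s.nat 1) (s.nat 11) e).map fun m => (m, ty)))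
    (by simpa [colorClass, EventsRep] using hL) (by
      intro k st _ hk hf hI
      have h1 : st.nat 1 = s.nat 1 := hf.nat 1 (by simp [natWrites, appendPoint])
      have h11 : st.nat 11 = s.nat 11 := hf.nat 11 (by simp [natWrites, appendPoint])
      have h23 : st.nat 23 0 = e := by
        rw [hf.nat 23 (by simp [natWrites, appendPoint]), he]
      have := run_appendPoint (ty := ty) h23 hk hI
      refine EventsRep.congr (s := (appendPoint ty).run st) ?_ (by simp) (by simp) (by simp)
      convert this using 1
      rw [h1, h11, List.append_assoc]
      congr 1
      simp only [colorClass, List.range_succ, List.map_append, List.filter_append]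
      congr 1
      by_cases h : s.nat 1 (s.nat 11 (k + 1)) = s.nat 1 e <;> simp [h])
  rw [hn] at key
  exact key

theorem run_testHead {e : ℕ} {s : State} (he : s.nat 23 0 = e) (hen : e < s.nat 0 0) :
    (testHead.run s).nat 18 0 = 1 ↔ ∀ m < e, s.nat 1 m ≠ s.nat 1 e := by
  rw [testHead, run_seq]
  set s1 := (setNat 18 (.const 0) (.const 1)).run s with hs1
  have e1 : s1 = s.setNat 18 0 1 := by simp [hs1]
  have key := run_loop (s := s1) (v := 22) (b := 0) (p := testHeadStep)
    (fun k st => st.nat 18 0 = if ∀ m < k, m < e → s.nat 1 m ≠ s.nat 1 e then 1 else 0)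
    (by simp [e1]) (by
      intro k st _ hk hf hI
      have h1 : st.nat 1 = s.nat 1 := by rw [hf.nat 1 (by decide)]; simp [e1]
      have h23 : st.nat 23 0 = e := by rw [hf.nat 23 (by decide)]; simp [e1, he]
      rw [testHeadStep, run_ite]
      by_cases hc : k < e ∧ s.nat 1 k = s.nat 1 e
      · rw [if_pos (by simpa [hk, h1, h23] using hc), if_neg]
        · simp
        · exact fun h => h k (by omega) hc.1 hc.2
      · rw [if_neg (by simpa [hk, h1, h23] using hc)]
        simp only [run_skip, State.setNat_nat]
        norm_num
        rw [hI]
        congr 1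
        simp only [eq_iff_iff]
        constructor
        · intro h m hm hme
          rcases (by omega : m < k ∨ m = k) with hm | rfl
          · exact h m hm hme
          · exact fun h' => hc ⟨hme, h'⟩
        · exact fun h m hm => h m (by omega))
  have hn : s1.nat 0 0 = s.nat 0 0 := by simp [e1]
  rw [key, hn]
  constructor
  · intro h m hm
    split at h
    · rename_i h'
      exact h' m (by omega) hm
    · simp at h
  · intro h
    rw [if_pos fun m _ hm => h m hm]

theorem run_makeEvents {n : ℕ} {s : State} (hn : s.nat 0 0 = n) :
    EventsRep (makeEvents.run s) (allEvents n (s.nat 1) (s.nat 11)) := by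
  rw [makeEvents, run_seq]
  set s1 := (setNat 15 (.const 0) (.const 0)).run s with hs1
  have e1 : s1 = s.setNat 15 0 0 := by simp [hs1]
  have hn1 : s1.nat 0 0 = n := by simp [e1, hn]
  have key := run_loop (s := s1) (v := 23) (b := 0) (p := appendColor)
    (fun k st => EventsRep st ((List.range k).flatMap (colorEvents n (s.nat 1) (s.nat 11))))
    (by simp [EventsRep, e1]) (by
      intro k st hkn hk hf hI
      rw [hn1] at hkn
      have h0 : st.nat 0 0 = n := by rw [hf.nat 0 (by decide), hn1]
      have h1 : st.nat 1 = s.nat 1 := by rw [hf.nat 1 (by decide)]; simp [e1]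
      have h11 : st.nat 11 = s.nat 11 := by rw [hf.nat 11 (by decide)]; simp [e1]
      refine EventsRep.congr (s := appendColor.run st) ?_ (by simp) (by simp) (by simp)
      rw [appendColor, run_seq, run_ite, List.range_succ, List.flatMap_append]
      have hhead := run_testHead hk (by rw [h0]; exact hkn)
      have ft : Frame testHead st (testHead.run st) := frame_run _ _
      set st' := testHead.run st
      have hI' : EventsRep st' ((List.range k).flatMap (colorEvents n (s.nat 1) (s.nat 11))) :=
        hI.congr (ft.nat 13 (by decide)) (ft.nat 14 (by decide)) (ft.nat 15 (by decide))
      have h0' : st'.nat 0 0 = n := by rw [ft.nat 0 (by decide), h0]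
      have h1' : st'.nat 1 = s.nat 1 := by rw [ft.nat 1 (by decide), h1]
      have h11' : st'.nat 11 = s.nat 11 := by rw [ft.nat 11 (by decide), h11]
      have h23' : st'.nat 23 0 = k := by rw [ft.nat 23 (by decide), hk]
      rw [h1] at hhead
      simp only [List.flatMap_cons, List.flatMap_nil, List.append_nil]
      rw [colorEvents]
      by_cases hc : ∀ m < k, s.nat 1 m ≠ s.nat 1 k
      · rw [if_pos (by simpa using hhead.mpr hc), if_pos hc, run_seq]
        have ha := run_appendClass (ty := 1) h0' h23' hI'
        have fa : Frame (appendClass 1) st' ((appendClass 1).run st') := frame_run _ _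
        have hb := run_appendClass (ty := 0) (n := n) (e := k)
          (by rw [fa.nat 0 (by decide), h0']) (by rw [fa.nat 23 (by decide), h23']) ha
        rw [fa.nat 1 (by decide), fa.nat 11 (by decide), h1', h11', List.append_assoc] at hb
        exact hb
      · rw [if_neg (by simpa using fun h => hc (hhead.mp h)), if_neg hc, List.append_nil]
        exact hI')
  rw [hn1] at key
  exact key

end Cmd

end RealRAM

/-! ### Partial sums of a row, and all rows -/

namespace RealRAM

namespace Cmd

section

variable {n h : ℕ} {col X Y : ℕ → ℕ} {r : ℕ → ℝ}

/-- The state of the computation of partial sums for the row `a` after `k` events. -/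
structure PushInv (n h : ℕ) (col X Y : ℕ → ℕ) (r : ℕ → ℝ) (a : ℕ) (E T : ℕ → ℝ)
    (L : List (ℕ × ℕ)) (k : ℕ) (st : State) : Prop where
  tree : TreeRep (2 ^ h) st ((L.take k).foldl (eventFactor X Y r a) 1) E
  old : ∀ x < a * n, st.real 16 x = T x
  new : ∀ l < k, ∀ m, L[l]? = some (m, 1) → a < X m →
    st.real 16 (a * n + m) = partialSum n col X Y r a m

theorem pushInv_setNat {a k b m v : ℕ} {E T : ℕ → ℝ} {L : List (ℕ × ℕ)} {st : State} :
    PushInv n h col X Y r a E T L k (st.setNat b m v) ↔ PushInv n h col X Y r a E T L k st :=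
  ⟨fun H => ⟨treeRep_setNat.mp H.tree, H.old, H.new⟩,
    fun H => ⟨treeRep_setNat.mpr H.tree, H.old, H.new⟩⟩

/-- With the indicated factors placed at second ranks, the product of the factors before leaf `b`
imposes the missing condition `Y v < b`. The inner stage is therefore a query at leaf `Y m`. -/
theorem partialSum_eq_prefixSum {a m : ℕ} {E : ℕ → ℝ}
    (hE : ∀ b < Y m, E b = cornerSum n col X Y r a b) (hc : ¬ SameColorAt n col X a m) :
    partialSum n col X Y r a m = prefixSum
      (fiberProd {v ∈ Finset.range n | col v = col m ∧ a < X v ∧ X v < X m} Y r) E (Y m) := by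
  rw [partialSum, if_neg hc, prefixSum]
  refine Finset.sum_congr rfl fun b hb => ?_
  rw [hE b (Finset.mem_range.mp hb), prod_range_fiberProd, Finset.filter_filter]
  congr 1
  refine Finset.prod_congr ?_ fun _ _ => rfl
  ext v
  simp only [Finset.mem_filter]
  tauto

/-- The query precedes the switching on of `m`, so it sees the factors of `foldl_prefix_allEvents`.
Points of first rank at most `a` are skipped, in agreement with `eventFactor`. -/
theorem run_eventStep {st : State} (hs : Sizes n h st) (hp : Points n col X Y r st)
    {a k : ℕ} (han : a ≤ n) (h19 : st.nat 19 0 = a) (hk : st.nat 22 0 = k) (hkn : k < n + n)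
    (hL : EventsRep st (allEvents n col (st.nat 11))) {E T : ℕ → ℝ}
    (hE : ∀ b ≤ n, E b = cornerSum n col X Y r a b)
    (hcol : ∀ m < n, (0 < a ∧ col (st.nat 33 0) = col m) ↔ SameColorAt n col X a m)
    (hI : PushInv n h col X Y r a E T (allEvents n col (st.nat 11)) k st) :
    PushInv n h col X Y r a E T (allEvents n col (st.nat 11)) (k + 1) (eventStep.run st) := by
  have hlen := length_allEvents (col := col) hp.isFst hp.invFst
  set L := allEvents n col (st.nat 11) with hLdef
  have hkL : k < L.length := by omega
  obtain ⟨⟨m, ty⟩, hmt⟩ : ∃ p, L[k] = p := ⟨_, rfl⟩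
  have hget : L[k]? = some (m, ty) := by rw [List.getElem?_eq_getElem hkL, hmt]
  have hm : m < n := lt_of_mem_allEvents (p := (m, ty)) hp.isFst hp.invFst
    (hmt ▸ List.getElem_mem hkL)
  obtain ⟨h13, h14⟩ := hL.2 k _ hget
  simp only at h13 h14
  have htake : L.take (k + 1) = L.take k ++ [(m, ty)] := by
    rw [List.take_add_one, hget]; rfl
  have hsplit : L = L.take k ++ (m, ty) :: L.drop (k + 1) := by
    rw [← hmt, List.getElem_cons_drop, List.take_append_drop]
  have hfold : (L.take (k + 1)).foldl (eventFactor X Y r a) 1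
      = eventFactor X Y r a ((L.take k).foldl (eventFactor X Y r a) 1) (m, ty) := by
    rw [htake, List.foldl_append]; rfl
  set A := (L.take k).foldl (eventFactor X Y r a) 1 with hA
  rw [eventStep, run_seq, run_seq, run_ite]
  set s1 := (setNat 16 (.const 0) (.get 10 (natVar 34))).run
    ((setNat 34 (.const 0) (.get 13 (natVar 22))).run st) with hs1
  have e1 : s1 = (st.setNat 34 0 m).setNat 16 0 (Y m) := by simp [hs1, hk, h13, hp.snd]
  have hcond : (Test.natLt (natVar 19) (.get 9 (natVar 34))).Holds s1 ↔ a < X m := by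
    simp [e1, h19, hp.fst]
  by_cases ham : a < X m
  swap
  · rw [if_neg (by rwa [hcond]), run_skip, e1, pushInv_setNat, pushInv_setNat]
    refine ⟨?_, hI.old, ?_⟩
    · rw [hfold, eventFactor, if_neg ham]; exact hI.tree
    · intro l hl m' hm' ham'
      rcases (by omega : l < k ∨ l = k) with hl | rfl
      · exact hI.new l hl m' hm' ham'
      · rw [hget] at hm'
        simp only [Option.some.injEq, Prod.mk.injEq] at hm'
        exact absurd (hm'.1 ▸ ham') ham
  rw [if_pos (by rwa [hcond]), run_ite]
  have hYlt : Y m < 2 ^ h := lt_of_le_of_lt (hp.isSnd.le m hm) hs.lt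
  have hsz1 : Sizes n h s1 := hs.congr fun b hb _ => by
    simp [e1, show b ≠ 16 by omega, show b ≠ 34 by omega]
  have htree1 : TreeRep (2 ^ h) s1 A E := by
    rw [e1, treeRep_setNat, treeRep_setNat]; exact hI.tree
  have n16 : s1.nat 16 0 = Y m := by simp [e1]
  have hcond1 : (Test.natEq (.get 14 (natVar 22)) (.const 1)).Holds s1 ↔ ty = 1 := by
    simp [e1, hk, h14]
  have hoff : a * n + n ≤ (a + 1) * n := by rw [add_mul, one_mul]
  by_cases hty : ty = 1
  · subst hty
    rw [if_pos (by rw [hcond1]), run_seq, run_seq, run_seq]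
    have hq := run_treeQuery hsz1 htree1 (by rw [n16]; exact hYlt)
    have fq : Frame treeQuery s1 (treeQuery.run s1) := frame_run _ _
    set s2 := treeQuery.run s1 with hs2
    have q34 : s2.nat 34 0 = m := by rw [fq.nat 34 (by decide)]; simp [e1]
    have q33 : s2.nat 33 = st.nat 33 := by rw [fq.nat 33 (by decide)]; simp [e1]
    have q19 : s2.nat 19 0 = a := by rw [fq.nat 19 (by decide)]; simp [e1, h19]
    have q1 : s2.nat 1 = col := by rw [fq.nat 1 (by decide)]; simp [e1, hp.color]
    have q8 : s2.nat 8 a = a * n := by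
      rw [fq.nat 8 (by decide)]; simp [e1, hs.offset a han]
    have q16 : s2.real 16 = st.real 16 := by rw [fq.real 16 (by decide)]; simp [e1]
    have hcond2 : (Test.and (.natLt (.const 0) (natVar 19))
        (.natEq (.get 1 (natVar 33)) (.get 1 (natVar 34)))).Holds s2 ↔
        SameColorAt n col X a m := by
      rw [← hcol m hm]; simp [q19, q1, q33, q34]
    have hval : ∃ s3 : State, s3 = s2.setReal 16 (a * n + m) (partialSum n col X Y r a m) ∧
        (ite (.and (.natLt (.const 0) (natVar 19))
            (.natEq (.get 1 (natVar 33)) (.get 1 (natVar 34))))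
          (setReal 16 (.add (.get 8 (natVar 19)) (natVar 34)) (.const 0))
          (setReal 16 (.add (.get 8 (natVar 19)) (natVar 34)) (realVar 12))).run s2 = s3 := by
      refine ⟨_, rfl, ?_⟩
      rw [run_ite]
      by_cases hsc : SameColorAt n col X a m
      · rw [if_pos (by rwa [hcond2]), partialSum, if_pos hsc]
        simp [q19, q8, q34]
      · rw [if_neg (by rwa [hcond2]), partialSum_eq_prefixSum (E := E)
          (fun b hb => hE b (by have := hp.isSnd.le m hm; omega)) hsc]
        rw [← foldl_prefix_allEvents hp.isFst hp.isSnd hp.invFst a m _ _ hsplit, ← hA, ← n16, ← hq]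
        simp [q19, q8, q34]
    obtain ⟨s3, e3, hs3⟩ := hval
    rw [hs3]
    set s4 := (setReal 13 (.const 0) (.sub (.const 1) (.get 8 (natVar 34)))).run s3 with hs4
    have p8 : s2.real 8 = r := by rw [fq.real 8 (by decide)]; simp [e1, hp.prob]
    have e4 : s4 = s3.setReal 13 0 (1 - r m) := by simp [hs4, e3, q34, p8]
    have hsz4 : Sizes n h s4 :=
      (fq.sizes hsz1 (by decide)).congr fun b _ _ => by simp [e4, e3]
    have n16' : s4.nat 16 0 = Y m := by
      simp only [e4, e3, State.setReal_nat]; rw [fq.nat 16 (by decide), n16]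
    have hT := run_treeSetFactor hsz4 (htree1.congr
      (by simp only [e4, e3, State.setReal_real]; norm_num; rw [fq.real 10 (by decide)])
      (by simp only [e4, e3, State.setReal_real]; norm_num; rw [fq.real 11 (by decide)]))
      (by rw [n16']; exact hYlt)
    rw [n16'] at hT
    have h16 : (treeSetFactor.run s4).real 16
        = Function.update (st.real 16) (a * n + m) (partialSum n col X Y r a m) := by
      rw [run_real 16 (by decide), e4, e3]; simp [q16]
    refine ⟨?_, ?_, ?_⟩
    · rw [hfold, eventFactor, if_pos ham, if_pos rfl]
      simpa [e4] using hT
    · intro x hx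
      rw [h16, Function.update_of_ne (by omega)]
      exact hI.old x hx
    · intro l hl m' hm' ham'
      rw [h16]
      by_cases hmm : m' = m
      · rw [hmm, Function.update_self]
      · rw [Function.update_of_ne (by omega)]
        rcases (by omega : l < k ∨ l = k) with hl | rfl
        · exact hI.new l hl m' hm' ham'
        · rw [hget] at hm'
          simp only [Option.some.injEq, Prod.mk.injEq] at hm'
          exact absurd hm'.1.symm hmm
  · rw [if_neg (by rwa [hcond1]), run_seq]
    set s4 := (setReal 13 (.const 0) (.const 1)).run s1 with hs4
    have e4 : s4 = s1.setReal 13 0 1 := by simp [hs4]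
    have n16' : s4.nat 16 0 = Y m := by rw [e4]; exact n16
    have hT := run_treeSetFactor (s := s4) (hsz1.congr fun b _ _ => by simp [e4])
      (htree1.congr (by simp [e4]) (by simp [e4])) (by rw [n16']; exact hYlt)
    rw [n16'] at hT
    have h16 : (treeSetFactor.run s4).real 16 = st.real 16 := by
      rw [run_real 16 (by decide), e4]; simp [e1]
    refine ⟨?_, ?_, ?_⟩
    · rw [hfold, eventFactor, if_pos ham, if_neg hty]
      simpa [e4] using hT
    · rw [h16]; exact hI.old
    · intro l hl m' hm' ham'
      rw [h16]
      rcases (by omega : l < k ∨ l = k) with hl | rfl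
      · exact hI.new l hl m' hm' ham'
      · rw [hget] at hm'
        simp only [Option.some.injEq, Prod.mk.injEq] at hm'
        exact absurd hm'.2 hty

/-- Every point occurs in an event of type one, so all needed entries are written. They lie at or
beyond the offset `a * n`, so earlier rows survive. -/
theorem run_pushRow {s : State} (hs : Sizes n h s) (hp : Points n col X Y r s)
    {a : ℕ} (han : a ≤ n) (h19 : s.nat 19 0 = a) (hL : EventsRep s (allEvents n col (s.nat 11)))
    (hE : ∀ b ≤ n, s.real 15 b = cornerSum n col X Y r a b)
    (hcol : ∀ m < n, (0 < a ∧ col (s.nat 33 0) = col m) ↔ SameColorAt n col X a m) :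
    (∀ m < n, a < X m → (pushRow.run s).real 16 (a * n + m) = partialSum n col X Y r a m) ∧
      ∀ x < a * n, (pushRow.run s).real 16 x = s.real 16 x := by
  rw [pushRow, run_seq, run_seq]
  have fa : Frame treeReset s (treeReset.run s) := frame_run _ _
  have ta := run_treeReset hs
  set sa := treeReset.run s
  have sza : Sizes n h sa := fa.sizes hs (by decide)
  have fb : Frame loadRow sa (loadRow.run sa) := frame_run _ _
  have tb := run_loadRow sza ta
  set sb := loadRow.run sa
  have szb : Sizes n h sb := fb.sizes sza (by decide)
  have hpb : Points n col X Y r sb := fb.points (fa.points hp (by decide)) (by decide)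
  have nat_eq : ∀ b ∈ [11, 13, 14, 15, 19, 33], sb.nat b = s.nat b := fun b hb => by
    rw [fb.nat b (by revert hb; revert b; decide), fa.nat b (by revert hb; revert b; decide)]
  set E : ℕ → ℝ := fun y => if y ≤ n then sa.real 15 y else 0 with hEdef
  have hE' : ∀ b ≤ n, E b = cornerSum n col X Y r a b := fun b hb => by
    simp only [hEdef, if_pos hb, fa.real 15 (by decide)]
    exact hE b hb
  have h16 : sb.real 16 = s.real 16 := by rw [fb.real 16 (by decide), fa.real 16 (by decide)]
  have key := run_loop (s := sb) (v := 22) (b := 6) (p := eventStep)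
    (fun k st => PushInv n h col X Y r a E (s.real 16) (allEvents n col (s.nat 11)) k st)
    (by
      rw [pushInv_setNat]
      exact ⟨tb, fun x _ => by rw [h16], fun l hl => absurd hl (Nat.not_lt_zero l)⟩)
    (by
      intro k st hkn hk hf hI
      rw [szb.twice_num] at hkn
      rw [pushInv_setNat]
      have nat_eq' : ∀ b ∈ [11, 13, 14, 15, 19, 33], st.nat b = s.nat b := fun b hb => by
        rw [hf.nat b (by revert hb; revert b; decide), nat_eq b hb]
      have h11 := nat_eq' 11 (by simp)
      rw [← h11] at hI ⊢
      exact run_eventStep (hf.sizes szb (by decide)) (hf.points hpb (by decide)) han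
        (by rw [nat_eq' 19 (by simp), h19]) hk hkn
        (by rw [h11]; exact hL.congr (nat_eq' 13 (by simp)) (nat_eq' 14 (by simp))
              (nat_eq' 15 (by simp))) hE' (by rw [nat_eq' 33 (by simp)]; exact hcol) hI)
  rw [szb.twice_num] at key
  refine ⟨fun m hm ham => ?_, key.old⟩
  obtain ⟨l, hl, hlm⟩ := List.getElem_of_mem (mem_allEvents (col := col) hp.isFst hp.invFst hm)
  refine key.new l ?_ m ?_ ham
  · rw [← length_allEvents (col := col) hp.isFst hp.invFst]; exact hl
  · rw [List.getElem?_eq_getElem hl, hlm]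

theorem run_emptyRow {s : State} (hn : s.nat 5 0 = n + 1) :
    ∀ b ≤ n, (emptyRow.run s).real 15 b = if b = 0 then 1 else 0 := by
  intro b hb
  rw [emptyRow, run_seq]
  have key := run_loop (s := s) (v := 22) (b := 5) (p := setReal 15 (natVar 22) (.const 0))
    (fun k st => ∀ x < k, st.real 15 x = 0) (by simp) (by
      intro k st _ hk _ hI x hx
      simp only [run_setReal, State.setNat_real, State.setReal_real, if_true, NatExpr.eval, hk]
      rcases (by omega : x < k ∨ x = k) with hx | rfl
      · rw [Function.update_of_ne (by omega)]; exact hI x hx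
      · simp)
  rw [hn] at key
  simp only [run_setReal, State.setReal_real, if_true, NatExpr.eval, RealExpr.eval]
  by_cases h0 : b = 0
  · simp [h0]
  · rw [Function.update_of_ne h0, if_neg h0]
    exact key b (by omega)

/-- The state after the first `k` rows. -/
structure RowsInv (n : ℕ) (col X Y : ℕ → ℕ) (r : ℕ → ℝ) (k : ℕ) (st : State) : Prop where
  total : st.real 18 0 =
    ∑ a ∈ Finset.range k, ∑ b ∈ Finset.range (n + 1), cornerSum n col X Y r a b
  table : ∀ t < k, ∀ m < n, t < X m → st.real 16 (t * n + m) = partialSum n col X Y r t m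

/-- Row `k` uses the partial sums of earlier rows only, since the cut is strictly below the last
point; it then adds its own partial sums to the table. -/
theorem run_doRow {st : State} (hs : Sizes n h st) (hp : Points n col X Y r st) {k : ℕ}
    (hk : st.nat 23 0 = k) (hkn : k < n + 1) (hL : EventsRep st (allEvents n col (st.nat 11)))
    (hI : RowsInv n col X Y r k st) : RowsInv n col X Y r (k + 1) (doRow.run st) := by
  rw [doRow, run_seq, run_seq, run_seq, run_seq]
  set s1 := (setNat 33 (.const 0) (.get 11 (natVar 23))).run
    ((setNat 19 (.const 0) (natVar 23)).run st) with hs1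
  have e1 : s1 = (st.setNat 19 0 k).setNat 33 0 (st.nat 11 k) := by simp [hs1, hk]
  have hs' : Sizes n h s1 := hs.congr fun b hb _ => by
    simp [e1, show b ≠ 19 by omega, show b ≠ 33 by omega]
  have hp' : Points n col X Y r s1 := hp.congr (by simp [e1]) (by simp [e1]) (by simp [e1])
    (by simp [e1]) (by simp [e1]) (by simp [e1])
  have hcol : ∀ m < n, (0 < k ∧ col (s1.nat 33 0) = col m) ↔ SameColorAt n col X k m := by
    intro m _
    have : s1.nat 33 0 = st.nat 11 k := by simp [e1]
    rw [this]
    constructor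
    · rintro ⟨h0, hc⟩
      obtain ⟨i, hi, rfl⟩ := hp.isFst.exists_eq h0 (by omega)
      rw [hp.invFst i hi] at hc
      exact ⟨i, hi, rfl, hc⟩
    · rintro ⟨i, hi, rfl, hc⟩
      rw [hp.invFst i hi]
      exact ⟨hp.isFst.pos i hi, hc⟩
  set rowCmd := ite (.natEq (natVar 23) (.const 0)) emptyRow pointRow with hrowCmd
  have f2 : Frame rowCmd s1 (rowCmd.run s1) := frame_run _ _
  have hrow : ∀ b ≤ n, (rowCmd.run s1).real 15 b = cornerSum n col X Y r k b := by
    rw [hrowCmd, run_ite]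
    have hcond : (Test.natEq (natVar 23) (.const 0)).Holds s1 ↔ k = 0 := by simp [e1, hk]
    by_cases h0 : k = 0
    · rw [if_pos (by rwa [hcond])]
      intro b hb
      rw [h0, cornerSum_zero_left hp.isFst, run_emptyRow hs'.succ_num b hb]
    · rw [if_neg (by rwa [hcond])]
      obtain ⟨i, hi, hik⟩ := hp.isFst.exists_eq (k := k) (by omega) (by omega)
      rw [← hik]
      refine run_pointRow hs' hp' hi (by simp [e1, hik]) ?_ ?_
      · simp only [e1, State.setNat_nat]
        norm_num
        rw [← hik, hp.invFst i hi]
      · intro t ht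
        rw [show s1.real 16 = st.real 16 by simp [e1]]
        exact hI.table t (by omega) i hi ht
  set s2 := rowCmd.run s1 with hs2
  have hs2' : Sizes n h s2 := f2.sizes hs' (by decide)
  set sumCmd := loop 21 5 (setReal 18 (.const 0) (.add (realVar 18) (.get 15 (natVar 21))))
    with hsumCmd
  have f3 : Frame sumCmd s2 (sumCmd.run s2) := frame_run _ _
  have hsum : (sumCmd.run s2).real 18 0 = s2.real 18 0 + ∑ b ∈ Finset.range (n + 1), s2.real 15 b := by
    have key := run_loop (s := s2) (v := 21) (b := 5)
      (p := setReal 18 (.const 0) (.add (realVar 18) (.get 15 (natVar 21))))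
      (fun l st => st.real 18 0 = s2.real 18 0 + ∑ b ∈ Finset.range l, s2.real 15 b)
      (by simp) (by
        intro l st _ hl hf hJ
        have h15 : st.real 15 = s2.real 15 := hf.real 15 (by decide)
        simp [hl, h15, hJ, Finset.sum_range_succ]
        ring)
    rw [hs2'.succ_num] at key
    exact key
  set s3 := sumCmd.run s2 with hs3
  have hs3' : Sizes n h s3 := f3.sizes hs2' (by decide)
  have hp3 : Points n col X Y r s3 := f3.points (f2.points hp' (by decide)) (by decide)
  have nat_eq : ∀ b ∈ [11, 13, 14, 15, 19, 33], s3.nat b = s1.nat b := fun b hb => by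
    rw [f3.nat b (by revert hb; revert b; decide), f2.nat b (by revert hb; revert b; decide)]
  have h11 : s3.nat 11 = st.nat 11 := by rw [nat_eq 11 (by simp)]; simp [e1]
  have h16 : s3.real 16 = st.real 16 := by
    rw [f3.real 16 (by decide), f2.real 16 (by decide)]; simp [e1]
  obtain ⟨hnew, hold⟩ := run_pushRow hs3' hp3 (a := k) (by omega)
    (by rw [nat_eq 19 (by simp)]; simp [e1])
    (by
      rw [h11]
      exact hL.congr (by rw [nat_eq 13 (by simp)]; simp [e1])
        (by rw [nat_eq 14 (by simp)]; simp [e1]) (by rw [nat_eq 15 (by simp)]; simp [e1]))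
    (by rw [f3.real 15 (by decide)]; exact hrow)
    (by rw [nat_eq 33 (by simp)]; exact hcol)
  refine ⟨?_, ?_⟩
  · rw [run_real 18 (by decide), hsum, f2.real 18 (by decide), Finset.sum_range_succ _ k]
    congr 1
    · simpa [e1] using hI.total
    · exact Finset.sum_congr rfl fun b hb => hrow b (by simpa [Nat.lt_succ_iff] using hb)
  · intro t ht m hm htm
    rcases (by omega : t < k ∨ t = k) with ht | rfl
    · have : t * n + m < k * n := by
        have : (t + 1) * n ≤ k * n := Nat.mul_le_mul_right n ht
        rw [add_mul, one_mul] at this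
        omega
      rw [hold _ this, h16]
      exact hI.table t ht m hm htm
    · exact hnew m hm htm

open Classical in
theorem run_doRows {s : State} (hs : Sizes n h s) (hp : Points n col X Y r s)
    (hL : EventsRep s (allEvents n col (s.nat 11))) :
    (doRows.run s).real 18 0 =
      ∑ R ∈ (Finset.range n).powerset with Concordant col X Y R, ∏ v ∈ R, r v / (1 - r v) := by
  rw [doRows, run_seq]
  set s1 := (setReal 18 (.const 0) (.const 0)).run s with hs1
  have e1 : s1 = s.setReal 18 0 0 := by simp [hs1]
  have hs' : Sizes n h s1 := hs.congr fun b _ _ => by simp [e1]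
  have hp' : Points n col X Y r s1 := hp.congr (by simp [e1]) (by simp [e1]) (by simp [e1])
    (by simp [e1]) (by simp [e1]) (by simp [e1])
  have key := run_loop (s := s1) (v := 23) (b := 5) (p := doRow)
    (fun k st => RowsInv n col X Y r k st)
    (by exact ⟨by simp [e1], fun t ht => absurd ht (Nat.not_lt_zero t)⟩)
    (by
      intro k st hkn hk hf hI
      rw [hs'.succ_num] at hkn
      have := run_doRow (hf.sizes hs' (by decide)) (hf.points hp' (by decide)) hk hkn
        (by
          have nat_eq : ∀ b ∈ [11, 13, 14, 15], st.nat b = s.nat b := fun b hb => by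
            rw [hf.nat b (by revert hb; revert b; decide), e1, State.setReal_nat]
          rw [nat_eq 11 (by simp)]
          exact hL.congr (nat_eq 13 (by simp)) (nat_eq 14 (by simp)) (nat_eq 15 (by simp))) hI
      exact ⟨this.total, this.table⟩)
  rw [hs'.succ_num] at key
  rw [key.total, sum_cornerSum hp.isFst hp.isSnd]

end

end Cmd

end RealRAM

/-! ### Ranks and certain points -/

/-- The lexicographic order given by a primary and a secondary key. -/
def LexLt (A B : ℕ → ℝ) (j i : ℕ) : Prop := A j < A i ∨ (A j = A i ∧ B j < B i)

/-- Different points have different keys. -/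
def KeysInj (n : ℕ) (A B : ℕ → ℝ) : Prop := ∀ i < n, ∀ j < n, A i = A j → B i = B j → i = j

open Classical in
/-- The rank of a point in the lexicographic order. -/
noncomputable def lexRank (n : ℕ) (A B : ℕ → ℝ) (i : ℕ) : ℕ :=
  ({j ∈ Finset.range n | LexLt A B j i} : Finset ℕ).card + 1

theorem LexLt.trans {A B : ℕ → ℝ} {i j k : ℕ} (h : LexLt A B i j) (h' : LexLt A B j k) :
    LexLt A B i k := by
  rcases h with h | ⟨h1, h2⟩ <;> rcases h' with h' | ⟨h1', h2'⟩
  · exact .inl (h.trans h')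
  · exact .inl (h1' ▸ h)
  · exact .inl (h1 ▸ h')
  · exact .inr ⟨h1.trans h1', h2.trans h2'⟩

theorem LexLt.irrefl {A B : ℕ → ℝ} {i : ℕ} : ¬ LexLt A B i i := by
  rintro (h | ⟨-, h⟩) <;> exact lt_irrefl _ h

theorem KeysInj.trichotomy {n : ℕ} {A B : ℕ → ℝ} (hk : KeysInj n A B) {i j : ℕ} (hi : i < n)
    (hj : j < n) : LexLt A B i j ∨ i = j ∨ LexLt A B j i := by
  rcases lt_trichotomy (A i) (A j) with h | h | h
  · exact .inl (.inl h)
  · rcases lt_trichotomy (B i) (B j) with h' | h' | h'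
    · exact .inl (.inr ⟨h, h'⟩)
    · exact .inr (.inl (hk i hi j hj h h'))
    · exact .inr (.inr (.inr ⟨h.symm, h'⟩))
  · exact .inr (.inr (.inl h))

theorem lexRank_lt_of_lexLt {n : ℕ} {A B : ℕ → ℝ} {i j : ℕ} (hi : i < n) (h : LexLt A B i j) :
    lexRank n A B i < lexRank n A B j := by
  classical
  rw [lexRank, lexRank]
  refine Nat.succ_lt_succ (Finset.card_lt_card ⟨?_, ?_⟩)
  · intro k hk
    rw [Finset.mem_filter] at hk ⊢
    exact ⟨hk.1, hk.2.trans h⟩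
  · intro hsub
    have := hsub (Finset.mem_filter.mpr ⟨Finset.mem_range.mpr hi, h⟩)
    exact LexLt.irrefl (Finset.mem_filter.mp this).2

theorem lexRank_lt_iff {n : ℕ} {A B : ℕ → ℝ} (hk : KeysInj n A B) {i j : ℕ} (hi : i < n)
    (hj : j < n) : lexRank n A B i < lexRank n A B j ↔ LexLt A B i j := by
  refine ⟨fun h => ?_, lexRank_lt_of_lexLt hi⟩
  rcases hk.trichotomy hi hj with h' | rfl | h'
  · exact h'
  · omega
  · have := lexRank_lt_of_lexLt hj h'
    omega

theorem isRanking_lexRank {n : ℕ} {A B : ℕ → ℝ} (hk : KeysInj n A B) :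
    IsRanking n (lexRank n A B) := by
  classical
  refine ⟨fun i hi j hj h => ?_, fun i _ => by rw [lexRank]; omega, fun i hi => ?_⟩
  · rcases hk.trichotomy hi hj with h' | h' | h'
    · have := lexRank_lt_of_lexLt hi h'; omega
    · exact h'
    · have := lexRank_lt_of_lexLt hj h'; omega
  · rw [lexRank]
    have : ({j ∈ Finset.range n | LexLt A B j i} : Finset ℕ) ⊂ Finset.range n :=
      ⟨Finset.filter_subset _ _, fun hsub =>
        LexLt.irrefl (Finset.mem_filter.mp (hsub (Finset.mem_range.mpr hi))).2⟩
    have := Finset.card_lt_card this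
    rw [Finset.card_range] at this
    omega

theorem IsRanking.congr {n : ℕ} {X X' : ℕ → ℕ} (hX : IsRanking n X) (h : ∀ i < n, X' i = X i) :
    IsRanking n X' :=
  ⟨fun i hi j hj hij => hX.inj i hi j hj (by rw [← h i hi, ← h j hj, hij]),
    fun i hi => by rw [h i hi]; exact hX.pos i hi, fun i hi => by rw [h i hi]; exact hX.le i hi⟩

/-- The point `i` is incompatible with a point of probability one. -/
def Conflict (n : ℕ) (col X Y : ℕ → ℕ) (p : ℕ → ℝ) (i : ℕ) : Prop :=
  ∃ k < n, p k = 1 ∧ col k ≠ col i ∧ ¬ (X k < X i ↔ Y k < Y i)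

open Classical in
/-- The probability of a point, replaced by zero for points that are certain or incompatible with
a certain point. -/
noncomputable def reducedProb (n : ℕ) (col X Y : ℕ → ℕ) (p : ℕ → ℝ) (i : ℕ) : ℝ :=
  if p i = 1 ∨ Conflict n col X Y p i then 0 else p i

open Classical in
/-- The factor of a point in the probability that no uncertain point exists and no two certain
points are incompatible. -/
noncomputable def absenceFactor (n : ℕ) (col X Y : ℕ → ℕ) (p : ℕ → ℝ) (i : ℕ) : ℝ :=
  if p i = 1 then if Conflict n col X Y p i then 0 else 1 else 1 - p i

/-- The probability that exactly the points in `R` exist. -/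
noncomputable def existProb (n : ℕ) (p : ℕ → ℝ) (R : Finset ℕ) : ℝ :=
  (∏ v ∈ R, p v) * ∏ v ∈ Finset.range n \ R, (1 - p v)

open Classical in
-- Odds are meaningless for certain points. But a realization of nonzero probability contains all of
-- them, and then concordance of the rest means concordance among themselves and compatibility with
-- every certain point. Incompatible points get odds zero, while their probability of absence stays
-- in the constant factor.
theorem sum_existProb_concordant {n : ℕ} {col X Y : ℕ → ℕ} (hX : IsRanking n X)
    (hY : IsRanking n Y) (p : ℕ → ℝ) :
    ∑ R ∈ (Finset.range n).powerset with Concordant col X Y R, existProb n p R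
      = (∏ v ∈ Finset.range n, absenceFactor n col X Y p v) *
        ∑ R ∈ (Finset.range n).powerset with Concordant col X Y R,
          ∏ v ∈ R, reducedProb n col X Y p v / (1 - reducedProb n col X Y p v) := by
  set K : Finset ℕ := {v ∈ Finset.range n | p v = 1} with hK
  have hKsub : K ⊆ Finset.range n := Finset.filter_subset _ _
  have hzero : ∀ R ⊆ Finset.range n, ¬ K ⊆ R → existProb n p R = 0 := by
    intro R _ hKR
    obtain ⟨v, hvK, hvR⟩ := Finset.not_subset.mp hKR
    rw [hK, Finset.mem_filter] at hvK
    rw [existProb, Finset.prod_eq_zero (s := Finset.range n \ R) (i := v)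
      (Finset.mem_sdiff.mpr ⟨hvK.1, hvR⟩) (by rw [hvK.2, sub_self]), mul_zero]
  -- If two certain points are incompatible, both sides vanish: the right one through its constant
  -- factor, the left one because no concordant set contains all of `K`.
  by_cases hconf : ∃ i ∈ K, Conflict n col X Y p i
  · obtain ⟨i, hiK, k, hk, hpk, hcol, hki⟩ := hconf
    have hiK' := hiK
    rw [hK, Finset.mem_filter] at hiK'
    rw [Finset.prod_eq_zero (s := Finset.range n) (i := i) hiK'.1 (by
      rw [absenceFactor, if_pos hiK'.2, if_pos ⟨k, hk, hpk, hcol, hki⟩]), zero_mul]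
    refine Finset.sum_eq_zero fun R hR => ?_
    rw [Finset.mem_filter, Finset.mem_powerset] at hR
    refine hzero R hR.1 fun hKR => ?_
    have hkK : k ∈ K := Finset.mem_filter.mpr ⟨Finset.mem_range.mpr hk, hpk⟩
    rcases hR.2 k (hKR hkK) i (hKR hiK) with h | h
    · exact hcol h
    · exact hki h
  push Not at hconf
  set U : Finset ℕ := {v ∈ Finset.range n | p v ≠ 1 ∧ ¬ Conflict n col X Y p v} with hU
  have hΦ : ∏ v ∈ Finset.range n, absenceFactor n col X Y p v
      = ∏ v ∈ Finset.range n \ K, (1 - p v) := by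
    rw [← Finset.prod_sdiff hKsub]
    rw [Finset.prod_eq_one (s := K) fun v hv => by
      rw [absenceFactor, if_pos (Finset.mem_filter.mp hv).2, if_neg (hconf v hv)], mul_one]
    refine Finset.prod_congr rfl fun v hv => ?_
    rw [Finset.mem_sdiff, hK, Finset.mem_filter] at hv
    rw [absenceFactor, if_neg fun h => hv.2 ⟨hv.1, h⟩]
  have hleft : ∑ R ∈ (Finset.range n).powerset with Concordant col X Y R, existProb n p R
      = ∑ R ∈ (Finset.range n).powerset with Concordant col X Y R ∧ K ⊆ R, existProb n p R := by
    rw [← Finset.filter_filter, Finset.sum_filter (p := fun R => K ⊆ R)]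
    refine Finset.sum_congr rfl fun R hR => ?_
    rw [Finset.mem_filter, Finset.mem_powerset] at hR
    by_cases h : K ⊆ R
    · rw [if_pos h]
    · rw [if_neg h, hzero R hR.1 h]
  have hright : ∑ R ∈ (Finset.range n).powerset with Concordant col X Y R,
        ∏ v ∈ R, reducedProb n col X Y p v / (1 - reducedProb n col X Y p v)
      = ∑ R ∈ (Finset.range n).powerset with Concordant col X Y R ∧ R ⊆ U,
        ∏ v ∈ R, p v / (1 - p v) := by
    rw [← Finset.filter_filter, Finset.sum_filter (p := fun R => R ⊆ U)]
    refine Finset.sum_congr rfl fun R hR => ?_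
    rw [Finset.mem_filter, Finset.mem_powerset] at hR
    by_cases h : R ⊆ U
    · rw [if_pos h]
      refine Finset.prod_congr rfl fun v hv => ?_
      have := h hv
      rw [hU, Finset.mem_filter] at this
      rw [reducedProb, if_neg (by tauto)]
    · rw [if_neg h]
      obtain ⟨v, hvR, hvU⟩ := Finset.not_subset.mp h
      refine Finset.prod_eq_zero hvR ?_
      rw [reducedProb, if_pos, zero_div]
      by_contra hcon
      rw [not_or] at hcon
      exact hvU (Finset.mem_filter.mpr ⟨hR.1 hvR, hcon⟩)
  rw [hleft, hright, hΦ, Finset.mul_sum]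
  have hUK : ∀ v ∈ U, v ∉ K := fun v hv hvK =>
    (Finset.mem_filter.mp hv).2.1 (Finset.mem_filter.mp hvK).2
  -- Removing and adjoining the certain points matches the nonvanishing terms of the two sides.
  refine Finset.sum_bij' (fun R _ => R \ K) (fun R _ => R ∪ K) ?_ ?_ ?_ ?_ ?_
  · intro R hR
    rw [Finset.mem_filter, Finset.mem_powerset] at hR ⊢
    obtain ⟨hsub, hc, hKR⟩ := hR
    refine ⟨Finset.sdiff_subset.trans hsub, fun i hi j hj => hc i (Finset.mem_sdiff.mp hi).1 j
      (Finset.mem_sdiff.mp hj).1, fun v hv => ?_⟩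
    rw [Finset.mem_sdiff] at hv
    refine Finset.mem_filter.mpr ⟨hsub hv.1, fun h =>
      hv.2 (Finset.mem_filter.mpr ⟨hsub hv.1, h⟩), ?_⟩
    rintro ⟨k, hk, hpk, hcol, hkv⟩
    rcases hc k (hKR (Finset.mem_filter.mpr ⟨Finset.mem_range.mpr hk, hpk⟩)) v hv.1 with h | h
    · exact hcol h
    · exact hkv h
  · intro R hR
    rw [Finset.mem_filter, Finset.mem_powerset] at hR ⊢
    obtain ⟨hsub, hc, hRU⟩ := hR
    refine ⟨Finset.union_subset hsub hKsub, ?_, Finset.subset_union_right⟩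
    have hone : ∀ k ∈ K, ∀ v < n, ¬ Conflict n col X Y p v →
        col k = col v ∨ (X k < X v ↔ Y k < Y v) := by
      intro k hk v _ hv
      by_contra hcon
      rw [not_or] at hcon
      rw [hK, Finset.mem_filter, Finset.mem_range] at hk
      exact hv ⟨k, hk.1, hk.2, hcon⟩
    -- The condition defining `Conflict` compares in one direction only; because ranks of different
    -- points differ, it is symmetric.
    have hother : ∀ k ∈ K, ∀ v < n, ¬ Conflict n col X Y p v →
        col v = col k ∨ (X v < X k ↔ Y v < Y k) := by
      intro k hk v hvn hv
      by_cases hkv : v = k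
      · exact .inl (by rw [hkv])
      rw [hK, Finset.mem_filter, Finset.mem_range] at hk
      have h1 : X v ≠ X k := fun h => hkv (hX.inj v hvn k hk.1 h)
      have h2 : Y v ≠ Y k := fun h => hkv (hY.inj v hvn k hk.1 h)
      rcases hone k (Finset.mem_filter.mpr ⟨Finset.mem_range.mpr hk.1, hk.2⟩) v hvn hv with h | h
      · exact .inl h.symm
      · right; omega
    have hgood : ∀ v ∈ R ∪ K, v < n ∧ ¬ Conflict n col X Y p v := by
      intro v hv
      rcases Finset.mem_union.mp hv with h | h
      · exact ⟨Finset.mem_range.mp (hsub h), (Finset.mem_filter.mp (hRU h)).2.2⟩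
      · exact ⟨Finset.mem_range.mp (hKsub h), hconf v h⟩
    intro i hi j hj
    by_cases hiK : i ∈ K
    · exact hone i hiK j (hgood j hj).1 (hgood j hj).2
    by_cases hjK : j ∈ K
    · exact hother j hjK i (hgood i hi).1 (hgood i hi).2
    exact hc i ((Finset.mem_union.mp hi).resolve_right hiK) j
      ((Finset.mem_union.mp hj).resolve_right hjK)
  · intro R hR
    rw [Finset.mem_filter] at hR
    exact Finset.sdiff_union_of_subset hR.2.2
  · intro R hR
    rw [Finset.mem_filter] at hR
    exact Finset.union_sdiff_cancel_right
      (Finset.disjoint_left.mpr fun v hv => hUK v (hR.2.2 hv))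
  · intro R hR
    rw [Finset.mem_filter, Finset.mem_powerset] at hR
    obtain ⟨hsub, hc, hKR⟩ := hR
    have hsub' : R \ K ⊆ Finset.range n \ K := Finset.sdiff_subset_sdiff hsub le_rfl
    have hset : (Finset.range n \ K) \ (R \ K) = Finset.range n \ R := by
      ext v
      simp only [Finset.mem_sdiff]
      have := @hKR v
      tauto
    rw [existProb, ← Finset.prod_sdiff hsub', hset, ← Finset.prod_sdiff hKR,
      Finset.prod_eq_one (s := K) fun v hv => (Finset.mem_filter.mp hv).2, mul_one, mul_comm,
      mul_assoc, ← Finset.prod_mul_distrib]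
    congr 1
    refine Finset.prod_congr rfl fun v hv => ?_
    have : 1 - p v ≠ 0 := fun h => (Finset.mem_sdiff.mp hv).2
      (Finset.mem_filter.mpr ⟨hsub (Finset.mem_sdiff.mp hv).1, by linarith⟩)
    field_simp

/-! ### Execution of ranking and reduction -/

namespace RealRAM

namespace Cmd

open Classical in
theorem run_rankPoint {n k₁ k₂ rk inv i : ℕ} {s : State} (hrk : rk ∉ [0, 22, 23])
    (hinv : inv ∉ [0, 22, 23]) (hne : rk ≠ inv) (hn : s.nat 0 0 = n) (hi : s.nat 23 0 = i) :
    (∀ m, ((rankPoint k₁ k₂ rk inv).run s).nat rk m = if m = i then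
      lexRank n (s.real k₁) (s.real k₂) i else s.nat rk m) ∧
    (∀ m, ((rankPoint k₁ k₂ rk inv).run s).nat inv m =
      if m = lexRank n (s.real k₁) (s.real k₂) i then i else s.nat inv m) := by
  simp only [List.mem_cons, List.not_mem_nil, or_false, not_or] at hrk hinv
  obtain ⟨r0, r22, r23⟩ := hrk
  obtain ⟨i0, i22, i23⟩ := hinv
  rw [rankPoint, run_seq, run_seq]
  set s1 := (setNat rk (natVar 23) (.const 1)).run s with hs1
  have e1 : s1 = s.setNat rk i 1 := by simp [hs1, hi]
  have hn1 : s1.nat 0 0 = n := by simp [e1, Ne.symm r0, hn]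
  have key := run_loop (s := s1) (v := 22) (b := 0) (p := comparePoints k₁ k₂ rk)
    (fun k st => ∀ m, st.nat rk m = if m = i then
      ({j ∈ Finset.range k | LexLt (s.real k₁) (s.real k₂) j i} : Finset ℕ).card + 1
      else s.nat rk m)
    (by intro m; simp [e1, r22, Function.update_apply]) (by
      intro k st _ hk hf hI m
      have h23 : st.nat 23 0 = i := by
        rw [hf.nat 23 (by simp [natWrites, comparePoints, Ne.symm r23])]
        simp [e1, Ne.symm r23, hi]
      have hr : ∀ b, st.real b = s.real b := fun b => by
        rw [hf.real b (by simp [realWrites, comparePoints])]; simp [e1]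
      have hcond : (Test.or (.realLt (.get k₁ (natVar 22)) (.get k₁ (natVar 23)))
          (.and (.realEq (.get k₁ (natVar 22)) (.get k₁ (natVar 23)))
            (.realLt (.get k₂ (natVar 22)) (.get k₂ (natVar 23))))).Holds st ↔
          LexLt (s.real k₁) (s.real k₂) k i := by
        simp only [Test.Holds, RealExpr.eval, NatExpr.eval, hk, h23, hr, LexLt]
        tauto
      rw [comparePoints, run_ite, Finset.range_add_one, Finset.filter_insert]
      by_cases hc : LexLt (s.real k₁) (s.real k₂) k i
      · rw [if_pos (by rwa [hcond]), if_pos hc, Finset.card_insert_of_notMem (by simp)]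
        have := hI i
        rw [if_pos rfl] at this
        by_cases hm : m = i
        · subst hm
          simp [r22, h23, this]
        · simp [r22, h23, hm, hI m]
      · rw [if_neg (by rwa [hcond]), if_neg hc]
        simpa [r22] using hI m)
  rw [hn1] at key
  set s2 := (loop 22 0 (comparePoints k₁ k₂ rk)).run s1 with hs2
  have f2 : Frame (loop 22 0 (comparePoints k₁ k₂ rk)) s1 s2 := frame_run _ _
  have h23 : s2.nat 23 0 = i := by
    rw [f2.nat 23 (by simp [natWrites, comparePoints, Ne.symm r23])]
    simp [e1, Ne.symm r23, hi]
  have hki := key i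
  rw [if_pos rfl] at hki
  have hinv' : s2.nat inv = s.nat inv := by
    rw [f2.nat inv (by simp [natWrites, comparePoints, i22, Ne.symm hne])]
    simp [e1, Ne.symm hne]
  refine ⟨fun m => ?_, fun m => ?_⟩
  · simp only [run_setNat, State.setNat_nat, if_neg hne, key m, lexRank]
  · simp only [run_setNat, State.setNat_nat, if_true, NatExpr.eval, h23, hki, hinv',
      Function.update_apply]
    rfl

theorem run_rankPoints {n k₁ k₂ rk inv : ℕ} {s : State} (hrk : rk ∉ [0, 22, 23])
    (hinv : inv ∉ [0, 22, 23]) (hne : rk ≠ inv) (hn : s.nat 0 0 = n)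
    (hk : KeysInj n (s.real k₁) (s.real k₂)) :
    ∀ i < n, ((rankPoints k₁ k₂ rk inv).run s).nat rk i = lexRank n (s.real k₁) (s.real k₂) i ∧
      ((rankPoints k₁ k₂ rk inv).run s).nat inv (lexRank n (s.real k₁) (s.real k₂) i) = i := by
  have hrk' := hrk
  have hinv' := hinv
  simp only [List.mem_cons, List.not_mem_nil, or_false, not_or] at hrk' hinv'
  obtain ⟨r0, r22, r23⟩ := hrk'
  obtain ⟨i0, i22, i23⟩ := hinv'
  have key := run_loop (s := s) (v := 23) (b := 0) (p := rankPoint k₁ k₂ rk inv)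
    (fun k st => ∀ i < k, st.nat rk i = lexRank n (s.real k₁) (s.real k₂) i ∧
      st.nat inv (lexRank n (s.real k₁) (s.real k₂) i) = i)
    (fun i hi => absurd hi (Nat.not_lt_zero i)) (by
      intro k st hkn hk' hf hI i hik
      rw [hn] at hkn
      have h0 : st.nat 0 0 = n := by
        rw [hf.nat 0 (by simp [natWrites, rankPoint, comparePoints, Ne.symm r0, Ne.symm i0]), hn]
      have hr : ∀ b, st.real b = s.real b := fun b =>
        hf.real b (by simp [realWrites, rankPoint, comparePoints])
      obtain ⟨h1, h2⟩ := run_rankPoint (k₁ := k₁) (k₂ := k₂) hrk hinv hne h0 hk'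
      simp only [State.setNat_nat, if_neg r23, if_neg i23, h1, h2, hr]
      rcases (by omega : i < k ∨ i = k) with hik | rfl
      -- Ranks of different points differ, so inverse entries written earlier are not overwritten.
      · rw [if_neg (by omega), if_neg fun h => ?_]
        · exact hI i hik
        · exact absurd ((isRanking_lexRank hk).inj i (by omega) k hkn h) (by omega)
      · simp)
  rw [hn] at key
  exact key

open Classical in
theorem run_findConflict {n i : ℕ} {s : State} (hn : s.nat 0 0 = n) (hi : s.nat 23 0 = i) :
    (findConflict.run s).nat 18 0 = 1 ↔
      Conflict n (s.nat 1) (s.nat 9) (s.nat 10) (s.real 2) i := by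
  rw [findConflict, run_seq]
  set s1 := (setNat 18 (.const 0) (.const 0)).run s with hs1
  have e1 : s1 = s.setNat 18 0 0 := by simp [hs1]
  have hn1 : s1.nat 0 0 = n := by simp [e1, hn]
  have key := run_loop (s := s1) (v := 22) (b := 0) (p := testConflict)
    (fun k st => st.nat 18 0 =
      if Conflict k (s.nat 1) (s.nat 9) (s.nat 10) (s.real 2) i then 1 else 0)
    (by simp [e1, Conflict]) (by
      intro k st _ hk hf hI
      have h1 : st.nat 1 = s.nat 1 := by rw [hf.nat 1 (by decide)]; simp [e1]
      have h9 : st.nat 9 = s.nat 9 := by rw [hf.nat 9 (by decide)]; simp [e1]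
      have h10 : st.nat 10 = s.nat 10 := by rw [hf.nat 10 (by decide)]; simp [e1]
      have h23 : st.nat 23 0 = i := by rw [hf.nat 23 (by decide)]; simp [e1, hi]
      have h2 : st.real 2 = s.real 2 := by rw [hf.real 2 (by decide)]; simp [e1]
      rw [testConflict, run_ite]
      set t : Test := .and (.realEq (.get 2 (natVar 22)) (.const 1))
        (.and (.not (.natEq (.get 1 (natVar 22)) (.get 1 (natVar 23))))
          (.or (.and (.natLt (.get 9 (natVar 22)) (.get 9 (natVar 23)))
              (.not (.natLt (.get 10 (natVar 22)) (.get 10 (natVar 23)))))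
            (.and (.not (.natLt (.get 9 (natVar 22)) (.get 9 (natVar 23))))
              (.natLt (.get 10 (natVar 22)) (.get 10 (natVar 23)))))) with ht
      have hcond : t.Holds st ↔ s.real 2 k = 1 ∧ s.nat 1 k ≠ s.nat 1 i ∧
          ¬ (s.nat 9 k < s.nat 9 i ↔ s.nat 10 k < s.nat 10 i) := by
        simp only [ht, Test.Holds, RealExpr.eval, NatExpr.eval, hk, h1, h2, h9, h10, h23]
        norm_num
        intro _ _
        simp only [← not_lt]
        tauto
      have hsucc : Conflict (k + 1) (s.nat 1) (s.nat 9) (s.nat 10) (s.real 2) i ↔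
          Conflict k (s.nat 1) (s.nat 9) (s.nat 10) (s.real 2) i ∨ t.Holds st := by
        rw [hcond]
        constructor
        · rintro ⟨m, hm, h⟩
          rcases (by omega : m < k ∨ m = k) with hm | rfl
          · exact .inl ⟨m, hm, h⟩
          · exact .inr h
        · rintro (⟨m, hm, h⟩ | h)
          · exact ⟨m, by omega, h⟩
          · exact ⟨k, by omega, h⟩
      by_cases hc : t.Holds st
      · rw [if_pos hc, if_pos (hsucc.mpr (.inr hc))]
        simp
      · rw [if_neg hc, run_skip]
        simp only [State.setNat_nat]
        norm_num
        rw [hI]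
        congr 1
        simp only [hsucc, hc, or_false])
  rw [key, hn1]
  split <;> simp_all

theorem run_reduceProbs {n : ℕ} {s : State} (hn : s.nat 0 0 = n) :
    (∀ i < n, (reduceProbs.run s).real 8 i
      = reducedProb n (s.nat 1) (s.nat 9) (s.nat 10) (s.real 2) i) ∧
    (reduceProbs.run s).real 19 0
      = ∏ i ∈ Finset.range n, absenceFactor n (s.nat 1) (s.nat 9) (s.nat 10) (s.real 2) i := by
  rw [reduceProbs, run_seq]
  set s1 := (setReal 19 (.const 0) (.const 1)).run s with hs1
  have e1 : s1 = s.setReal 19 0 1 := by simp [hs1]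
  have hn1 : s1.nat 0 0 = n := by simp [e1, hn]
  have key := run_loop (s := s1) (v := 23) (b := 0) (p := reduceProb)
    (fun k st => (∀ i < k, st.real 8 i
      = reducedProb n (s.nat 1) (s.nat 9) (s.nat 10) (s.real 2) i) ∧
      st.real 19 0
      = ∏ i ∈ Finset.range k, absenceFactor n (s.nat 1) (s.nat 9) (s.nat 10) (s.real 2) i)
    (by simp [e1]) (by
      intro k st _ hk hf ⟨hI, hJ⟩
      have h0 : st.nat 0 0 = n := by rw [hf.nat 0 (by decide), hn1]
      have h1 : st.nat 1 = s.nat 1 := by rw [hf.nat 1 (by decide)]; simp [e1]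
      have h9 : st.nat 9 = s.nat 9 := by rw [hf.nat 9 (by decide)]; simp [e1]
      have h10 : st.nat 10 = s.nat 10 := by rw [hf.nat 10 (by decide)]; simp [e1]
      have h2 : st.real 2 = s.real 2 := by rw [hf.real 2 (by decide)]; simp [e1]
      have hconf := run_findConflict h0 hk
      have fc : Frame findConflict st (findConflict.run st) := frame_run _ _
      rw [reduceProb, run_seq, run_ite]
      set s2 := findConflict.run st
      have k2 : s2.real 2 = s.real 2 := by rw [fc.real 2 (by decide), h2]
      have k23 : s2.nat 23 0 = k := by rw [fc.nat 23 (by decide), hk]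
      have k8 : s2.real 8 = st.real 8 := fc.real 8 (by decide)
      have k19 : s2.real 19 = st.real 19 := fc.real 19 (by decide)
      rw [h1, h9, h10, h2] at hconf
      have hcond : (Test.realEq (.get 2 (natVar 23)) (.const 1)).Holds s2 ↔ s.real 2 k = 1 := by
        simp [k2, k23]
      have hflag : (Test.natEq (natVar 18) (.const 1)).Holds s2 ↔
          Conflict n (s.nat 1) (s.nat 9) (s.nat 10) (s.real 2) k := by
        rw [← hconf]; simp
      have hlt : ∀ (i : ℕ) (x : ℝ), i < k →
          Function.update (st.real 8) k x i
            = reducedProb n (s.nat 1) (s.nat 9) (s.nat 10) (s.real 2) i := fun i x hi => by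
        rw [Function.update_of_ne (by omega)]; exact hI i hi
      have hfin : ∀ (x : ℝ) (s' : State),
          x = reducedProb n (s.nat 1) (s.nat 9) (s.nat 10) (s.real 2) k →
          s'.real 8 = Function.update (st.real 8) k x →
          s'.real 19 0 = st.real 19 0 *
            absenceFactor n (s.nat 1) (s.nat 9) (s.nat 10) (s.real 2) k →
          (∀ i < k + 1, (s'.setNat 23 0 (k + 1)).real 8 i
            = reducedProb n (s.nat 1) (s.nat 9) (s.nat 10) (s.real 2) i) ∧
          (s'.setNat 23 0 (k + 1)).real 19 0 = ∏ i ∈ Finset.range (k + 1),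
            absenceFactor n (s.nat 1) (s.nat 9) (s.nat 10) (s.real 2) i := by
        intro x s' hx h8 h19
        refine ⟨fun i hi => ?_, ?_⟩
        · rw [State.setNat_real, h8]
          rcases (by omega : i < k ∨ i = k) with hi | rfl
          · exact hlt i x hi
          · rw [Function.update_self, hx]
        · rw [State.setNat_real, h19, hJ, Finset.prod_range_succ]
      by_cases hc : s.real 2 k = 1
      · rw [if_pos (by rwa [hcond]), run_seq]
        set s3 := (setReal 8 (natVar 23) (.const 0)).run s2 with hs3
        have e3 : s3 = s2.setReal 8 k 0 := by simp [hs3, k23]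
        have hflag' : (Test.natEq (natVar 18) (.const 1)).Holds s3 ↔
            Conflict n (s.nat 1) (s.nat 9) (s.nat 10) (s.real 2) k := by
          rw [← hflag]; simp [e3]
        rw [run_ite]
        by_cases hcf : Conflict n (s.nat 1) (s.nat 9) (s.nat 10) (s.real 2) k
        · rw [if_pos (by rwa [hflag'])]
          exact hfin 0 _ (by rw [reducedProb, if_pos (.inl hc)]) (by simp [e3, k8])
            (by rw [absenceFactor, if_pos hc, if_pos hcf]; simp)
        · rw [if_neg (by rwa [hflag'])]
          exact hfin 0 _ (by rw [reducedProb, if_pos (.inl hc)]) (by simp [e3, k8])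
            (by rw [absenceFactor, if_pos hc, if_neg hcf]; simp [e3, k19])
      · rw [if_neg (by rwa [hcond]), run_seq]
        set s3 := (setReal 19 (.const 0)
          (.mul (realVar 19) (.sub (.const 1) (.get 2 (natVar 23))))).run s2 with hs3
        have e3 : s3 = s2.setReal 19 0 (st.real 19 0 * (1 - s.real 2 k)) := by
          simp [hs3, k23, k19, k2]
        have hflag' : (Test.natEq (natVar 18) (.const 1)).Holds s3 ↔
            Conflict n (s.nat 1) (s.nat 9) (s.nat 10) (s.real 2) k := by
          rw [← hflag]; simp [e3]
        rw [run_ite]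
        by_cases hcf : Conflict n (s.nat 1) (s.nat 9) (s.nat 10) (s.real 2) k
        · rw [if_pos (by rwa [hflag'])]
          exact hfin 0 _ (by rw [reducedProb, if_pos (.inr hcf)]) (by simp [e3, k8, k23])
            (by rw [absenceFactor, if_neg hc]; simp [e3])
        · rw [if_neg (by rwa [hflag'])]
          exact hfin (s.real 2 k) _ (by rw [reducedProb, if_neg (by tauto)])
            (by simp [e3, k8, k23, k2]) (by rw [absenceFactor, if_neg hc]; simp [e3]))
  rw [hn1] at key
  exact key

end Cmd

end RealRAM

/-! ### The concordance probability of two lexicographic orders -/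

/-- All points of different colors in `R` are in the same order for both pairs of keys. -/
def LexConcordant (col : ℕ → ℕ) (A B A' B' : ℕ → ℝ) (R : Finset ℕ) : Prop :=
  ∀ i ∈ R, ∀ j ∈ R, col i = col j ∨ (LexLt A B i j ↔ LexLt A' B' i j)

open Classical in
/-- The probability that the existing points are concordant in the orders given by the keys. -/
noncomputable def concordProb (n : ℕ) (col : ℕ → ℕ) (A B A' B' p : ℕ → ℝ) : ℝ :=
  ∑ R ∈ (Finset.range n).powerset with LexConcordant col A B A' B' R, existProb n p R

namespace RealRAM

namespace Cmd

/-- The keys enter only through the ranks, which reproduce the lexicographic orders as soon as keys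
distinguish points. The reduced probabilities are below one because certain points received zero, so
every division in the rows is legitimate. -/
theorem run_concordance {n h : ℕ} {s : State} (hs : Sizes n h s)
    (hk : KeysInj n (s.real 4) (s.real 5)) (hk' : KeysInj n (s.real 6) (s.real 7))
    (hp : ∀ i < n, s.real 2 i ≤ 1) :
    (concordance.run s).real 20 0 = concordProb n (s.nat 1) (s.real 4) (s.real 5) (s.real 6)
      (s.real 7) (s.real 2) := by
  classical
  rw [concordance, run_seq, run_seq, run_seq, run_seq, run_seq]
  have f1 : Frame (rankPoints 4 5 9 11) s ((rankPoints 4 5 9 11).run s) := frame_run _ _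
  have h1 := run_rankPoints (by decide) (by decide) (by decide) hs.num hk (rk := 9) (inv := 11)
  set s1 := (rankPoints 4 5 9 11).run s
  have r1 : s1.real = s.real := by funext a; exact f1.real a (by simp [realWrites, rankPoints, rankPoint, comparePoints])
  have f2 : Frame (rankPoints 6 7 10 12) s1 ((rankPoints 6 7 10 12).run s1) := frame_run _ _
  have h2 := run_rankPoints (s := s1) (k₁ := 6) (k₂ := 7) (rk := 10) (inv := 12) (by decide)
    (by decide) (by decide) (by rw [f1.nat 0 (by decide), hs.num]) (by rw [r1]; exact hk')
  set s2 := (rankPoints 6 7 10 12).run s1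
  have r2 : s2.real = s.real := by
    rw [← r1]; funext a; exact f2.real a (by simp [realWrites, rankPoints, rankPoint, comparePoints])
  rw [r1] at h2
  have hX0 := isRanking_lexRank hk
  have hY0 := isRanking_lexRank hk'
  have h1' : ∀ i < n, s2.nat 9 i = lexRank n (s.real 4) (s.real 5) i ∧
      s2.nat 11 (lexRank n (s.real 4) (s.real 5) i) = i := by
    rw [f2.nat 9 (by decide), f2.nat 11 (by decide)]; exact h1
  have hX : IsRanking n (s2.nat 9) := hX0.congr fun i hi => (h1' i hi).1
  have hY : IsRanking n (s2.nat 10) := hY0.congr fun i hi => (h2 i hi).1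
  have f3 : Frame reduceProbs s2 (reduceProbs.run s2) := frame_run _ _
  obtain ⟨h8, h19⟩ := run_reduceProbs (s := s2) (n := n)
    (by rw [f2.nat 0 (by decide), f1.nat 0 (by decide), hs.num])
  have n1 : s2.nat 1 = s.nat 1 := by rw [f2.nat 1 (by decide), f1.nat 1 (by decide)]
  rw [r2, n1] at h8 h19
  set s3 := reduceProbs.run s2
  have f4 : Frame makeEvents s3 (makeEvents.run s3) := frame_run _ _
  have hev := run_makeEvents (s := s3) (n := n)
    (by rw [f3.nat 0 (by decide), f2.nat 0 (by decide), f1.nat 0 (by decide), hs.num])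
  set s4 := makeEvents.run s3
  have hs4 : Sizes n h s4 := hs.congr fun a ha h1 => by
    rw [f4.nat a (by revert h1; revert ha; revert a; decide),
      f3.nat a (by revert h1; revert ha; revert a; decide),
      f2.nat a (by revert h1; revert ha; revert a; decide),
      f1.nat a (by revert h1; revert ha; revert a; decide)]
  have nat_eq : ∀ b ∈ [1, 9, 10, 11, 12], s4.nat b = s2.nat b := fun b hb => by
    rw [f4.nat b (by revert hb; revert b; decide), f3.nat b (by revert hb; revert b; decide)]
  set r := reducedProb n (s.nat 1) (s2.nat 9) (s2.nat 10) (s.real 2) with hr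
  have hr4 : ∀ i < n, s4.real 8 i = r i := by rw [f4.real 8 (by decide)]; exact h8
  have hpts : Points n (s.nat 1) (s2.nat 9) (s2.nat 10) (s4.real 8) s4 := by
    refine ⟨by rw [nat_eq 1 (by simp), n1], nat_eq 9 (by simp), nat_eq 10 (by simp), ?_, ?_, rfl,
      hX, hY, ?_⟩
    · intro i hi
      rw [nat_eq 11 (by simp), (h1' i hi).1, (h1' i hi).2]
    · intro i hi
      rw [nat_eq 12 (by simp), (h2 i hi).1, (h2 i hi).2]
    · intro i hi
      rw [hr4 i hi, hr, reducedProb]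
      split
      · norm_num
      · rename_i hcon
        exact lt_of_le_of_ne (hp i hi) fun h => hcon (.inl h)
  have hrows := run_doRows hs4 hpts (by
    rw [f3.nat 1 (by decide), f3.nat 11 (by decide), n1] at hev
    rw [nat_eq 11 (by simp)]
    exact hev)
  simp only [run_setReal, State.setReal_real, if_true, NatExpr.eval, RealExpr.eval,
    Function.update_self]
  rw [hrows, run_real 19 (by decide), f4.real 19 (by decide), h19, concordProb]
  have hsum : ∑ R ∈ (Finset.range n).powerset with Concordant (s.nat 1) (s2.nat 9) (s2.nat 10) R,
      ∏ v ∈ R, s4.real 8 v / (1 - s4.real 8 v)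
      = ∑ R ∈ (Finset.range n).powerset with Concordant (s.nat 1) (s2.nat 9) (s2.nat 10) R,
      ∏ v ∈ R, r v / (1 - r v) := by
    refine Finset.sum_congr rfl fun R hR => Finset.prod_congr rfl fun v hv => ?_
    rw [Finset.mem_filter, Finset.mem_powerset] at hR
    rw [hr4 v (Finset.mem_range.mp (hR.1 hv))]
  rw [hsum, ← sum_existProb_concordant hX hY]
  refine Finset.sum_congr (Finset.filter_congr fun R hR => ?_) fun _ _ => rfl
  rw [Finset.mem_powerset] at hR
  refine forall₄_congr fun i hi j hj => ?_
  have hi' := Finset.mem_range.mp (hR hi)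
  have hj' := Finset.mem_range.mp (hR hj)
  rw [(h1' i hi').1, (h1' j hj').1, (h2 i hi').1, (h2 j hj').1, lexRank_lt_iff hk hi' hj',
    lexRank_lt_iff hk' hi' hj']

end Cmd

end RealRAM

/-! ### Directions -/

/-- The product of the points with the vector `(p, q)`. -/
def dotKey (x y : ℕ → ℝ) (p q : ℝ) (i : ℕ) : ℝ := p * x i + q * y i

/-- The product of the points with the vector `(-q, p)`. -/
def crossKey (x y : ℕ → ℝ) (p q : ℝ) (i : ℕ) : ℝ := p * y i - q * x i

/-- The differences of points of different colors in `R` are in the open first or third quadrant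
of the coordinate system with first axis `(p, q)`. -/
def OpenDir (col : ℕ → ℕ) (x y : ℕ → ℝ) (R : Finset ℕ) (p q : ℝ) : Prop :=
  ∀ i ∈ R, ∀ j ∈ R, col i ≠ col j →
    0 < (dotKey x y p q j - dotKey x y p q i) * (crossKey x y p q j - crossKey x y p q i)

/-- The differences of points of different colors in `R` are in the first or third quadrant of the
coordinate system with first axis `(p, q)`, the first axis included. -/
def HalfOpenDir (col : ℕ → ℕ) (x y : ℕ → ℝ) (R : Finset ℕ) (p q : ℝ) : Prop :=
  ∀ i ∈ R, ∀ j ∈ R, col i ≠ col j → dotKey x y p q j - dotKey x y p q i ≠ 0 ∧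
    0 ≤ (dotKey x y p q j - dotKey x y p q i) * (crossKey x y p q j - crossKey x y p q i)

/-- All points in `R` have the same color. -/
def Monochromatic (col : ℕ → ℕ) (R : Finset ℕ) : Prop := ∀ i ∈ R, ∀ j ∈ R, col i = col j

theorem OpenDir.halfOpenDir {col : ℕ → ℕ} {x y : ℕ → ℝ} {R : Finset ℕ} {p q : ℝ}
    (h : OpenDir col x y R p q) : HalfOpenDir col x y R p q := fun i hi j hj hij =>
  ⟨fun h0 => by have := h i hi j hj hij; rw [h0, zero_mul] at this; exact this.false,
    (h i hi j hj hij).le⟩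

theorem dotKey_mul (x y : ℕ → ℝ) (c p q : ℝ) (i : ℕ) :
    dotKey x y (c * p) (c * q) i = c * dotKey x y p q i := by
  rw [dotKey, dotKey]; ring

theorem crossKey_mul (x y : ℕ → ℝ) (c p q : ℝ) (i : ℕ) :
    crossKey x y (c * p) (c * q) i = c * crossKey x y p q i := by
  rw [crossKey, crossKey]; ring

theorem OpenDir.mul {col : ℕ → ℕ} {x y : ℕ → ℝ} {R : Finset ℕ} {p q c : ℝ} (hc : c ≠ 0)
    (h : OpenDir col x y R p q) : OpenDir col x y R (c * p) (c * q) := by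
  intro i hi j hj hij
  have := h i hi j hj hij
  simp only [dotKey_mul, crossKey_mul, ← mul_sub]
  rw [mul_mul_mul_comm]
  exact mul_pos (mul_self_pos.mpr hc) this

theorem HalfOpenDir.mul {col : ℕ → ℕ} {x y : ℕ → ℝ} {R : Finset ℕ} {p q c : ℝ} (hc : c ≠ 0)
    (h : HalfOpenDir col x y R p q) : HalfOpenDir col x y R (c * p) (c * q) := by
  intro i hi j hj hij
  obtain ⟨h1, h2⟩ := h i hi j hj hij
  simp only [dotKey_mul, crossKey_mul, ← mul_sub]
  rw [mul_mul_mul_comm]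
  exact ⟨mul_ne_zero hc h1, mul_nonneg (mul_self_nonneg c) h2⟩

theorem exists_eq_mul_of_parallel {p q p' q' : ℝ} (h : p ≠ 0 ∨ q ≠ 0) (h' : p' ≠ 0 ∨ q' ≠ 0)
    (hpar : p * q' = q * p') : ∃ c ≠ 0, p' = c * p ∧ q' = c * q := by
  rcases h with hp | hq
  · have hp' : p' ≠ 0 := by
      rintro rfl
      rw [mul_zero] at hpar
      rcases mul_eq_zero.mp hpar with h0 | h0
      · exact hp h0
      · exact h'.elim (fun h => h rfl) fun h => h h0
    exact ⟨p' / p, div_ne_zero hp' hp, by field_simp, by field_simp; linarith⟩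
  · have hq' : q' ≠ 0 := by
      rintro rfl
      rw [mul_zero] at hpar
      rcases mul_eq_zero.mp hpar.symm with h0 | h0
      · exact hq h0
      · exact h'.elim (fun h => h h0) fun h => h rfl
    exact ⟨q' / q, div_ne_zero hq' hq, by field_simp; linarith, by field_simp⟩

theorem OpenDir.of_parallel {col : ℕ → ℕ} {x y : ℕ → ℝ} {R : Finset ℕ} {p q p' q' : ℝ}
    (hp : p ≠ 0 ∨ q ≠ 0) (hp' : p' ≠ 0 ∨ q' ≠ 0) (hpar : p * q' = q * p')
    (h : OpenDir col x y R p q) : OpenDir col x y R p' q' := by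
  obtain ⟨c, hc, rfl, rfl⟩ := exists_eq_mul_of_parallel hp hp' hpar
  exact h.mul hc

theorem HalfOpenDir.of_parallel {col : ℕ → ℕ} {x y : ℕ → ℝ} {R : Finset ℕ} {p q p' q' : ℝ}
    (hp : p ≠ 0 ∨ q ≠ 0) (hp' : p' ≠ 0 ∨ q' ≠ 0) (hpar : p * q' = q * p')
    (h : HalfOpenDir col x y R p q) : HalfOpenDir col x y R p' q' := by
  obtain ⟨c, hc, rfl, rfl⟩ := exists_eq_mul_of_parallel hp hp' hpar
  exact h.mul hc

/-- A small rotation moves the first axis into the open quadrant. -/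
theorem HalfOpenDir.exists_openDir {col : ℕ → ℕ} {x y : ℕ → ℝ} {R : Finset ℕ} {p q : ℝ}
    (hp : p ≠ 0 ∨ q ≠ 0) (h : HalfOpenDir col x y R p q) :
    ∃ p' q', (p' ≠ 0 ∨ q' ≠ 0) ∧ OpenDir col x y R p' q' := by
  -- The new axis is the old one turned clockwise, up to scaling. In the turned system the
  -- coordinates (D, C) of a difference become (D - εC, C + εD).
  have key : ∀ᶠ ε in nhdsWithin (0 : ℝ) (Set.Ioi 0), ∀ i ∈ R, ∀ j ∈ R, col i ≠ col j →
      0 < (dotKey x y (p + ε * q) (q - ε * p) j - dotKey x y (p + ε * q) (q - ε * p) i) *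
        (crossKey x y (p + ε * q) (q - ε * p) j - crossKey x y (p + ε * q) (q - ε * p) i) := by
    rw [Filter.eventually_all_finset]
    intro i hi
    rw [Filter.eventually_all_finset]
    intro j hj
    by_cases hij : col i = col j
    · exact Filter.Eventually.of_forall fun _ h => absurd hij h
    obtain ⟨h1, h2⟩ := h i hi j hj hij
    set D := dotKey x y p q j - dotKey x y p q i with hD
    set C := crossKey x y p q j - crossKey x y p q i with hC
    have hrot : ∀ ε : ℝ,
        (dotKey x y (p + ε * q) (q - ε * p) j - dotKey x y (p + ε * q) (q - ε * p) i) *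
        (crossKey x y (p + ε * q) (q - ε * p) j - crossKey x y (p + ε * q) (q - ε * p) i)
        = (D - ε * C) * (C + ε * D) := by
      intro ε
      simp only [hD, hC, dotKey, crossKey]
      ring
    simp only [hrot]
    rcases h2.lt_or_eq with h2 | h2
    · have hcont : Continuous fun ε : ℝ => (D - ε * C) * (C + ε * D) := by fun_prop
      have hpos := hcont.tendsto 0 |>.eventually (lt_mem_nhds (a := 0) (by simpa using h2))
      filter_upwards [nhdsWithin_le_nhds hpos] with ε hε _ using hε
    -- A difference on the axis moves into the open quadrant, because the product becomes ε D²; the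
    -- other differences stay inside by continuity.
    · have hC0 : C = 0 := (mul_eq_zero.mp h2.symm).resolve_left h1
      filter_upwards [self_mem_nhdsWithin] with ε hε _
      rw [hC0]
      have : 0 < ε := hε
      have hDD : 0 < D * D := mul_self_pos.mpr h1
      nlinarith
  obtain ⟨ε, hε⟩ := key.exists
  refine ⟨p + ε * q, q - ε * p, ?_, hε⟩
  by_contra! hcon
  obtain ⟨h1, h2⟩ := hcon
  have : p ^ 2 + q ^ 2 = 0 := by linear_combination p * h1 + q * h2
  rcases hp with hp | hq
  · have : 0 < p ^ 2 := by positivity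
    nlinarith [sq_nonneg q]
  · have : 0 < q ^ 2 := by positivity
    nlinarith [sq_nonneg p]

/-- If the axis of an open quadrant exists, then there is one through two points. -/
theorem OpenDir.exists_halfOpenDir {col : ℕ → ℕ} {x y : ℕ → ℝ} {R : Finset ℕ} {p q : ℝ}
    (h : OpenDir col x y R p q) (hR : ¬ Monochromatic col R) :
    ∃ a ∈ R, ∃ b ∈ R, col a ≠ col b ∧ HalfOpenDir col x y R (x b - x a) (y b - y a) := by
  classical
  have hnn : ∀ i ∈ R, ∀ j ∈ R, col i ≠ col j →
      0 < dotKey x y p q j - dotKey x y p q i ∨ 0 < dotKey x y p q i - dotKey x y p q j := by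
    intro i hi j hj hij
    have := (h.halfOpenDir i hi j hj hij).1
    rcases lt_or_gt_of_ne this with h | h
    · right; linarith
    · exact .inl h
  set P : Finset (ℕ × ℕ) := {v ∈ R ×ˢ R | col v.1 ≠ col v.2 ∧
    0 < dotKey x y p q v.2 - dotKey x y p q v.1} with hP
  have hPne : P.Nonempty := by
    rw [Monochromatic] at hR
    push Not at hR
    obtain ⟨i, hi, j, hj, hij⟩ := hR
    rcases hnn i hi j hj hij with h' | h'
    · exact ⟨(i, j), by simp only [hP, Finset.mem_filter, Finset.mem_product]; exact ⟨⟨hi, hj⟩, hij, h'⟩⟩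
    · exact ⟨(j, i), by
        simp only [hP, Finset.mem_filter, Finset.mem_product]; exact ⟨⟨hj, hi⟩, hij.symm, h'⟩⟩
  -- The axis is turned onto the difference of least slope. The other differences, oriented into the
  -- first quadrant, make an angle of less than 90 degrees with it and do not lie below it.
  obtain ⟨⟨a, b⟩, hab, hmin⟩ := P.exists_min_image (fun v =>
    (crossKey x y p q v.2 - crossKey x y p q v.1) / (dotKey x y p q v.2 - dotKey x y p q v.1)) hPne
  simp only [hP, Finset.mem_filter, Finset.mem_product] at hab hmin
  obtain ⟨⟨ha, hb⟩, hcol, hD0⟩ := hab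
  have hC0 := (mul_pos_iff_of_pos_left hD0).mp (h a ha b hb hcol)
  have hpq : 0 < p ^ 2 + q ^ 2 := by
    by_contra hcon
    have hp : p = 0 := by nlinarith [sq_nonneg p, sq_nonneg q]
    have hq : q = 0 := by nlinarith [sq_nonneg p, sq_nonneg q]
    simp [dotKey, hp, hq] at hD0
  have hpos : ∀ i ∈ R, ∀ j ∈ R, col i ≠ col j → 0 < dotKey x y p q j - dotKey x y p q i →
      0 < dotKey x y (x b - x a) (y b - y a) j - dotKey x y (x b - x a) (y b - y a) i ∧
      0 ≤ crossKey x y (x b - x a) (y b - y a) j - crossKey x y (x b - x a) (y b - y a) i := by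
    intro i hi j hj hij hD
    have hC := (mul_pos_iff_of_pos_left hD).mp (h i hi j hj hij)
    have hle := hmin (i, j) ⟨⟨hi, hj⟩, hij, hD⟩
    rw [div_le_div_iff₀ hD0 hD] at hle
    -- The identities `h1` and `h2` express the dot and cross products of two differences through
    -- their coordinates with respect to (p, q); the factor is the squared length of that vector.
    have h1 : (p ^ 2 + q ^ 2) *
        (dotKey x y (x b - x a) (y b - y a) j - dotKey x y (x b - x a) (y b - y a) i)
        = (dotKey x y p q b - dotKey x y p q a) * (dotKey x y p q j - dotKey x y p q i) +
          (crossKey x y p q b - crossKey x y p q a) * (crossKey x y p q j - crossKey x y p q i) := by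
      simp only [dotKey, crossKey]
      ring
    have h2 : (p ^ 2 + q ^ 2) *
        (crossKey x y (x b - x a) (y b - y a) j - crossKey x y (x b - x a) (y b - y a) i)
        = (crossKey x y p q j - crossKey x y p q i) * (dotKey x y p q b - dotKey x y p q a) -
          (crossKey x y p q b - crossKey x y p q a) * (dotKey x y p q j - dotKey x y p q i) := by
      simp only [dotKey, crossKey]
      ring
    constructor
    · refine (mul_pos_iff_of_pos_left hpq).mp ?_
      rw [h1]
      positivity
    · refine nonneg_of_mul_nonneg_right ?_ hpq
      rw [h2]
      exact sub_nonneg.mpr hle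
  refine ⟨a, ha, b, hb, hcol, fun i hi j hj hij => ?_⟩
  rcases hnn i hi j hj hij with h' | h'
  · obtain ⟨h1, h2⟩ := hpos i hi j hj hij h'
    exact ⟨h1.ne', mul_nonneg h1.le h2⟩
  · obtain ⟨h1, h2⟩ := hpos j hj i hi hij.symm h'
    refine ⟨by linarith, ?_⟩
    nlinarith [mul_nonneg h1.le h2]

theorem HalfOpenDir.exists_cross_eq_zero {col : ℕ → ℕ} {x y : ℕ → ℝ} {R : Finset ℕ} {p q : ℝ}
    (h : HalfOpenDir col x y R p q) (h' : ¬ OpenDir col x y R p q) :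
    ∃ i ∈ R, ∃ j ∈ R, col i ≠ col j ∧ crossKey x y p q j - crossKey x y p q i = 0 := by
  rw [OpenDir] at h'
  push Not at h'
  obtain ⟨i, hi, j, hj, hij, hle⟩ := h'
  obtain ⟨h1, h2⟩ := h i hi j hj hij
  exact ⟨i, hi, j, hj, hij, (mul_eq_zero.mp (le_antisymm hle h2)).resolve_left h1⟩

/-- Each boundary direction is parallel to a difference of points of different colors, and so
satisfies the quadrant condition of the other one. The product of their dot and cross products is
therefore nonnegative. Exchanging the two directions reverses the sign of the cross product, so this
product is zero, and as the dot product is not, the cross product vanishes. -/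
theorem HalfOpenDir.parallel {col : ℕ → ℕ} {x y : ℕ → ℝ} {R : Finset ℕ} {p q p' q' : ℝ}
    (hp : p ≠ 0 ∨ q ≠ 0) (hp' : p' ≠ 0 ∨ q' ≠ 0)
    (h : HalfOpenDir col x y R p q) (ho : ¬ OpenDir col x y R p q)
    (h' : HalfOpenDir col x y R p' q') (ho' : ¬ OpenDir col x y R p' q') :
    p * q' = q * p' := by
  have aux : ∀ {p q p' q' : ℝ}, (p' ≠ 0 ∨ q' ≠ 0) → HalfOpenDir col x y R p q →
      HalfOpenDir col x y R p' q' → ¬ OpenDir col x y R p' q' →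
      p * p' + q * q' ≠ 0 ∧ 0 ≤ (p * p' + q * q') * (p * q' - q * p') := by
    intro p q p' q' hp' h h' ho'
    obtain ⟨i, hi, j, hj, hij, h0⟩ := h'.exists_cross_eq_zero ho'
    obtain ⟨h1, h2⟩ := h i hi j hj hij
    have hv : x j - x i ≠ 0 ∨ y j - y i ≠ 0 := by
      by_contra! hcon
      apply h1
      rw [dotKey, dotKey]
      linear_combination p * hcon.1 + q * hcon.2
    obtain ⟨c, hc, hx, hy⟩ := exists_eq_mul_of_parallel hp' hv (by
      rw [crossKey, crossKey] at h0; linarith)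
    have hD : dotKey x y p q j - dotKey x y p q i = c * (p * p' + q * q') := by
      rw [dotKey, dotKey]; linear_combination p * hx + q * hy
    have hC : crossKey x y p q j - crossKey x y p q i = c * (p * q' - q * p') := by
      rw [crossKey, crossKey]; linear_combination p * hy - q * hx
    rw [hD] at h1
    rw [hD, hC, mul_mul_mul_comm] at h2
    exact ⟨right_ne_zero_of_mul h1, nonneg_of_mul_nonneg_right h2 (mul_self_pos.mpr hc)⟩
  obtain ⟨h1, h2⟩ := aux hp' h h' ho'
  obtain ⟨_, h4⟩ := aux hp h' h ho
  have h5 : (p * p' + q * q') * (p * q' - q * p') = 0 := by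
    refine le_antisymm ?_ h2
    nlinarith
  have := (mul_eq_zero.mp h5).resolve_left h1
  linarith

/-! ### The sum over the directions -/

/-- The number of ordered pairs of different points parallel to the direction. -/
noncomputable def parallelCount (n : ℕ) (x y : ℕ → ℝ) (p q : ℝ) : ℕ :=
  open Classical in
  ({v ∈ Finset.range n ×ˢ Finset.range n |
    v.1 ≠ v.2 ∧ p * (y v.2 - y v.1) = q * (x v.2 - x v.1)} : Finset (ℕ × ℕ)).card

open Classical in
-- A half-open direction that is not open exists exactly when the set is good and not monochromatic,
-- and is then unique up to parallelism. It is counted once for each ordered pair parallel to it,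
-- and the division by `parallelCount` turns these contributions into one.
theorem indicator_exists_openDir {n : ℕ} {x y : ℕ → ℝ} (hxy : KeysInj n x y) (col : ℕ → ℕ)
    {R : Finset ℕ} (hR : R ⊆ Finset.range n) :
    (if ∃ p q, (p ≠ 0 ∨ q ≠ 0) ∧ OpenDir col x y R p q then (1 : ℝ) else 0)
      = (if Monochromatic col R then 1 else 0) +
        ∑ a ∈ Finset.range n, ∑ b ∈ Finset.range n, if a = b then 0 else
          ((if HalfOpenDir col x y R (x b - x a) (y b - y a) then 1 else 0) -
            (if OpenDir col x y R (x b - x a) (y b - y a) then 1 else 0)) /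
          (parallelCount n x y (x b - x a) (y b - y a) : ℝ) := by
  have hdir : ∀ a ∈ Finset.range n, ∀ b ∈ Finset.range n, a ≠ b →
      x b - x a ≠ 0 ∨ y b - y a ≠ 0 := by
    intro a ha b hb hab
    by_contra! hcon
    exact hab (hxy a (Finset.mem_range.mp ha) b (Finset.mem_range.mp hb) (by linarith)
      (by linarith))
  by_cases hmono : Monochromatic col R
  -- All conditions are vacuous, so the two indicators cancel for every pair.
  · have ho : ∀ p q, OpenDir col x y R p q := fun p q i hi j hj hij =>
      absurd (hmono i hi j hj) hij
    rw [if_pos ⟨1, 0, .inl one_ne_zero, ho 1 0⟩, if_pos hmono]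
    simp [ho, (ho _ _).halfOpenDir]
  rw [if_neg hmono, zero_add]
  split_ifs with hgood
  · obtain ⟨p, q, hpq, hopen⟩ := hgood
    obtain ⟨a₀, ha₀, b₀, hb₀, hcol, hho⟩ := hopen.exists_halfOpenDir hmono
    have hne : a₀ ≠ b₀ := fun h => hcol (by rw [h])
    have hd₀ := hdir a₀ (hR ha₀) b₀ (hR hb₀) hne
    -- The difference of `a₀` and `b₀` itself lies on the axis.
    have hno : ¬ OpenDir col x y R (x b₀ - x a₀) (y b₀ - y a₀) := by
      intro h
      have := h a₀ ha₀ b₀ hb₀ hcol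
      rw [show crossKey x y (x b₀ - x a₀) (y b₀ - y a₀) b₀ -
        crossKey x y (x b₀ - x a₀) (y b₀ - y a₀) a₀ = 0 by rw [crossKey, crossKey]; ring,
        mul_zero] at this
      exact this.false
    set P : Finset (ℕ × ℕ) := {v ∈ Finset.range n ×ˢ Finset.range n |
      v.1 ≠ v.2 ∧ (x b₀ - x a₀) * (y v.2 - y v.1) = (y b₀ - y a₀) * (x v.2 - x v.1)} with hP
    have hterm : ∀ v ∈ Finset.range n ×ˢ Finset.range n, (if v.1 = v.2 then 0 else
          ((if HalfOpenDir col x y R (x v.2 - x v.1) (y v.2 - y v.1) then 1 else 0) -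
            (if OpenDir col x y R (x v.2 - x v.1) (y v.2 - y v.1) then 1 else 0)) /
          (parallelCount n x y (x v.2 - x v.1) (y v.2 - y v.1) : ℝ))
        = if v.1 ≠ v.2 ∧ (x b₀ - x a₀) * (y v.2 - y v.1) = (y b₀ - y a₀) * (x v.2 - x v.1) then
          1 / (P.card : ℝ) else 0 := by
      intro v hv
      rw [Finset.mem_product] at hv
      by_cases hv12 : v.1 = v.2
      · rw [if_pos hv12, if_neg (by tauto)]
      rw [if_neg hv12]
      have hd := hdir v.1 hv.1 v.2 hv.2 hv12
      by_cases hpar : (x b₀ - x a₀) * (y v.2 - y v.1) = (y b₀ - y a₀) * (x v.2 - x v.1)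
      · rw [if_pos (show v.1 ≠ v.2 ∧ _ from ⟨hv12, hpar⟩), if_pos (HalfOpenDir.of_parallel hd₀ hd hpar hho),
          if_neg fun h => hno (OpenDir.of_parallel hd hd₀ (by linarith) h), sub_zero]
        congr 2
        rw [parallelCount]
        refine congrArg _ (Finset.filter_congr fun w hw => and_congr_right fun hw12 => ?_)
        obtain ⟨c, hc, h1, h2⟩ := exists_eq_mul_of_parallel hd₀ hd hpar
        rw [h1, h2, mul_assoc, mul_assoc, mul_right_inj' hc]
      · rw [if_neg (fun h : v.1 ≠ v.2 ∧ _ => hpar h.2)]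
        have : HalfOpenDir col x y R (x v.2 - x v.1) (y v.2 - y v.1) ↔
            OpenDir col x y R (x v.2 - x v.1) (y v.2 - y v.1) := by
          refine ⟨fun h => ?_, OpenDir.halfOpenDir⟩
          by_contra hcon
          exact hpar (HalfOpenDir.parallel hd₀ hd hho hno h hcon)
        simp only [this, sub_self, zero_div]
    rw [← Finset.sum_product' (Finset.range n) (Finset.range n), Finset.sum_congr rfl hterm,
      ← Finset.sum_filter, Finset.sum_const, nsmul_eq_mul, mul_one_div, div_self]
    have hmem : (a₀, b₀) ∈ P := by
      simp only [hP, Finset.mem_filter, Finset.mem_product]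
      exact ⟨⟨hR ha₀, hR hb₀⟩, hne, mul_comm _ _⟩
    exact_mod_cast (Finset.card_pos.mpr ⟨_, hmem⟩).ne'
  · refine (Finset.sum_eq_zero fun a ha => Finset.sum_eq_zero fun b hb => ?_).symm
    by_cases hab : a = b
    · rw [if_pos hab]
    · have hd := hdir a ha b hb hab
      rw [if_neg hab, if_neg fun h => hgood (HalfOpenDir.exists_openDir hd h),
        if_neg fun h => hgood ⟨_, _, hd, h⟩, sub_zero, zero_div]

/-! ### Concordance in terms of directions -/

theorem keysInj_dotKey_crossKey {n : ℕ} {x y : ℕ → ℝ} (hxy : KeysInj n x y) {p q : ℝ}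
    (hpq : p ≠ 0 ∨ q ≠ 0) {i j : ℕ} (hi : i < n) (hj : j < n)
    (hd : dotKey x y p q i = dotKey x y p q j) (hc : crossKey x y p q i = crossKey x y p q j) :
    i = j := by
  have hpos : p ^ 2 + q ^ 2 ≠ 0 := by
    rcases hpq with h | h <;> positivity
  rw [dotKey, dotKey] at hd
  rw [crossKey, crossKey] at hc
  refine hxy i hi j hj ?_ ?_
  · have : (p ^ 2 + q ^ 2) * (x i - x j) = 0 := by linear_combination p * hd - q * hc
    linarith [(mul_eq_zero.mp this).resolve_left hpos]
  · have : (p ^ 2 + q ^ 2) * (y i - y j) = 0 := by linear_combination q * hd + p * hc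
    linarith [(mul_eq_zero.mp this).resolve_left hpos]

/-- Negating both keys reverses the order, so no two different points are in the same order for both
pairs of keys. -/
theorem lexConcordant_opposite {n : ℕ} {x y : ℕ → ℝ} (hxy : KeysInj n x y) (col : ℕ → ℕ)
    {R : Finset ℕ} (hR : R ⊆ Finset.range n) :
    LexConcordant col x y (fun i => 0 - x i) (fun i => 0 - y i) R ↔ Monochromatic col R := by
  refine forall₄_congr fun i hi j hj => ⟨fun h => ?_, .inl⟩
  rcases h with h | h
  · exact h
  have hi' := Finset.mem_range.mp (hR hi)
  have hj' := Finset.mem_range.mp (hR hj)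
  refine congrArg col (hxy i hi' j hj' ?_ ?_) <;> simp only [LexLt] at h <;> grind

/-- For a difference with coordinates (D, C) off the axes, concordance says that D and C have the
same sign. If D = 0, the first order looks at -C and the second at C, a disagreement; if C = 0, both
look at D and agree. -/
theorem lexConcordant_halfOpen {n : ℕ} {x y : ℕ → ℝ} (hxy : KeysInj n x y) (col : ℕ → ℕ)
    {R : Finset ℕ} (hR : R ⊆ Finset.range n) {p q : ℝ} (hpq : p ≠ 0 ∨ q ≠ 0) :
    LexConcordant col (dotKey x y p q) (fun i => -crossKey x y p q i) (crossKey x y p q)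
      (dotKey x y p q) R ↔ HalfOpenDir col x y R p q := by
  refine forall₄_congr fun i hi j hj => ?_
  rw [or_iff_not_imp_left]
  refine imp_congr_right fun hij => ?_
  have hne : dotKey x y p q j - dotKey x y p q i ≠ 0 ∨
      crossKey x y p q j - crossKey x y p q i ≠ 0 := by
    by_contra! h
    exact hij (by rw [keysInj_dotKey_crossKey hxy hpq (Finset.mem_range.mp (hR hi))
      (Finset.mem_range.mp (hR hj)) (by linarith) (by linarith)])
  set D := dotKey x y p q j - dotKey x y p q i with hD
  set C := crossKey x y p q j - crossKey x y p q i with hC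
  rw [LexLt, LexLt, show dotKey x y p q j = dotKey x y p q i + D by rw [hD]; ring,
    show crossKey x y p q j = crossKey x y p q i + C by rw [hC]; ring]
  rw [mul_nonneg_iff]
  simp only [lt_add_iff_pos_right, left_eq_add, neg_lt_neg_iff, add_lt_iff_neg_left]
  clear_value C D
  grind

/-- Compared with `lexConcordant_halfOpen`, the tie C = 0 is now broken by -D, so differences on the
first axis become discordant as well. -/
theorem lexConcordant_open {n : ℕ} {x y : ℕ → ℝ} (hxy : KeysInj n x y) (col : ℕ → ℕ)
    {R : Finset ℕ} (hR : R ⊆ Finset.range n) {p q : ℝ} (hpq : p ≠ 0 ∨ q ≠ 0) :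
    LexConcordant col (dotKey x y p q) (fun i => -crossKey x y p q i) (crossKey x y p q)
      (fun i => 0 - dotKey x y p q i) R ↔ OpenDir col x y R p q := by
  refine forall₄_congr fun i hi j hj => ?_
  rw [or_iff_not_imp_left]
  refine imp_congr_right fun hij => ?_
  have hne : dotKey x y p q j - dotKey x y p q i ≠ 0 ∨
      crossKey x y p q j - crossKey x y p q i ≠ 0 := by
    by_contra! h
    exact hij (by rw [keysInj_dotKey_crossKey hxy hpq (Finset.mem_range.mp (hR hi))
      (Finset.mem_range.mp (hR hj)) (by linarith) (by linarith)])
  set D := dotKey x y p q j - dotKey x y p q i with hD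
  set C := crossKey x y p q j - crossKey x y p q i with hC
  rw [LexLt, LexLt, show dotKey x y p q j = dotKey x y p q i + D by rw [hD]; ring,
    show crossKey x y p q j = crossKey x y p q i + C by rw [hC]; ring]
  rw [mul_pos_iff]
  simp only [lt_add_iff_pos_right, left_eq_add, neg_lt_neg_iff, add_lt_iff_neg_left,
    sub_lt_sub_iff_left]
  clear_value C D
  grind

/-- The contribution of a pair of points to the probability that some axis of an open quadrant
exists. -/
noncomputable def pairTerm (n : ℕ) (col : ℕ → ℕ) (x y p : ℕ → ℝ) (a b : ℕ) : ℝ :=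
  if a = b then 0 else
    concordProb n col (dotKey x y (x b - x a) (y b - y a))
        (fun i => -crossKey x y (x b - x a) (y b - y a) i)
        (crossKey x y (x b - x a) (y b - y a)) (dotKey x y (x b - x a) (y b - y a)) p /
      (parallelCount n x y (x b - x a) (y b - y a) : ℝ) -
    concordProb n col (dotKey x y (x b - x a) (y b - y a))
        (fun i => -crossKey x y (x b - x a) (y b - y a) i)
        (crossKey x y (x b - x a) (y b - y a))
        (fun i => 0 - dotKey x y (x b - x a) (y b - y a) i) p /
      (parallelCount n x y (x b - x a) (y b - y a) : ℝ)

open Classical in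
theorem sum_existProb_exists_openDir {n : ℕ} {x y : ℕ → ℝ} (hxy : KeysInj n x y) (col : ℕ → ℕ)
    (p : ℕ → ℝ) :
    ∑ R ∈ (Finset.range n).powerset,
      (if ∃ p q, (p ≠ 0 ∨ q ≠ 0) ∧ OpenDir col x y R p q then existProb n p R else 0)
      = concordProb n col x y (fun i => 0 - x i) (fun i => 0 - y i) p +
        ∑ a ∈ Finset.range n, ∑ b ∈ Finset.range n, pairTerm n col x y p a b := by
  have h1 : ∀ R ∈ (Finset.range n).powerset,
      (if ∃ p q, (p ≠ 0 ∨ q ≠ 0) ∧ OpenDir col x y R p q then existProb n p R else 0)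
      = (if Monochromatic col R then existProb n p R else 0) +
        ∑ a ∈ Finset.range n, ∑ b ∈ Finset.range n, if a = b then 0 else
          ((if HalfOpenDir col x y R (x b - x a) (y b - y a) then existProb n p R else 0) /
          (parallelCount n x y (x b - x a) (y b - y a) : ℝ) -
            (if OpenDir col x y R (x b - x a) (y b - y a) then existProb n p R else 0) /
          (parallelCount n x y (x b - x a) (y b - y a) : ℝ)) := by
    intro R hR
    have h := congrArg (existProb n p R * ·)
      (indicator_exists_openDir hxy col (Finset.mem_powerset.mp hR))
    simp only [mul_add, mul_ite, mul_one, mul_zero, Finset.mul_sum, mul_div_assoc', mul_sub,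
      sub_div] at h
    exact h
  have h2 : concordProb n col x y (fun i => 0 - x i) (fun i => 0 - y i) p
      = ∑ R ∈ (Finset.range n).powerset, if Monochromatic col R then existProb n p R else 0 := by
    rw [concordProb, Finset.sum_filter]
    refine Finset.sum_congr rfl fun R hR => ?_
    simp only [lexConcordant_opposite hxy col (Finset.mem_powerset.mp hR)]
  rw [Finset.sum_congr rfl h1, Finset.sum_add_distrib, ← h2, Finset.sum_comm]
  congr 1
  refine Finset.sum_congr rfl fun a ha => ?_
  rw [Finset.sum_comm]
  refine Finset.sum_congr rfl fun b hb => ?_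
  rw [pairTerm]
  by_cases hab : a = b
  · simp only [if_pos hab, Finset.sum_const_zero]
  · have hd : x b - x a ≠ 0 ∨ y b - y a ≠ 0 := by
      by_contra! hcon
      exact hab (hxy a (Finset.mem_range.mp ha) b (Finset.mem_range.mp hb) (by linarith)
        (by linarith))
    simp only [if_neg hab]
    rw [Finset.sum_sub_distrib, ← Finset.sum_div, ← Finset.sum_div, concordProb, concordProb,
      Finset.sum_filter, Finset.sum_filter]
    congr 2 <;> refine Finset.sum_congr rfl fun R hR => ?_
    · simp only [lexConcordant_halfOpen hxy col (Finset.mem_powerset.mp hR) hd]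
    · simp only [lexConcordant_open hxy col (Finset.mem_powerset.mp hR) hd]

theorem sum_existProb (n : ℕ) (p : ℕ → ℝ) :
    ∑ R ∈ (Finset.range n).powerset, existProb n p R = 1 := by
  simp only [existProb]
  rw [← Finset.prod_add]
  simp

/-! ### Planar datasets -/

namespace ColoredStochasticDataset

theorem inner_eq (v w : EuclideanSpace ℝ (Fin 2)) : inner ℝ v w = v 0 * w 0 + v 1 * w 1 := by
  rw [PiLp.inner_apply, Fin.sum_univ_two]
  simp [mul_comm]

variable {n : ℕ} (S : ColoredStochasticDataset 2 n)

/-- Neither of two points dominates the other exactly when the two coordinates of their difference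
have strictly opposite signs. In the plane the second basis vector is a multiple `c` of the first
turned by 90 degrees, so one direction describes the basis, up to the sign of `c`. -/
theorem exists_orthogonalBasis_iff (R : Finset (Fin n)) :
    (∃ B : Module.Basis (Fin 2) ℝ (EuclideanSpace ℝ (Fin 2)),
      IsOrthogonalBasis B ∧ ¬ S.HasInterColorDominance B R) ↔
    ∃ p q : ℝ, (p ≠ 0 ∨ q ≠ 0) ∧ ∀ i ∈ R, ∀ j ∈ R, S.color i ≠ S.color j →
      0 < (p * (S.point j 0 - S.point i 0) + q * (S.point j 1 - S.point i 1)) *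
        (p * (S.point j 1 - S.point i 1) - q * (S.point j 0 - S.point i 0)) := by
  constructor
  · rintro ⟨B, hB, hdom⟩
    have hne : ∀ k, B k 0 ≠ 0 ∨ B k 1 ≠ 0 := by
      intro k
      by_contra! h
      refine B.ne_zero k ?_
      ext l
      fin_cases l
      · exact h.1
      · exact h.2
    have horth := hB 0 1 (by decide)
    rw [inner_eq] at horth
    obtain ⟨c, hc, h0, h1⟩ := exists_eq_mul_of_parallel (p := -B 0 1) (q := B 0 0)
      (p' := B 1 0) (q' := B 1 1) (by rw [neg_ne_zero]; exact (hne 0).symm) (hne 1) (by linarith)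
    have hlt : ∀ i ∈ R, ∀ j ∈ R, S.color i ≠ S.color j →
        c * ((B 0 0 * (S.point j 0 - S.point i 0) + B 0 1 * (S.point j 1 - S.point i 1)) *
        (B 0 0 * (S.point j 1 - S.point i 1) - B 0 1 * (S.point j 0 - S.point i 0))) < 0 := by
      intro i hi j hj hij
      have hd1 : ¬ DominatesWrt B (S.point i) (S.point j) :=
        fun h => hdom ⟨i, hi, j, hj, hij, h⟩
      have hd2 : ¬ DominatesWrt B (S.point j) (S.point i) :=
        fun h => hdom ⟨j, hj, i, hi, hij.symm, h⟩
      simp only [DominatesWrt, Fin.forall_fin_two, inner_eq, h0, h1, not_and_or, not_le] at hd1 hd2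
      by_contra! hcon
      have hcon' : 0 ≤ (B 0 0 * (S.point j 0 - S.point i 0) + B 0 1 * (S.point j 1 - S.point i 1)) *
        (c * (B 0 0 * (S.point j 1 - S.point i 1) - B 0 1 * (S.point j 0 - S.point i 0))) := by
        linarith
      rcases hd1 with h | h
      · rcases hd2 with h' | h'
        · linarith
        · have a1 : 0 < B 0 0 * (S.point j 0 - S.point i 0) +
            B 0 1 * (S.point j 1 - S.point i 1) := by linarith
          have := nonneg_of_mul_nonneg_right hcon' a1
          linarith
      · rcases hd2 with h' | h'
        · have a1 : 0 < -(B 0 0 * (S.point j 0 - S.point i 0) +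
            B 0 1 * (S.point j 1 - S.point i 1)) := by linarith
          have a2 : 0 < c * (B 0 0 * (S.point j 1 - S.point i 1) -
            B 0 1 * (S.point j 0 - S.point i 0)) := by linarith
          nlinarith [mul_pos a1 a2]
        · linarith
    -- For negative `c` the first basis vector already serves as axis. For positive `c` it is turned
    -- by 90 degrees, which exchanges the two pairs of opposite quadrants.
    rcases lt_or_gt_of_ne hc with hc | hc
    · refine ⟨B 0 0, B 0 1, hne 0, fun i hi j hj hij => ?_⟩
      have := hlt i hi j hj hij
      by_contra! hcon
      exact this.not_ge (mul_nonneg_of_nonpos_of_nonpos hc.le hcon)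
    · refine ⟨-B 0 1, B 0 0, by rw [neg_ne_zero]; exact (hne 0).symm, fun i hi j hj hij => ?_⟩
      have := hlt i hi j hj hij
      by_contra! hcon
      refine this.not_ge (mul_nonneg hc.le ?_)
      linarith
  · rintro ⟨p, q, hpq, h⟩
    have hsq : p * p + q * q ≠ 0 := by
      rcases hpq with h | h
      · linarith [mul_self_pos.mpr h, mul_self_nonneg q]
      · linarith [mul_self_pos.mpr h, mul_self_nonneg p]
    -- The second vector is turned clockwise, so its coordinate is the negative of `crossKey`; same
    -- signs for the direction thus become opposite signs for the basis.
    set v : Fin 2 → EuclideanSpace ℝ (Fin 2) := ![!₂[p, q], !₂[q, -p]] with hv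
    have hli : LinearIndependent ℝ v := by
      rw [hv, LinearIndependent.pair_iff]
      intro s t hst
      have e0 := congrFun (congrArg WithLp.ofLp hst) 0
      have e1 := congrFun (congrArg WithLp.ofLp hst) 1
      simp at e0 e1
      constructor
      · refine (mul_eq_zero.mp ?_).resolve_right hsq
        linear_combination p * e0 + q * e1
      · refine (mul_eq_zero.mp ?_).resolve_right hsq
        linear_combination q * e0 - p * e1
    refine ⟨basisOfLinearIndependentOfCardEqFinrank hli (by simp), ?_, ?_⟩
    · intro i j hij
      rw [coe_basisOfLinearIndependentOfCardEqFinrank, inner_eq]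
      fin_cases i <;> fin_cases j <;> simp [hv] at hij ⊢ <;> ring
    · rintro ⟨i, hi, j, hj, hij, hdom⟩
      rw [DominatesWrt, coe_basisOfLinearIndependentOfCardEqFinrank, Fin.forall_fin_two] at hdom
      simp only [inner_eq, hv] at hdom
      simp at hdom
      have := h i hi j hj hij
      have a1 : p * (S.point j 0 - S.point i 0) + q * (S.point j 1 - S.point i 1) ≤ 0 := by
        linarith [hdom.1]
      have a2 : 0 ≤ p * (S.point j 1 - S.point i 1) - q * (S.point j 0 - S.point i 0) := by
        linarith [hdom.2]
      exact this.not_ge (mul_nonpos_of_nonpos_of_nonneg a1 a2)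

theorem existProb_map (R : Finset (Fin n)) :
    existProb n (S.initialState.real 2) (R.map Fin.valEmbedding) = S.realizationProb R := by
  have hcompl : Finset.range n \ R.map Fin.valEmbedding = Rᶜ.map Fin.valEmbedding := by
    ext k
    simp only [Finset.mem_sdiff, Finset.mem_range, Finset.mem_map, Finset.mem_compl,
      Fin.valEmbedding_apply]
    constructor
    · rintro ⟨hk, h⟩
      exact ⟨⟨k, hk⟩, fun hR => h ⟨_, hR, rfl⟩, rfl⟩
    · rintro ⟨i, hi, rfl⟩
      refine ⟨i.2, ?_⟩
      rintro ⟨j, hj, hji⟩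
      exact hi (Fin.ext hji ▸ hj)
  rw [existProb, hcompl, Finset.prod_map, Finset.prod_map, realizationProb]
  simp [initialState]

theorem openDir_map_iff (R : Finset (Fin n)) (p q : ℝ) :
    OpenDir (S.initialState.nat 1) (S.initialState.real 0) (S.initialState.real 1)
      (R.map Fin.valEmbedding) p q ↔ ∀ i ∈ R, ∀ j ∈ R, S.color i ≠ S.color j →
      0 < (p * (S.point j 0 - S.point i 0) + q * (S.point j 1 - S.point i 1)) *
        (p * (S.point j 1 - S.point i 1) - q * (S.point j 0 - S.point i 0)) := by
  rw [OpenDir, Finset.forall_mem_map]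
  refine forall₂_congr fun i hi => ?_
  rw [Finset.forall_mem_map]
  refine forall₂_congr fun j hj => ?_
  simp only [dotKey, crossKey, initialState, Fin.valEmbedding_apply, Fin.is_lt, dite_true, if_true,
    and_self, Fin.eta, one_ne_zero, false_and, if_false]
  refine imp_congr_right fun _ => ?_
  ring_nf

theorem keysInj_initialState :
    KeysInj n (S.initialState.real 0) (S.initialState.real 1) := by
  intro i hi j hj h0 h1
  simp only [initialState, hi, hj, dite_true, if_true, one_ne_zero, if_false] at h0 h1
  have : S.point ⟨i, hi⟩ = S.point ⟨j, hj⟩ := by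
    ext l
    fin_cases l
    · exact h0
    · exact h1
  exact congrArg Fin.val (S.point_injective this)

theorem freeBasisDominanceProb_eq :
    S.freeBasisDominanceProb = 1 -
      (concordProb n (S.initialState.nat 1) (S.initialState.real 0) (S.initialState.real 1)
        (fun i => 0 - S.initialState.real 0 i) (fun i => 0 - S.initialState.real 1 i)
        (S.initialState.real 2) +
      ∑ a ∈ Finset.range n, ∑ b ∈ Finset.range n, pairTerm n (S.initialState.nat 1)
        (S.initialState.real 0) (S.initialState.real 1) (S.initialState.real 2) a b) := by
  classical
  rw [← sum_existProb_exists_openDir S.keysInj_initialState, ← sum_existProb n (S.initialState.real 2),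
    ← Finset.sum_sub_distrib, freeBasisDominanceProb]
  refine Finset.sum_bij (fun R _ => R.map Fin.valEmbedding) (fun R _ => ?_) (fun R _ R' _ h => ?_)
    (fun R hR => ?_) (fun R _ => ?_)
  · rw [Finset.mem_powerset]
    intro k hk
    obtain ⟨i, _, rfl⟩ := Finset.mem_map.mp hk
    exact Finset.mem_range.mpr i.2
  · exact Finset.map_injective _ h
  · rw [Finset.mem_powerset] at hR
    refine ⟨R.attachFin fun k hk => Finset.mem_range.mp (hR hk), Finset.mem_univ _, ?_⟩
    ext k
    simp only [Finset.mem_map, Finset.mem_attachFin, Fin.valEmbedding_apply]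
    exact ⟨by rintro ⟨i, hi, rfl⟩; exact hi, fun hk => ⟨⟨k, Finset.mem_range.mp (hR hk)⟩, hk, rfl⟩⟩
  · rw [existProb_map]
    have := S.exists_orthogonalBasis_iff R
    simp only [openDir_map_iff, ← this]
    by_cases h : ∀ B : Module.Basis (Fin 2) ℝ (EuclideanSpace ℝ (Fin 2)),
        IsOrthogonalBasis B → S.HasInterColorDominance B R
    · rw [if_pos h, if_neg (by push Not; exact h), sub_zero]
    · rw [if_neg h, if_pos (by push Not at h; exact h), sub_self]

end ColoredStochasticDataset

/-! ### The sum over all pairs of points -/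

theorem LexConcordant.congr {n : ℕ} {col : ℕ → ℕ} {A B A' B' A₁ B₁ A₁' B₁' : ℕ → ℝ}
    (h : ∀ i < n, A i = A₁ i ∧ B i = B₁ i ∧ A' i = A₁' i ∧ B' i = B₁' i) {R : Finset ℕ}
    (hR : R ⊆ Finset.range n) :
    LexConcordant col A B A' B' R ↔ LexConcordant col A₁ B₁ A₁' B₁' R := by
  refine forall₄_congr fun i hi j hj => ?_
  obtain ⟨h1, h2, h3, h4⟩ := h i (Finset.mem_range.mp (hR hi))
  obtain ⟨k1, k2, k3, k4⟩ := h j (Finset.mem_range.mp (hR hj))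
  rw [LexLt, LexLt, LexLt, LexLt, h1, h2, h3, h4, k1, k2, k3, k4]

theorem concordProb_congr {n : ℕ} {col : ℕ → ℕ} {A B A' B' A₁ B₁ A₁' B₁' : ℕ → ℝ} (p : ℕ → ℝ)
    (h : ∀ i < n, A i = A₁ i ∧ B i = B₁ i ∧ A' i = A₁' i ∧ B' i = B₁' i) :
    concordProb n col A B A' B' p = concordProb n col A₁ B₁ A₁' B₁' p := by
  classical
  rw [concordProb, concordProb]
  exact Finset.sum_congr (Finset.filter_congr fun R hR =>
    LexConcordant.congr h (Finset.mem_powerset.mp hR)) fun _ _ => rfl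

namespace RealRAM

namespace Cmd

theorem run_oppositeKeys {n : ℕ} {s : State} (hn : s.nat 0 0 = n) : ∀ i < n,
    (oppositeKeys.run s).real 4 i = s.real 0 i ∧ (oppositeKeys.run s).real 5 i = s.real 1 i ∧
    (oppositeKeys.run s).real 6 i = 0 - s.real 0 i ∧
    (oppositeKeys.run s).real 7 i = 0 - s.real 1 i := by
  rw [oppositeKeys]
  have key := run_loop (s := s) (v := 23) (b := 0)
    (p := setReal 4 (natVar 23) (.get 0 (natVar 23)) ;;
      setReal 5 (natVar 23) (.get 1 (natVar 23)) ;;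
      setReal 6 (natVar 23) (.sub (.const 0) (.get 0 (natVar 23))) ;;
      setReal 7 (natVar 23) (.sub (.const 0) (.get 1 (natVar 23))))
    (fun k st => ∀ i < k, st.real 4 i = s.real 0 i ∧ st.real 5 i = s.real 1 i ∧
      st.real 6 i = 0 - s.real 0 i ∧ st.real 7 i = 0 - s.real 1 i)
    (fun _ h => absurd h (Nat.not_lt_zero _)) (by
      intro k st _ hk hf hI i hi
      have h0 : st.real 0 = s.real 0 := hf.real 0 (by decide)
      have h1 : st.real 1 = s.real 1 := hf.real 1 (by decide)
      rcases (by omega : i < k ∨ i = k) with hi | rfl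
      · have hne : i ≠ k := by omega
        simpa [hk, h0, h1, hne] using hI i hi
      · simp [hk, h0, h1])
  rw [hn] at key
  exact key

theorem run_halfOpenKeys {n : ℕ} {s : State} (hn : s.nat 0 0 = n) : ∀ i < n,
    (halfOpenKeys.run s).real 4 i
      = dotKey (s.real 0) (s.real 1) (s.real 23 0) (s.real 24 0) i ∧
    (halfOpenKeys.run s).real 5 i
      = -crossKey (s.real 0) (s.real 1) (s.real 23 0) (s.real 24 0) i ∧
    (halfOpenKeys.run s).real 6 i
      = crossKey (s.real 0) (s.real 1) (s.real 23 0) (s.real 24 0) i ∧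
    (halfOpenKeys.run s).real 7 i
      = dotKey (s.real 0) (s.real 1) (s.real 23 0) (s.real 24 0) i := by
  rw [halfOpenKeys]
  set p : Cmd := (setReal 4 (natVar 23) (.add (.mul (realVar 23) (.get 0 (natVar 23)))
      (.mul (realVar 24) (.get 1 (natVar 23)))) ;;
    setReal 5 (natVar 23) (.sub (.mul (realVar 24) (.get 0 (natVar 23)))
      (.mul (realVar 23) (.get 1 (natVar 23)))) ;;
    setReal 6 (natVar 23) (.sub (.mul (realVar 23) (.get 1 (natVar 23)))
      (.mul (realVar 24) (.get 0 (natVar 23)))) ;;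
    setReal 7 (natVar 23) (.add (.mul (realVar 23) (.get 0 (natVar 23)))
      (.mul (realVar 24) (.get 1 (natVar 23))))) with hp
  have key := run_loop (s := s) (v := 23) (b := 0) (p := p)
    (fun k st => ∀ i < k,
      st.real 4 i = dotKey (s.real 0) (s.real 1) (s.real 23 0) (s.real 24 0) i ∧
      st.real 5 i = -crossKey (s.real 0) (s.real 1) (s.real 23 0) (s.real 24 0) i ∧
      st.real 6 i = crossKey (s.real 0) (s.real 1) (s.real 23 0) (s.real 24 0) i ∧
      st.real 7 i = dotKey (s.real 0) (s.real 1) (s.real 23 0) (s.real 24 0) i)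
    (fun _ h => absurd h (Nat.not_lt_zero _)) (by
      intro k st _ hk hf hI i hi
      have h0 : st.real 0 = s.real 0 := hf.real 0 (by decide)
      have h1 : st.real 1 = s.real 1 := hf.real 1 (by decide)
      have h23 : st.real 23 = s.real 23 := hf.real 23 (by decide)
      have h24 : st.real 24 = s.real 24 := hf.real 24 (by decide)
      rcases (by omega : i < k ∨ i = k) with hi | rfl
      · have hne : i ≠ k := by omega
        simpa [hp, hk, h0, h1, hne] using hI i hi
      · simp [hp, hk, h0, h1, h23, h24, dotKey, crossKey])
  rw [hn] at key
  exact key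

theorem run_openKeys {n : ℕ} {s : State} (hn : s.nat 0 0 = n) :
    ∀ i < n, (openKeys.run s).real 7 i = 0 - s.real 7 i := by
  rw [openKeys]
  have key := run_loop (s := s) (v := 23) (b := 0)
    (p := setReal 7 (natVar 23) (.sub (.const 0) (.get 7 (natVar 23))))
    (fun k st => ∀ i, st.real 7 i = if i < k then 0 - s.real 7 i else s.real 7 i)
    (by simp) (by
      intro k st _ hk _ hI i
      rcases lt_trichotomy i k with hi | rfl | hi
      · simp [hk, hI, hi.ne, hi, show i < k + 1 by omega]
      · simp [hk, hI]
      · simp [hk, hI, hi.ne', hi.not_gt, show ¬ i < k + 1 by omega])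
  rw [hn] at key
  intro i hi
  rw [key i, if_pos hi]

open Classical in
theorem parallelCount_eq_sum (n : ℕ) (x y : ℕ → ℝ) (p q : ℝ) :
    parallelCount n x y p q = ∑ c ∈ Finset.range n,
      ({d ∈ Finset.range n | c ≠ d ∧ p * (y d - y c) = q * (x d - x c)} : Finset ℕ).card := by
  rw [parallelCount, Finset.card_filter, Finset.sum_product]
  simp only [Finset.card_filter]

open Classical in
theorem run_countParallel_inner {n c : ℕ} {s : State} (hn : s.nat 0 0 = n)
    (hc : s.nat 26 0 = c) :
    ((loop 27 0 testParallel).run s).real 21 0 = s.real 21 0 +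
      (({d ∈ Finset.range n | c ≠ d ∧ s.real 23 0 * (s.real 1 d - s.real 1 c)
        = s.real 24 0 * (s.real 0 d - s.real 0 c)} : Finset ℕ).card : ℝ) := by
  have key := run_loop (s := s) (v := 27) (b := 0) (p := testParallel)
    (fun k st => st.real 21 0 = s.real 21 0 +
      (({d ∈ Finset.range k | c ≠ d ∧ s.real 23 0 * (s.real 1 d - s.real 1 c)
        = s.real 24 0 * (s.real 0 d - s.real 0 c)} : Finset ℕ).card : ℝ))
    (by simp) (by
      intro k st _ hk hf hI
      have h0 : st.real 0 = s.real 0 := hf.real 0 (by decide)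
      have h1 : st.real 1 = s.real 1 := hf.real 1 (by decide)
      have h23 : st.real 23 = s.real 23 := hf.real 23 (by decide)
      have h24 : st.real 24 = s.real 24 := hf.real 24 (by decide)
      have h26 : st.nat 26 0 = c := by rw [hf.nat 26 (by decide), hc]
      have hcond : (Test.and (.not (.natEq (natVar 26) (natVar 27)))
          (.realEq (.mul (realVar 23) (.sub (.get 1 (natVar 27)) (.get 1 (natVar 26))))
            (.mul (realVar 24) (.sub (.get 0 (natVar 27)) (.get 0 (natVar 26)))))).Holds st ↔
          c ≠ k ∧ s.real 23 0 * (s.real 1 k - s.real 1 c)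
            = s.real 24 0 * (s.real 0 k - s.real 0 c) := by
        simp only [Test.Holds, RealExpr.eval, NatExpr.eval, hk, h26, h0, h1, h23, h24, ne_eq]
      rw [testParallel, run_ite, Finset.range_add_one, Finset.filter_insert]
      by_cases hd : c ≠ k ∧ s.real 23 0 * (s.real 1 k - s.real 1 c)
            = s.real 24 0 * (s.real 0 k - s.real 0 c)
      · rw [if_pos (by rwa [hcond]), if_pos hd, Finset.card_insert_of_notMem (by simp)]
        simp [hI, add_assoc]
      · rw [if_neg (by rwa [hcond]), if_neg hd]
        simpa using hI)
  rw [hn] at key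
  exact key

theorem run_countParallel {n : ℕ} {s : State} (hn : s.nat 0 0 = n) :
    (countParallel.run s).real 21 0
      = parallelCount n (s.real 0) (s.real 1) (s.real 23 0) (s.real 24 0) := by
  classical
  rw [countParallel, run_seq]
  set s1 := (setReal 21 (.const 0) (.const 0)).run s with hs1
  have e1 : s1 = s.setReal 21 0 0 := by simp [hs1]
  have hn1 : s1.nat 0 0 = n := by simp [e1, hn]
  have key := run_loop (s := s1) (v := 26) (b := 0) (p := loop 27 0 testParallel)
    (fun k st => st.real 21 0 = ∑ c ∈ Finset.range k,
      (({d ∈ Finset.range n | c ≠ d ∧ s.real 23 0 * (s.real 1 d - s.real 1 c)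
        = s.real 24 0 * (s.real 0 d - s.real 0 c)} : Finset ℕ).card : ℝ))
    (by simp [e1]) (by
      intro k st _ hk hf hI
      have h0 : st.real 0 = s.real 0 := by rw [hf.real 0 (by decide)]; simp [e1]
      have h1 : st.real 1 = s.real 1 := by rw [hf.real 1 (by decide)]; simp [e1]
      have h23 : st.real 23 = s.real 23 := by rw [hf.real 23 (by decide)]; simp [e1]
      have h24 : st.real 24 = s.real 24 := by rw [hf.real 24 (by decide)]; simp [e1]
      have hn' : st.nat 0 0 = n := by rw [hf.nat 0 (by decide), hn1]
      rw [State.setNat_real, run_countParallel_inner hn' hk, hI, h0, h1, h23, h24,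
        Finset.sum_range_succ])
  rw [hn1] at key
  rw [key, parallelCount_eq_sum, Nat.cast_sum]

theorem run_doPair {n h a b : ℕ} {s : State} (hs : Sizes n h s)
    (hxy : KeysInj n (s.real 0) (s.real 1)) (hp : ∀ i < n, s.real 2 i ≤ 1)
    (ha : s.nat 24 0 = a) (hb : s.nat 25 0 = b) (han : a < n) (hbn : b < n) :
    (doPair.run s).real 22 0 = s.real 22 0 +
      pairTerm n (s.nat 1) (s.real 0) (s.real 1) (s.real 2) a b := by
  rw [doPair, run_ite, pairTerm]
  by_cases hab : a = b
  · rw [if_pos (by simpa [ha, hb] using hab), if_pos hab, run_skip, add_zero]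
  rw [if_neg (by simpa [ha, hb] using hab), if_neg hab, run_seq, run_seq, run_seq, run_seq,
    run_seq, run_seq, run_seq, run_seq]
  have hd : s.real 0 b - s.real 0 a ≠ 0 ∨ s.real 1 b - s.real 1 a ≠ 0 := by
    by_contra! hcon
    exact hab (hxy a han b hbn (by linarith) (by linarith))
  set p := s.real 0 b - s.real 0 a with hpdef
  set q := s.real 1 b - s.real 1 a with hqdef
  set s1 := (setReal 24 (.const 0) (.sub (.get 1 (natVar 25)) (.get 1 (natVar 24)))).run
    ((setReal 23 (.const 0) (.sub (.get 0 (natVar 25)) (.get 0 (natVar 24)))).run s) with hs1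
  have e1 : s1 = (s.setReal 23 0 p).setReal 24 0 q := by simp [hs1, ha, hb, hpdef, hqdef]
  clear_value s1
  have n1 : s1.nat = s.nat := by rw [e1]; rfl
  have r1 : ∀ c, c ≠ 23 → c ≠ 24 → s1.real c = s.real c := fun c h h' => by simp [e1, h, h']
  have r23 : s1.real 23 0 = p := by simp [e1]
  have r24 : s1.real 24 0 = q := by simp [e1]
  have hs1' : Sizes n h s1 := hs.congr fun c _ _ => by rw [n1]
  -- the number of parallel pairs
  have f2 : Frame countParallel s1 (countParallel.run s1) := frame_run _ _
  have hcount := run_countParallel hs1'.num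
  rw [r1 0 (by decide) (by decide), r1 1 (by decide) (by decide), r23, r24] at hcount
  set s2 := countParallel.run s1
  have hs2 : Sizes n h s2 := f2.sizes hs1' (by decide)
  -- the half-open quadrant
  have f3 : Frame halfOpenKeys s2 (halfOpenKeys.run s2) := frame_run _ _
  have hkeys := run_halfOpenKeys hs2.num
  rw [f2.real 0 (by decide), f2.real 1 (by decide), f2.real 23 (by decide), f2.real 24 (by decide),
    r1 0 (by decide) (by decide), r1 1 (by decide) (by decide), r23, r24] at hkeys
  set s3 := halfOpenKeys.run s2
  have hs3 : Sizes n h s3 := f3.sizes hs2 (by decide)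
  have n3 : s3.nat 1 = s.nat 1 := by rw [f3.nat 1 (by decide), f2.nat 1 (by decide), n1]
  have p3 : s3.real 2 = s.real 2 := by
    rw [f3.real 2 (by decide), f2.real 2 (by decide), r1 2 (by decide) (by decide)]
  have inj : ∀ i < n, ∀ j < n, s3.real 4 i = s3.real 4 j → s3.real 6 i = s3.real 6 j → i = j := by
    intro i hi j hj h1 h2
    rw [(hkeys i hi).1, (hkeys j hj).1] at h1
    rw [(hkeys i hi).2.2.1, (hkeys j hj).2.2.1] at h2
    exact keysInj_dotKey_crossKey hxy hd hi hj h1 h2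
  have h5 : ∀ i < n, s3.real 5 i = -s3.real 6 i := fun i hi => by
    rw [(hkeys i hi).2.1, (hkeys i hi).2.2.1]
  have h7 : ∀ i < n, s3.real 7 i = s3.real 4 i := fun i hi => by
    rw [(hkeys i hi).2.2.2, (hkeys i hi).1]
  have hk3 : KeysInj n (s3.real 4) (s3.real 5) := fun i hi j hj h1 h2 => inj i hi j hj h1 (by
    rw [h5 i hi, h5 j hj] at h2; exact neg_injective h2)
  have hk3' : KeysInj n (s3.real 6) (s3.real 7) := fun i hi j hj h1 h2 => inj i hi j hj (by
    rwa [h7 i hi, h7 j hj] at h2) h1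
  have f4 : Frame concordance s3 (concordance.run s3) := frame_run _ _
  have hhalf := run_concordance hs3 hk3 hk3' (by rw [p3]; exact hp)
  rw [concordProb_congr _ hkeys, n3, p3] at hhalf
  set s4 := concordance.run s3
  have w4 : ∀ c ∈ [4, 5, 6, 7, 2, 21, 22], s4.real c = s3.real c := fun c hc =>
    f4.real c (by revert hc; revert c; decide)
  set s5 := (setReal 22 (.const 0) (.add (realVar 22) (.div (realVar 20) (realVar 21)))).run s4
    with hs5
  have e5 : s5 = s4.setReal 22 0 (s4.real 22 0 + s4.real 20 0 / s4.real 21 0) := by simp [hs5]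
  clear_value s5
  have hs5' : Sizes n h s5 := by
    refine hs3.congr fun c hc h1 => ?_
    rw [e5, State.setReal_nat, f4.nat c (by revert h1; revert hc; revert c; decide)]
  have r5 : ∀ c, c ≠ 22 → s5.real c = s4.real c := fun c h => by simp [e5, h]
  -- the open quadrant
  have f6 : Frame openKeys s5 (openKeys.run s5) := frame_run _ _
  have hopen := run_openKeys hs5'.num
  set s6 := openKeys.run s5
  have hs6 : Sizes n h s6 := f6.sizes hs5' (by decide)
  have w6 : ∀ c ∈ [4, 5, 6, 2, 21], s6.real c = s3.real c := fun c hc => by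
    rw [f6.real c (by revert hc; revert c; decide), r5 c (by revert hc; revert c; decide),
      w4 c (by revert hc; revert c; decide)]
  have n6 : s6.nat 1 = s.nat 1 := by
    rw [f6.nat 1 (by decide), e5, State.setReal_nat, f4.nat 1 (by decide), n3]
  have hkeys6 : ∀ i < n, s6.real 4 i = dotKey (s.real 0) (s.real 1) p q i ∧
      s6.real 5 i = -crossKey (s.real 0) (s.real 1) p q i ∧
      s6.real 6 i = crossKey (s.real 0) (s.real 1) p q i ∧
      s6.real 7 i = 0 - dotKey (s.real 0) (s.real 1) p q i := by
    intro i hi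
    obtain ⟨k4, k5, k6, k7⟩ := hkeys i hi
    rw [w6 4 (by simp), w6 5 (by simp), w6 6 (by simp), hopen i hi, r5 7 (by decide),
      w4 7 (by simp), k4, k5, k6, k7]
    exact ⟨rfl, rfl, rfl, rfl⟩
  have hk6' : KeysInj n (s6.real 6) (s6.real 7) := fun i hi j hj h1 h2 => by
    rw [(hkeys6 i hi).2.2.1, (hkeys6 j hj).2.2.1] at h1
    rw [(hkeys6 i hi).2.2.2, (hkeys6 j hj).2.2.2] at h2
    exact keysInj_dotKey_crossKey hxy hd hi hj (by linarith) h1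
  have f7 : Frame concordance s6 (concordance.run s6) := frame_run _ _
  have hfull := run_concordance hs6 (by rw [w6 4 (by simp), w6 5 (by simp)]; exact hk3) hk6'
    (by rw [w6 2 (by simp), p3]; exact hp)
  rw [concordProb_congr _ hkeys6, n6, w6 2 (by simp), p3] at hfull
  set s7 := concordance.run s6
  have h21 : s3.real 21 0 = parallelCount n (s.real 0) (s.real 1) p q := by
    rw [f3.real 21 (by decide), hcount]
  have h22 : s3.real 22 0 = s.real 22 0 := by
    rw [f3.real 22 (by decide), f2.real 22 (by decide), r1 22 (by decide) (by decide)]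
  have e22 : s7.real 22 0 = s.real 22 0 + s4.real 20 0 / s4.real 21 0 := by
    rw [f7.real 22 (by decide), f6.real 22 (by decide), e5]
    simp [w4 22 (by simp), h22]
  simp only [run_setReal, State.setReal_real, if_true, NatExpr.eval, RealExpr.eval,
    Function.update_self]
  rw [e22, hhalf, hfull, w4 21 (by simp), f7.real 21 (by decide), w6 21 (by simp), h21]
  ring

theorem run_sumPairs {n h : ℕ} {s : State} (hs : Sizes n h s)
    (hxy : KeysInj n (s.real 0) (s.real 1)) (hp : ∀ i < n, s.real 2 i ≤ 1) :
    (sumPairs.run s).real 3 0 = 1 -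
      (concordProb n (s.nat 1) (s.real 0) (s.real 1) (fun i => 0 - s.real 0 i)
        (fun i => 0 - s.real 1 i) (s.real 2) +
      ∑ a ∈ Finset.range n, ∑ b ∈ Finset.range n,
        pairTerm n (s.nat 1) (s.real 0) (s.real 1) (s.real 2) a b) := by
  rw [sumPairs, run_seq, run_seq, run_seq, run_seq]
  have f1 : Frame oppositeKeys s (oppositeKeys.run s) := frame_run _ _
  have hkeys := run_oppositeKeys hs.num
  set s1 := oppositeKeys.run s
  have hs1 : Sizes n h s1 := f1.sizes hs (by decide)
  have f2 : Frame concordance s1 (concordance.run s1) := frame_run _ _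
  have hmono := run_concordance hs1
    (fun i hi j hj h4 h5 => hxy i hi j hj (by
      rwa [(hkeys i hi).1, (hkeys j hj).1] at h4) (by
      rwa [(hkeys i hi).2.1, (hkeys j hj).2.1] at h5))
    (fun i hi j hj h6 h7 => hxy i hi j hj (by
      rw [(hkeys i hi).2.2.1, (hkeys j hj).2.2.1] at h6; linarith) (by
      rw [(hkeys i hi).2.2.2, (hkeys j hj).2.2.2] at h7; linarith))
    (by rw [f1.real 2 (by decide)]; exact hp)
  rw [concordProb_congr _ hkeys, f1.nat 1 (by decide), f1.real 2 (by decide)] at hmono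
  set s2 := concordance.run s1
  set s3 := (setReal 22 (.const 0) (realVar 20)).run s2 with hs3
  have e3 : s3 = s2.setReal 22 0 (s2.real 20 0) := by simp [hs3]
  clear_value s3
  have r3 : ∀ c ∈ [0, 1, 2], s3.real c = s.real c := fun c hc => by
    rw [e3, State.setReal_real, if_neg (by revert hc; revert c; decide),
      f2.real c (by revert hc; revert c; decide), f1.real c (by revert hc; revert c; decide)]
  have n3 : s3.nat 1 = s.nat 1 := by
    rw [e3, State.setReal_nat, f2.nat 1 (by decide), f1.nat 1 (by decide)]
  have hs3' : Sizes n h s3 := hs1.congr fun c hc h1 => by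
    rw [e3, State.setReal_nat, f2.nat c (by revert h1; revert hc; revert c; decide)]
  have h22 : s3.real 22 0 = s2.real 20 0 := by simp [e3]
  have sizes_of : ∀ (c : Cmd) (st st' : State), Frame c st st' → Sizes n h st →
      (∀ a ≤ 8, a ≠ 1 → a ∉ c.natWrites) → Sizes n h st' := fun c st st' hf hst hc =>
    hst.congr fun a ha h1 => hf.nat a (hc a ha h1)
  have key := run_loop (s := s3) (v := 24) (b := 0) (p := loop 25 0 doPair)
    (fun k st => st.real 22 0 = s3.real 22 0 + ∑ a ∈ Finset.range k, ∑ b ∈ Finset.range n,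
      pairTerm n (s.nat 1) (s.real 0) (s.real 1) (s.real 2) a b)
    (by simp) (by
      intro k st hkn hk hf hI
      rw [hs3'.num] at hkn
      have hst : Sizes n h st := sizes_of _ _ _ hf hs3' (by decide)
      have w : ∀ c ∈ [0, 1, 2], st.real c = s.real c := fun c hc => by
        rw [hf.real c (by revert hc; revert c; decide), r3 c hc]
      have w1 : st.nat 1 = s.nat 1 := by rw [hf.nat 1 (by decide), n3]
      have key' := run_loop (s := st) (v := 25) (b := 0) (p := doPair)
        (fun m su => su.real 22 0 = st.real 22 0 + ∑ b ∈ Finset.range m,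
          pairTerm n (s.nat 1) (s.real 0) (s.real 1) (s.real 2) k b)
        (by simp) (by
          intro m su hmn hm hg hJ
          rw [hst.num] at hmn
          have hsu : Sizes n h su := sizes_of _ _ _ hg hst (by decide)
          have u : ∀ c ∈ [0, 1, 2], su.real c = s.real c := fun c hc => by
            rw [hg.real c (by revert hc; revert c; decide), w c hc]
          have u1 : su.nat 1 = s.nat 1 := by rw [hg.nat 1 (by decide), w1]
          have := run_doPair hsu (by rw [u 0 (by simp), u 1 (by simp)]; exact hxy)
            (by rw [u 2 (by simp)]; exact hp) (by rw [hg.nat 24 (by decide), hk]) hm hkn hmn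
          rw [State.setNat_real, this, hJ, u 0 (by simp), u 1 (by simp), u 2 (by simp), u1,
            Finset.sum_range_succ, add_assoc])
      rw [hst.num] at key'
      rw [State.setNat_real, key', hI, Finset.sum_range_succ, add_assoc])
  rw [hs3'.num] at key
  simp only [run_setReal, State.setReal_real, if_true, NatExpr.eval, RealExpr.eval,
    Function.update_self]
  rw [key, h22, hmono, Nat.cast_one]

/-! ### Initialization -/

theorem run_initTables {n h : ℕ} {s : State} (hn : s.nat 0 0 = n) (h2 : s.nat 2 0 = 2 ^ h)
    (h3 : s.nat 3 0 = h) (h4 : s.nat 4 0 = 2 ^ h + 2 ^ h) (h5 : s.nat 5 0 = n + 1)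
    (h6 : s.nat 6 0 = n + n) (h8 : s.nat 8 0 = 0) (hlt : n < 2 ^ h) :
    Sizes n h (initTables.run s) := by
  rw [initTables, run_seq]
  set p : Cmd := (setNat 7 (.add (natVar 20) (natVar 20)) (natVar 20) ;;
    setNat 7 (.add (.add (natVar 20) (natVar 20)) (.const 1)) (natVar 20)) with hp
  set q : Cmd := setNat 8 (.add (natVar 20) (.const 1)) (.add (.get 8 (natVar 20)) (natVar 0))
    with hq
  have f1 : Frame (loop 20 2 p) s ((loop 20 2 p).run s) := frame_run _ _
  have hhalf := run_loop (s := s) (v := 20) (b := 2) (p := p)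
    (fun k st => ∀ m < k + k, st.nat 7 m = m / 2) (fun _ hm => absurd hm (Nat.not_lt_zero _)) (by
      intro k st _ hk _ hI m hm
      have e : ((p.run st).setNat 20 0 (k + 1)).nat 7
          = Function.update (Function.update (st.nat 7) (k + k) k) (k + k + 1) k := by
        simp [hp, hk]
      rw [e]
      by_cases h1 : m = k + k + 1
      · rw [h1, Function.update_self]; omega
      · rw [Function.update_of_ne h1]
        by_cases h2 : m = k + k
        · rw [h2, Function.update_self]; omega
        · rw [Function.update_of_ne h2]
          exact hI m (by omega))
  rw [h2] at hhalf
  set s1 := (loop 20 2 p).run s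
  have hn1 : s1.nat 0 0 = n := by rw [f1.nat 0 (by decide), hn]
  have hb : s1.nat 5 0 = n + 1 := by rw [f1.nat 5 (by decide), h5]
  have f2 : Frame (loop 20 5 q) s1 ((loop 20 5 q).run s1) := frame_run _ _
  have hoff := run_loop (s := s1) (v := 20) (b := 5) (p := q)
    (fun k st => ∀ j ≤ k, st.nat 8 j = j * n) (by
      intro j hj
      obtain rfl : j = 0 := by omega
      simp [f1.nat 8 (by decide), h8]) (by
      intro k st _ hk hf hI j hj
      have h0 : st.nat 0 0 = n := by rw [hf.nat 0 (by decide), hn1]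
      have e : ((q.run st).setNat 20 0 (k + 1)).nat 8
          = Function.update (st.nat 8) (k + 1) (st.nat 8 k + n) := by
        simp [hq, hk, h0]
      rw [e]
      by_cases h1 : j = k + 1
      · rw [h1, Function.update_self, hI k le_rfl, Nat.succ_mul]
      · rw [Function.update_of_ne h1]
        exact hI j (by omega))
  rw [hb] at hoff
  set s2 := (loop 20 5 q).run s1
  have w : ∀ a ∈ [0, 2, 3, 4, 5, 6], s2.nat a = s.nat a := fun a ha => by
    rw [f2.nat a (by revert ha; revert a; decide), f1.nat a (by revert ha; revert a; decide)]
  refine ⟨?_, ?_, ?_, ?_, ?_, ?_, ?_, fun k hk => hoff k (by omega), hlt⟩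
  · rw [w 0 (by simp), hn]
  · rw [w 2 (by simp), h2]
  · rw [w 3 (by simp), h3]
  · rw [w 4 (by simp), h4]
  · rw [w 5 (by simp), h5]
  · rw [w 6 (by simp), h6]
  · rw [f2.nat 7 (by decide)]; exact hhalf

/-- Doubling stops at `n.size`, the least exponent whose power of two exceeds `n`. The remaining
rounds do nothing, which the minimum in the invariant records. -/
theorem run_initTree {n : ℕ} {s : State} (hn : s.nat 0 0 = n) (h2 : s.nat 2 0 = 1)
    (h3 : s.nat 3 0 = 0) (h5 : s.nat 5 0 = n + 1) :
    (initTree.run s).nat 2 0 = 2 ^ n.size ∧ (initTree.run s).nat 3 0 = n.size := by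
  rw [initTree]
  set p : Cmd := ite (.natLt (natVar 0) (natVar 2)) skip
    (setNat 2 (.const 0) (.add (natVar 2) (natVar 2)) ;;
      setNat 3 (.const 0) (.add (natVar 3) (.const 1))) with hp
  have key := run_loop (s := s) (v := 20) (b := 5) (p := p)
    (fun k st => st.nat 2 0 = 2 ^ min k n.size ∧ st.nat 3 0 = min k n.size)
    (by simp [h2, h3]) (by
      intro k st _ hk hf hI
      have h0 : st.nat 0 0 = n := by rw [hf.nat 0 (by decide), hn]
      rw [hp, run_ite]
      by_cases hc : n < 2 ^ min k n.size
      · rw [if_pos (by simpa [h0, hI.1] using hc), run_skip]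
        have h1 := Nat.size_le.mpr hc
        have h2 : min (k + 1) n.size = min k n.size := by omega
        simpa [h2] using hI
      · rw [if_neg (by simpa [h0, hI.1] using hc)]
        have h1 : ¬ n.size ≤ min k n.size := fun h => hc (Nat.size_le.mp h)
        have h2 : min (k + 1) n.size = min k n.size + 1 := by omega
        simp [h2, hI.1, hI.2, pow_succ, mul_two])
  have hsize : n.size ≤ n + 1 :=
    Nat.size_le.mpr (Nat.lt_two_pow_self.trans (Nat.pow_lt_pow_right (by norm_num) (by omega)))
  rw [h5, min_eq_right hsize] at key
  exact key

end Cmd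

end RealRAM

/-! ### The whole program and its running time -/

namespace RealRAM

namespace Cmd

/-- The whole program. -/
def whole : Cmd := initSizes ;; initTree ;; initNodes ;; mainPart

/-- The values of the loop bounds for `n` points. -/
def boundValue (n b : ℕ) : ℕ :=
  if b = 0 then n else if b = 2 then 2 ^ n.size else if b = 3 then n.size
  else if b = 4 then 2 ^ n.size + 2 ^ n.size else if b = 5 then n + 1 else n + n

theorem bounds_whole : ∀ b ∈ whole.bounds, b = 0 ∨ b = 2 ∨ b = 3 ∨ b = 4 ∨ b = 5 ∨ b = 6 := by
  decide +kernel

theorem two_pow_size_le {n : ℕ} (hn : 0 < n) : 2 ^ n.size ≤ 2 * n := by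
  have h1 : 0 < n.size := Nat.size_pos.mpr hn
  have h2 : 2 ^ (n.size - 1) ≤ n := Nat.lt_size.mp (by omega)
  calc 2 ^ n.size = 2 ^ (n.size - 1) * 2 := by rw [← pow_succ, Nat.sub_add_cancel h1]
    _ ≤ 2 * n := by omega

/-- The four levels are the two loops over pairs, the loop over rows or points and a loop inside it;
tree paths add one loop over the height. The largest other bound is the number of tree nodes, at
most 4n because the number of leaves is at most 2n. -/
theorem time_whole_le {n : ℕ} (hn : 0 < n) :
    whole.time (boundValue n) ≤ whole.timeConst * ((4 * n) ^ 4 * n.size ^ 1) := by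
  have hsize := two_pow_size_le hn
  have h := time_le (b₀ := 3) (M := 4 * n) (H := n.size) (ρ := boundValue n) (by omega)
    (Nat.size_pos.mpr hn) whole (by
      intro b hb
      rcases bounds_whole b hb with rfl | rfl | rfl | rfl | rfl | rfl <;>
        simp [boundValue] <;> omega)
  have h1 : whole.depth 3 = 4 := by decide +kernel
  have h2 : whole.depthAt 3 = 1 := by decide +kernel
  rwa [h1, h2] at h

theorem size_le_log {n : ℕ} (hn : 2 ≤ n) : (n.size : ℝ) ≤ 4 * Real.log n := by
  have h1 : 0 < n.size := Nat.size_pos.mpr (by omega)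
  have h2 : 2 ^ (n.size - 1) ≤ n := Nat.lt_size.mp (by omega)
  have h3 : ((n.size - 1 : ℕ) : ℝ) * Real.log 2 ≤ Real.log n := by
    rw [← Real.log_pow]
    exact Real.log_le_log (by positivity) (by exact_mod_cast h2)
  rw [Nat.cast_sub h1, Nat.cast_one] at h3
  have h4 : Real.log 2 ≤ Real.log n :=
    Real.log_le_log (by norm_num) (by exact_mod_cast hn)
  have h5 := Real.log_two_gt_d9
  have h6 : (0 : ℝ) ≤ n.size := by positivity
  nlinarith

theorem isBigO_time_whole :
    Asymptotics.IsBigO Filter.atTop (fun n : ℕ => (whole.time (boundValue n) : ℝ))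
      (fun n : ℕ => (n : ℝ) ^ 4 * Real.log (n : ℝ) ^ 2) := by
  refine Asymptotics.IsBigO.of_bound (whole.timeConst * 2048) ?_
  filter_upwards [Filter.eventually_ge_atTop 2] with n hn
  have h1 : (whole.time (boundValue n) : ℝ) ≤ whole.timeConst * ((4 * n) ^ 4 * n.size ^ 1) := by
    exact_mod_cast time_whole_le (n := n) (by omega)
  have h2 := size_le_log hn
  have h3 : 1 / 2 ≤ Real.log n := by
    have := Real.log_le_log (by norm_num : (0 : ℝ) < 2) (by exact_mod_cast hn : (2 : ℝ) ≤ n)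
    linarith [Real.log_two_gt_d9]
  rw [Real.norm_of_nonneg (by positivity), Real.norm_of_nonneg (by positivity), mul_assoc]
  refine h1.trans (mul_le_mul_of_nonneg_left ?_ (by positivity))
  -- One logarithm would suffice; the second is introduced using log n ≥ 1/2, valid for n ≥ 2.
  have h4 : (n.size : ℝ) ≤ 8 * Real.log n ^ 2 := by nlinarith
  calc ((4 * n : ℝ)) ^ 4 * (n.size : ℝ) ^ 1 = 256 * (n : ℝ) ^ 4 * n.size := by ring
    _ ≤ 256 * (n : ℝ) ^ 4 * (8 * Real.log n ^ 2) := by gcongr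
    _ = 2048 * ((n : ℝ) ^ 4 * Real.log n ^ 2) := by ring

end Cmd

end RealRAM

open RealRAM RealRAM.Cmd in
-- The initialization writes the scalars that later bound loops, so the program as a whole is not
-- `Safe`. It is cut into four segments, in each of which the loop bounds are constant.
theorem ColoredStochasticDataset.exec_whole {n : ℕ} (S : ColoredStochasticDataset 2 n) :
    ∃ (t : ℕ) (s : State), Exec whole.toProgram S.initialState t s ∧
      t ≤ whole.time (boundValue n) ∧ s.output = S.freeBasisDominanceProb := by
  set s := S.initialState with hs
  have z : ∀ a, a ≠ 0 → a ≠ 1 → s.nat a 0 = 0 := fun a h0 h1 => by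
    simp [hs, initialState, h0, h1]
  have hn : s.nat 0 0 = n := by simp [hs, initialState]
  obtain ⟨t1, ht1, x1⟩ := exec_of_safe' (ρ := boundValue n) initSizes (by decide) s
    (fun b hb => by simp [initSizes, bounds] at hb)
  have f1 : Frame initSizes s (initSizes.run s) := frame_run _ _
  have a5 : (initSizes.run s).nat 5 0 = n + 1 := by simp [initSizes, hn]
  have a6 : (initSizes.run s).nat 6 0 = n + n := by simp [initSizes, hn]
  have a2 : (initSizes.run s).nat 2 0 = 1 := by simp [initSizes]
  set s1 := initSizes.run s
  have a3 : s1.nat 3 0 = 0 := by rw [f1.nat 3 (by decide), z 3 (by decide) (by decide)]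
  obtain ⟨t2, ht2, x2⟩ := exec_of_safe' (ρ := boundValue n) initTree (by decide) s1
    (fun b hb => by
      obtain rfl : b = 5 := by simpa [initTree, bounds] using hb
      rw [a5]; rfl)
  have f2 : Frame initTree s1 (initTree.run s1) := frame_run _ _
  obtain ⟨b2, b3⟩ := run_initTree (by rw [f1.nat 0 (by decide), hn]) a2 a3 a5
  set s2 := initTree.run s1
  obtain ⟨t3, ht3, x3⟩ := exec_of_safe' (ρ := boundValue n) initNodes (by decide) s2
    (fun b hb => by simp [initNodes, bounds] at hb)
  have f3 : Frame initNodes s2 (initNodes.run s2) := frame_run _ _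
  have c4 : (initNodes.run s2).nat 4 0 = 2 ^ n.size + 2 ^ n.size := by simp [initNodes, b2]
  set s3 := initNodes.run s2
  have w : ∀ a ∈ [0, 1, 8], s3.nat a = s.nat a := fun a ha => by
    rw [f3.nat a (by revert ha; revert a; decide), f2.nat a (by revert ha; revert a; decide),
      f1.nat a (by revert ha; revert a; decide)]
  have r3 : s3.real = s.real := by
    funext a
    rw [f3.real a (by simp [realWrites, initNodes]), f2.real a (by simp [realWrites, initTree]),
      f1.real a (by simp [realWrites, initSizes])]
  have c0 : s3.nat 0 0 = n := by rw [w 0 (by simp), hn]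
  have c2 : s3.nat 2 0 = 2 ^ n.size := by rw [f3.nat 2 (by decide), b2]
  have c3 : s3.nat 3 0 = n.size := by rw [f3.nat 3 (by decide), b3]
  have c5 : s3.nat 5 0 = n + 1 := by rw [f3.nat 5 (by decide), f2.nat 5 (by decide), a5]
  have c6 : s3.nat 6 0 = n + n := by rw [f3.nat 6 (by decide), f2.nat 6 (by decide), a6]
  obtain ⟨t4, ht4, x4⟩ := exec_of_safe' (ρ := boundValue n) mainPart safe_mainPart s3
    (fun b hb => by
      rcases bounds_mainPart b hb with rfl | rfl | rfl | rfl | rfl | rfl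
      · exact c0
      · exact c2
      · exact c3
      · exact c4
      · exact c5
      · exact c6)
  refine ⟨_, _, x1.seq (x2.seq (x3.seq x4)), ?_, ?_⟩
  · simp only [whole, time]
    omega
  · have f4 : Frame initTables s3 (initTables.run s3) := frame_run _ _
    have hsizes : Sizes n n.size (initTables.run s3) := run_initTables c0 c2 c3 c4 c5 c6
      (by rw [w 8 (by simp), z 8 (by decide) (by decide)]) (Nat.lt_size_self n)
    have rr : (initTables.run s3).real = s.real := by
      funext a
      rw [f4.real a (by simp [realWrites, initTables]), r3]
    have hsum := run_sumPairs hsizes (by rw [rr]; exact S.keysInj_initialState) (by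
      rw [rr]
      intro i hi
      simpa [hs, initialState, hi] using (S.prob_mem ⟨i, hi⟩).2)
    rw [rr, f4.nat 1 (by decide), w 1 (by simp)] at hsum
    rw [S.freeBasisDominanceProb_eq, ← hsum]
    rfl

theorem mainTheorem5 :
    ∃ (P : RealRAM.Program) (T : ℕ → ℕ),
      Asymptotics.IsBigO Filter.atTop (fun n : ℕ => (T n : ℝ))
        (fun n : ℕ => (n : ℝ) ^ 4 * Real.log (n : ℝ) ^ 2) ∧
      ∀ (n : ℕ) (S : ColoredStochasticDataset 2 n),
        ∃ (t : ℕ) (s : RealRAM.State),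
          RealRAM.Exec P S.initialState t s ∧ t ≤ T n ∧
            s.output = S.freeBasisDominanceProb :=
  ⟨RealRAM.Cmd.whole.toProgram, fun n => RealRAM.Cmd.whole.time (RealRAM.Cmd.boundValue n),
    RealRAM.Cmd.isBigO_time_whole, fun _ S => S.exec_whole⟩
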